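/- Let $n\ge 1$, $1\le k\le n$, $\Pi=\{(x,t): 0<x<1,\ t>0\}$, $\Pi^T=\{(x,t): 0<x<1,\ 0<t<T\}$, and let $\|\cdot\|$ be the Euclidean norm on $\mathbb R^n$ (and the operator norm for matrices). Consider the problem $$(\partial_t+\Lambda(x,t)\partial_x)u=f(x,t,u)\ \text{ in }\Pi,\qquad u(x,0)=\varphi(x),\ x\in(0,1),$$ $$u_i(0,t)=h_i(t,v(t)),\ k+1\le i\le n,\qquad u_i(1,t)=h_i(t,v(t)),\ 1\le i\le k,\qquad t>0,$$ for $u:\overline\Pi\to\mathbb R^n$, where $\Lambda=\mathrm{diag}(\lambda_1,\dots,\lambda_n)$ with $\lambda_1,\dots,\lambda_k<0$ and $\lambda_{k+1},\dots,\lambda_n>0$ on $\overline\Pi$, and $v(t)=(u_1(0,t),\dots,u_k(0,t),u_{k+1}(1,t),\dots,u_n(1,t))$. Assume that: (i) $\lambda_i$ and $\partial_x\lambda_i$ exist and are continuous on $\overline\Pi$; $\varphi\in C^1([0,1];\mathbb R^n)$; $f$, $\partial_xf$ and $\nabla_yf$ exist and are continuous on $\overline\Pi\times\mathbb R^n$ (arguments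 $(x,t,y)$); $h=h(t,z)\in C^1([0,\infty)\times\mathbb R^n;\mathbb R^n)$. (ii) $\nabla_zh$ is bounded on $K\times\mathbb R^n$ for every compact $K\subset[0,\infty)$. (iii) For each $T>0$ there are $C_f>0$ and a polynomial $F(x,t,r)$ in $r$ with coefficients in $C^1(\overline{\Pi^T})$ such that for all $(x,t)\in\overline{\Pi^T}$ and $y\in\mathbb R^n$ one has $F(x,t,\|y\|)>1$ (so that $\log\log F$ is defined) and $$\|\nabla_yf(x,t,y)\|\le C_f\log\log F(x,t,\|y\|).$$ (iv) The compatibility conditions of order zero and one hold: put $x_i^{\rm in}=1$, $x_i^{\rm out}=0$ for $i\le k$ and $x_i^{\rm in}=0$, $x_i^{\rm out}=1$ for $i>k$; let $g_i(x)=f_i(x,0,\varphi(x))-\lambda_i(x,0)\varphi_i'(x)$, $v^0=(\varphi_i(x_i^{\rm out}))_{i=1}^n$ and $v^1=(g_i(x_i^{\rm out}))_{i=1}^n$; then for every $i$ $$\varphi_i(x_i^{\rm in})=h_i(0,v^0),\qquad g_i(x_i^{\rm in})=\partial_th_i(0,v^0)+\nabla_zh_i(0,v^0)\cdot v^1 .$$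 Call $u$ a classical solution if $u\in C(\overline\Pi)\cap C^1(\Pi)$ and $u$ satisfies the differential equations, the initial condition and the boundary conditions pointwise. Then the problem has a classical solution in $\Pi$, this solution belongs to $C^1(\overline\Pi)$, and it is the only classical solution. -/

import Mathlib

open Set

namespace HypIBVP

/-- Euclidean space `ℝⁿ`. -/
abbrev E (n : ℕ) : Type := EuclideanSpace ℝ (Fin n)

/-- The open half-strip `Π = {(x, t) | 0 < x < 1, t > 0}`; points are pairs `(x, t)`. -/
def strip : Set (ℝ × ℝ) := Ioo 0 1 ×ˢ Ioi 0

/-- The closed half-strip, the closure of `Π`. -/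
def closedStrip : Set (ℝ × ℝ) := Icc 0 1 ×ˢ Ici 0

/-- The closed rectangle, the closure of `Π^T = {(x, t) | 0 < x < 1, 0 < t < T}`. -/
def closedRect (T : ℝ) : Set (ℝ × ℝ) := Icc 0 1 ×ˢ Icc 0 T

/-- The abscissa of the boundary side on which the boundary condition for the `i`-th unknown is
posed: `x = 1` for the first `k` indices (negative speeds), `x = 0` for the others. -/
def inflow {n : ℕ} (k : ℕ) (i : Fin n) : ℝ := if i.val < k then 1 else 0

/-- The abscissa of the opposite side: `x = 0` for the first `k` indices, `x = 1` for the others. -/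
def outflow {n : ℕ} (k : ℕ) (i : Fin n) : ℝ := if i.val < k then 0 else 1

/-- The vector `(w₁(0), …, w_k(0), w_{k+1}(1), …, w_n(1))`. -/
noncomputable def outTrace {n : ℕ} (k : ℕ) (w : ℝ → E n) : E n :=
  WithLp.toLp 2 fun i => w (outflow k i) i

/-- `λ` is continuous on the closed half-strip and continuously differentiable in `x` there: the
partial derivative in `x` (one-sided at `x = 0, 1`) exists and is continuous in `(x, t)`. -/
def SpeedRegular (lam : ℝ × ℝ → ℝ) : Prop :=
  ContinuousOn lam closedStrip ∧
  (∀ x ∈ Icc (0 : ℝ) 1, ∀ t ∈ Ici (0 : ℝ),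
    DifferentiableWithinAt ℝ (fun ξ => lam (ξ, t)) (Icc 0 1) x) ∧
  ContinuousOn (fun p : ℝ × ℝ => derivWithin (fun ξ => lam (ξ, p.2)) (Icc 0 1) p.1) closedStrip

/-- `f` is continuous, and continuously differentiable in `x` and in `y`: the partial derivatives
in `x` and in `y` exist and are continuous functions of `(x, t, y)`. -/
def SourceRegular {n : ℕ} (f : ℝ × ℝ → E n → E n) : Prop :=
  ContinuousOn (fun q : (ℝ × ℝ) × E n => f q.1 q.2) (closedStrip ×ˢ univ) ∧
  (∀ x ∈ Icc (0 : ℝ) 1, ∀ t ∈ Ici (0 : ℝ), ∀ y : E n,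
    DifferentiableWithinAt ℝ (fun ξ => f (ξ, t) y) (Icc 0 1) x) ∧
  ContinuousOn (fun q : (ℝ × ℝ) × E n =>
    derivWithin (fun ξ => f (ξ, q.1.2) q.2) (Icc 0 1) q.1.1) (closedStrip ×ˢ univ) ∧
  (∀ p ∈ closedStrip, Differentiable ℝ (f p)) ∧
  ContinuousOn (fun q : (ℝ × ℝ) × E n => fderiv ℝ (f q.1) q.2) (closedStrip ×ˢ univ)

/-- `h` is `C¹` in both arguments on `[0, ∞) × ℝⁿ`. -/
def BoundaryRegular {n : ℕ} (h : ℝ → E n → E n) : Prop :=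
  ContDiffOn ℝ 1 (fun q : ℝ × E n => h q.1 q.2) (Ici 0 ×ˢ univ)

/-- `∇_z h` is bounded on `K × ℝⁿ` for every compact `K ⊆ [0, ∞)`. -/
def BoundaryGradBounded {n : ℕ} (h : ℝ → E n → E n) : Prop :=
  ∀ K : Set ℝ, IsCompact K → K ⊆ Ici 0 → ∃ C : ℝ, ∀ t ∈ K, ∀ z : E n, ‖fderiv ℝ (h t) z‖ ≤ C

/-- For each `T > 0` there are `C > 0` and a polynomial `F(x, t, r) = ∑ c_j(x, t) r^j` in `r` with
coefficients in `C¹` of the closed rectangle such that `‖∇_y f(x, t, y)‖ ≤ C log log F(x, t, ‖y‖)`.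
The condition `1 < F` says that the iterated logarithm is meaningful. -/
def SourceGradGrowth {n : ℕ} (f : ℝ × ℝ → E n → E n) : Prop :=
  ∀ T : ℝ, 0 < T → ∃ C : ℝ, 0 < C ∧ ∃ (d : ℕ) (c : ℕ → ℝ × ℝ → ℝ),
    (∀ j, ContDiffOn ℝ 1 (c j) (closedRect T)) ∧
    ∀ p ∈ closedRect T, ∀ y : E n,
      1 < ∑ j ∈ Finset.range (d + 1), c j p * ‖y‖ ^ j ∧
      ‖fderiv ℝ (f p) y‖ ≤
        C * Real.log (Real.log (∑ j ∈ Finset.range (d + 1), c j p * ‖y‖ ^ j))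

/-- Zero-order compatibility: `φ_i = h_i(0, v(0))` at the inflow end of the `i`-th component, where
`v(0) = (φ₁(0), …, φ_k(0), φ_{k+1}(1), …, φ_n(1))`. -/
def ZeroOrderCompatible {n : ℕ} (k : ℕ) (φ : ℝ → E n) (h : ℝ → E n → E n) : Prop :=
  ∀ i : Fin n, φ (inflow k i) i = h 0 (outTrace k φ) i

/-- The function `x ↦ f(x, 0, φ(x)) - Λ(x, 0) φ'(x)`, which is the initial value of `∂_t u`
prescribed by the differential equations. -/
noncomputable def initialVelocity {n : ℕ} (lam : Fin n → ℝ × ℝ → ℝ) (f : ℝ × ℝ → E n → E n)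
    (φ : ℝ → E n) (x : ℝ) : E n :=
  WithLp.toLp 2 fun i =>
    f (x, 0) (φ x) i - lam i (x, 0) * derivWithin (fun ξ => φ ξ i) (Icc 0 1) x

/-- First-order compatibility: at the inflow end of the `i`-th component,
`f_i - λ_i φ_i' = ∂_t h_i(0, v(0)) + ∇_v h_i(0, v(0)) · v'(0)`. -/
def FirstOrderCompatible {n : ℕ} (k : ℕ) (lam : Fin n → ℝ × ℝ → ℝ) (f : ℝ × ℝ → E n → E n)
    (φ : ℝ → E n) (h : ℝ → E n → E n) : Prop :=
  ∀ i : Fin n, initialVelocity lam f φ (inflow k i) i =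
    derivWithin (fun t => h t (outTrace k φ) i) (Ici 0) 0 +
      fderiv ℝ (fun z => h 0 z i) (outTrace k φ) (outTrace k (initialVelocity lam f φ))

/-- `u` is a classical solution of the problem in `Π`: it is continuous on the closed half-strip,
continuously differentiable in `Π`, and satisfies the differential equations, the initial
condition and the boundary conditions pointwise. -/
structure IsClassicalSolution {n : ℕ} (k : ℕ) (lam : Fin n → ℝ × ℝ → ℝ)
    (f : ℝ × ℝ → E n → E n) (φ : ℝ → E n) (h : ℝ → E n → E n) (u : ℝ × ℝ → E n) : Prop where
  continuousOn : ContinuousOn u closedStrip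
  contDiffOn : ContDiffOn ℝ 1 u strip
  equation : ∀ x ∈ Ioo (0 : ℝ) 1, ∀ t ∈ Ioi (0 : ℝ), ∀ i : Fin n,
    deriv (fun s => u (x, s) i) t + lam i (x, t) * deriv (fun ξ => u (ξ, t) i) x =
      f (x, t) (u (x, t)) i
  initial : ∀ x ∈ Ioo (0 : ℝ) 1, u (x, 0) = φ x
  boundary : ∀ t ∈ Ioi (0 : ℝ), ∀ i : Fin n,
    u (inflow k i, t) i = h t (outTrace k fun x => u (x, t)) i

end HypIBVP

open HypIBVP

/-!
The problem is solved up to a fixed time `T` by a Picard iteration: given an iterate `v`, each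
component of the next iterate solves a *scalar* linear transport equation whose source and boundary
values are computed from `v`. Scalar problems are solved by characteristics
(`CharFlow.exists_transport`, `exists_isTransport`). The compatibility conditions make the solution
continuously differentiable across the characteristic that issues from the corner, and these
conditions are inherited by the next iterate.

All estimates follow from one maximum principle along characteristics, `le_wt_of_along`, for the
weights `exp (γ t - μ d)`, where `d` is the distance to the inflow side of the component. A large
`μ` makes the reflection at the boundary a contraction, because the values that are reflected are
taken at distance one from the inflow side. A large `γ`, of the form `const + const * K`,
compensates a source with Lipschitz constant `K`. In these weights a step of the iteration is a
contraction on the whole interval `[0, T]` (`RectBounds.wtBound_of_along`, `Solves.wtBound_sub`).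

The source is only locally Lipschitz continuous, with a constant `K = K(R)` in the ball of radius
`R`. The a priori bound of the iterates is of the form `const * exp (γ T)`, and it does not depend
on `K` except through `γ`. As `K(R)` grows at most like `log log R`, the factor `exp (γ T)` is at
most a power of `log R`; so the bound is smaller than `R` for a suitable `R`
(`SourceGradGrowth.exists_radius`), and the iterates never leave the ball.

The derivatives of the iterates satisfy linear equations whose coefficients depend on the iterates.
They are bounded, and they contract up to errors that tend to zero as the iterates converge
(`Iterate.IsStep.wtBound_derivatives_sub`), so they converge uniformly and the limit is `C¹` up to
the boundary. The same contraction estimate gives uniqueness (`IsLocalSolution.eqOn`); hence the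
solutions for different `T` fit together (`Admissible.exists_unique_solution`).
-/

namespace HypIBVP

open Filter Topology MeasureTheory

/-! ### Calculus on closed intervals and rectangles -/

/-- A `C¹` extension to the real line of a function `q` on `[l, r]` with derivative `q'`. The sine
keeps the extension and its derivative bounded. -/
noncomputable def ext (l r : ℝ) (q q' : ℝ → ℝ) (x : ℝ) : ℝ :=
  q (max l (min r x)) + q' (max l (min r x)) * Real.sin (x - max l (min r x))

/-- The derivative of `ext l r q q'`. -/
noncomputable def extDeriv (l r : ℝ) (q' : ℝ → ℝ) (x : ℝ) : ℝ :=
  q' (max l (min r x)) * Real.cos (x - max l (min r x))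

lemma clamp_mem {l r : ℝ} (hlr : l ≤ r) (x : ℝ) : max l (min r x) ∈ Icc l r :=
  ⟨le_max_left _ _, max_le hlr (min_le_left _ _)⟩

lemma clamp_of_mem {l r x : ℝ} (hx : x ∈ Icc l r) : max l (min r x) = x := by
  rw [min_eq_right hx.2, max_eq_right hx.1]

lemma ext_of_mem {l r x : ℝ} (q q' : ℝ → ℝ) (hx : x ∈ Icc l r) : ext l r q q' x = q x := by
  simp [ext, clamp_of_mem hx]

lemma extDeriv_of_mem {l r x : ℝ} (q' : ℝ → ℝ) (hx : x ∈ Icc l r) :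
    extDeriv l r q' x = q' x := by
  simp [extDeriv, clamp_of_mem hx]

lemma hasDerivAt_ext {l r : ℝ} (hlr : l < r) {q q' : ℝ → ℝ}
    (hq : ∀ x ∈ Icc l r, HasDerivWithinAt q (q' x) (Icc l r) x) (x : ℝ) :
    HasDerivAt (ext l r q q') (extDeriv l r q' x) x := by
  have hI : ∀ x ∈ Icc l r, HasDerivWithinAt (ext l r q q') (extDeriv l r q' x) (Icc l r) x := by
    intro x hx
    rw [extDeriv_of_mem q' hx]
    exact (hq x hx).congr (fun y hy => ext_of_mem q q' hy) (ext_of_mem q q' hx)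
  have hL : ∀ x ≤ l, HasDerivWithinAt (ext l r q q') (extDeriv l r q' x) (Iic l) x := by
    intro x hx
    have e : ∀ y ≤ l, max l (min r y) = l := fun y hy => by
      rw [max_eq_left]; exact (min_le_right _ _).trans hy
    have : HasDerivAt (fun y => q l + q' l * Real.sin (y - l)) (q' l * Real.cos (x - l)) x := by
      simpa using (((hasDerivAt_id x).sub_const l).sin.const_mul (q' l)).const_add (q l)
    have h2 : extDeriv l r q' x = q' l * Real.cos (x - l) := by simp only [extDeriv, e x hx]
    rw [h2]
    exact this.hasDerivWithinAt.congr (fun y hy => by simp only [ext, e y hy])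
      (by simp only [ext, e x hx])
  have hR : ∀ x ≥ r, HasDerivWithinAt (ext l r q q') (extDeriv l r q' x) (Ici r) x := by
    intro x hx
    have e : ∀ y ≥ r, max l (min r y) = r := fun y hy => by
      rw [min_eq_left hy, max_eq_right hlr.le]
    have : HasDerivAt (fun y => q r + q' r * Real.sin (y - r)) (q' r * Real.cos (x - r)) x := by
      simpa using (((hasDerivAt_id x).sub_const r).sin.const_mul (q' r)).const_add (q r)
    have h2 : extDeriv l r q' x = q' r * Real.cos (x - r) := by simp only [extDeriv, e x hx]
    rw [h2]
    exact this.hasDerivWithinAt.congr (fun y hy => by simp only [ext, e y hy])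
      (by simp only [ext, e x hx])
  rcases lt_trichotomy x l with h | rfl | h
  · exact (hL x h.le).hasDerivAt (Iic_mem_nhds h)
  · have := (hL x le_rfl).union (hI x ⟨le_rfl, hlr.le⟩)
    exact this.hasDerivAt (by rw [Iic_union_Icc_eq_Iic hlr.le]; exact Iic_mem_nhds hlr)
  rcases lt_trichotomy x r with h' | rfl | h'
  · exact (hI x ⟨h.le, h'.le⟩).hasDerivAt (Icc_mem_nhds h h')
  · have := (hI x ⟨hlr.le, le_rfl⟩).union (hR x le_rfl)
    exact this.hasDerivAt (by rw [Icc_union_Ici_eq_Ici hlr.le]; exact Ici_mem_nhds hlr)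
  · exact (hR x h'.le).hasDerivAt (Ici_mem_nhds h')

/-- Uniform convergence of functions and derivatives on a closed interval gives the derivative of
the limit, up to the end points. -/
lemma hasDerivWithinAt_Icc_of_tendstoUniformlyOn {l r : ℝ} (hlr : l < r) {q q' : ℕ → ℝ → ℝ}
    {Q Q' : ℝ → ℝ} (hq : ∀ m, ∀ x ∈ Icc l r, HasDerivWithinAt (q m) (q' m x) (Icc l r) x)
    (hQ : ∀ x ∈ Icc l r, Tendsto (fun m => q m x) atTop (𝓝 (Q x)))
    (hQ' : TendstoUniformlyOn q' Q' atTop (Icc l r)) :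
    ∀ x ∈ Icc l r, HasDerivWithinAt Q (Q' x) (Icc l r) x := by
  intro x hx
  have key : HasDerivAt (ext l r Q Q') (extDeriv l r Q' x) x := by
    refine hasDerivAt_of_tendstoUniformly (l := atTop) (f := fun m => ext l r (q m) (q' m))
      (f' := fun m => extDeriv l r (q' m)) ?_ (.of_forall fun m => hasDerivAt_ext hlr (hq m)) ?_ x
    · rw [Metric.tendstoUniformly_iff]
      intro ε hε
      filter_upwards [(Metric.tendstoUniformlyOn_iff.1 hQ') ε hε] with m hm y
      refine lt_of_le_of_lt ?_ (hm _ (clamp_mem hlr.le y))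
      simp only [extDeriv, Real.dist_eq, ← sub_mul, abs_mul]
      exact mul_le_of_le_one_right (abs_nonneg _) (Real.abs_cos_le_one _)
    · intro y
      have hy := clamp_mem hlr.le y
      exact (hQ _ hy).add ((hQ'.tendsto_at hy).mul_const _)
  rw [extDeriv_of_mem Q' hx] at key
  exact key.hasDerivWithinAt.congr (fun y hy => (ext_of_mem Q Q' hy).symm)
    (ext_of_mem Q Q' hx).symm

/-- If the derivatives of the functions `f χ` tend to `φ` near `u`, then the increment of `f χ`
between `u` and `v χ → u` is `φ (v χ - u)` to first order. -/
lemma isLittleO_sub_sub_of_tendsto_fderiv {α E F : Type*} [NormedAddCommGroup E] [NormedSpace ℝ E]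
    [NormedAddCommGroup F] [NormedSpace ℝ F] {u : E} {v : α → E} {l : Filter α} {s : Set E}
    (hs : Convex ℝ s) (hu : u ∈ s) (hv : Tendsto v l (𝓝 u)) (hvs : ∀ᶠ χ in l, v χ ∈ s)
    {f : α → E → F} {f' : α → E → E →L[ℝ] F} {φ : E →L[ℝ] F}
    (df : ∀ᶠ p in l ×ˢ 𝓝[s] u, HasFDerivWithinAt (f p.1) (f' p.1 p.2) s p.2)
    (cf : Tendsto (fun p : α × E => f' p.1 p.2) (l ×ˢ 𝓝[s] u) (𝓝 φ)) :
    (fun χ => f χ (v χ) - f χ u - φ (v χ - u)) =o[l] (fun χ => v χ - u) := by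
  rw [Asymptotics.isLittleO_iff]
  intro ε hε
  have cf' := (Metric.tendsto_nhds.1 cf) ε hε
  obtain ⟨A, hA, B, hB, hAB⟩ := eventually_prod_iff.1 (df.and cf')
  obtain ⟨δ, hδ, hball⟩ := Metric.mem_nhdsWithin_iff.1 hB
  filter_upwards [hA, hvs, (Metric.tendsto_nhds.1 hv) δ hδ] with χ h1 h2 h3
  have hsub : ∀ x ∈ Metric.ball u δ ∩ s, B x := fun x hx => hball hx
  refine Convex.norm_image_sub_le_of_norm_hasFDerivWithin_le' (f := f χ) (f' := f' χ)
    (s := Metric.ball u δ ∩ s) (fun x hx => (hAB h1 (hsub x hx)).1.mono inter_subset_right)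
    (fun x hx => ?_) ((convex_ball u δ).inter hs) ⟨Metric.mem_ball_self hδ, hu⟩ ⟨h3, h2⟩
  have := (hAB h1 (hsub x hx)).2
  rw [dist_eq_norm] at this
  exact this.le

/-- A function with partial derivatives on a product of two sets, the first of them convex, is
differentiable if the first partial derivative is continuous. -/
lemma hasFDerivWithinAt_of_partial {E₁ E₂ F : Type*} [NormedAddCommGroup E₁] [NormedSpace ℝ E₁]
    [NormedAddCommGroup E₂] [NormedSpace ℝ E₂] [NormedAddCommGroup F] [NormedSpace ℝ F]
    {s : Set E₁} {t : Set E₂} (hs : Convex ℝ s) {f : E₁ → E₂ → F} {f₁ : E₁ × E₂ → E₁ →L[ℝ] F}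
    {f₂ : E₂ →L[ℝ] F} {u : E₁ × E₂} (hu : u ∈ s ×ˢ t)
    (h₁ : ∀ x ∈ s, ∀ y ∈ t, HasFDerivWithinAt (fun x => f x y) (f₁ (x, y)) s x)
    (hc : ContinuousWithinAt f₁ (s ×ˢ t) u)
    (h₂ : HasFDerivWithinAt (f u.1) f₂ t u.2) :
    HasFDerivWithinAt (fun p : E₁ × E₂ => f p.1 p.2) ((f₁ u).coprod f₂) (s ×ˢ t) u := by
  have hl1 : Tendsto (fun p : E₁ × E₂ => p.1) (𝓝[s ×ˢ t] u) (𝓝[s] u.1) :=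
    tendsto_fst.mono_left (by rw [nhdsWithin_prod_eq])
  have hl2 : Tendsto (fun p : E₁ × E₂ => p.2) (𝓝[s ×ˢ t] u) (𝓝[t] u.2) :=
    tendsto_snd.mono_left (by rw [nhdsWithin_prod_eq])
  have a1 := isLittleO_sub_sub_of_tendsto_fderiv hs hu.1 (v := fun p : E₁ × E₂ => p.1)
    (l := 𝓝[s ×ˢ t] u) (hl1.mono_right nhdsWithin_le_nhds)
    (by filter_upwards [self_mem_nhdsWithin] with p hp using hp.1)
    (f := fun (p : E₁ × E₂) x => f x p.2) (f' := fun p x => f₁ (x, p.2)) (φ := f₁ u) (by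
      have : ∀ᶠ q in (𝓝[s ×ˢ t] u) ×ˢ 𝓝[s] u.1, q.1 ∈ s ×ˢ t ∧ q.2 ∈ s :=
        Eventually.prod_mk (self_mem_nhdsWithin (a := u)) (self_mem_nhdsWithin (a := u.1))
      filter_upwards [this] with q hq
      exact h₁ _ hq.2 _ hq.1.2) (by
      have hc' : Tendsto f₁ (𝓝[s] u.1 ×ˢ 𝓝[t] u.2) (𝓝 (f₁ u)) := by
        rw [← nhdsWithin_prod_eq]; exact hc
      exact hc'.comp ((tendsto_snd (f := 𝓝[s ×ˢ t] u) (g := 𝓝[s] u.1)).prodMk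
        (hl2.comp tendsto_fst)))
  have a2 := (h₂.isLittleO).comp_tendsto hl2
  rw [hasFDerivWithinAt_iff_isLittleO]
  have b1 : (fun p : E₁ × E₂ => p.1 - u.1) =O[𝓝[s ×ˢ t] u] fun p => p - u :=
    Asymptotics.isBigO_of_le _ fun p => norm_fst_le (p - u)
  have b2 : (fun p : E₁ × E₂ => p.2 - u.2) =O[𝓝[s ×ˢ t] u] fun p => p - u :=
    Asymptotics.isBigO_of_le _ fun p => norm_snd_le (p - u)
  refine ((a1.trans_isBigO b1).add (a2.trans_isBigO b2)).congr_left fun p => ?_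
  simp only [Function.comp, ContinuousLinearMap.coprod_apply, Prod.fst_sub, Prod.snd_sub]
  abel

/-- If `w` has a continuous `x`-derivative `z` near `(η t, t)` and the derivative of `w` along the
curve `η` at time `t` is `g`, then `∂_t w = g - η' z`. -/
lemma hasDerivAt_time_of_along {w z : ℝ × ℝ → ℝ} {η : ℝ → ℝ} {t l g : ℝ}
    (hz : ∀ᶠ p in 𝓝 (η t, t), HasDerivAt (fun ξ => w (ξ, p.2)) (z p) p.1)
    (hzc : ContinuousAt z (η t, t)) (hη : HasDerivAt η l t)
    (hw : HasDerivAt (fun s => w (η s, s)) g t) :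
    HasDerivAt (fun s => w (η t, s)) (g - l * z (η t, t)) t := by
  have hsw : Tendsto (fun p : ℝ × ℝ => (p.2, p.1)) (𝓝 t ×ˢ 𝓝[univ] (η t)) (𝓝 (η t, t)) := by
    rw [nhdsWithin_univ, nhds_prod_eq]; exact tendsto_snd.prodMk tendsto_fst
  have a1 := isLittleO_sub_sub_of_tendsto_fderiv convex_univ (mem_univ (η t)) (v := fun s => η s)
    (l := 𝓝 t) hη.continuousAt (by simp) (f := fun s x => w (x, s))
    (f' := fun s x => ContinuousLinearMap.toSpanSingleton ℝ (z (x, s)))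
    (φ := ContinuousLinearMap.toSpanSingleton ℝ (z (η t, t))) (by
      filter_upwards [hsw.eventually hz] with p hp
      exact hp.hasFDerivAt.hasFDerivWithinAt)
    (((ContinuousLinearMap.toSpanSingletonCLE (𝕜 := ℝ) (E := ℝ)).continuous.tendsto _).comp
      (hzc.tendsto.comp hsw))
  have hO : (fun s => η s - η t) =O[𝓝 t] fun s => s - t := hη.isBigO_sub
  have a2 := a1.trans_isBigO hO
  have a3 := hw.isLittleO
  have a4 := (hη.isLittleO).const_mul_left (z (η t, t))
  rw [hasDerivAt_iff_isLittleO]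
  refine ((a3.sub a2).sub a4).congr_left fun s => ?_
  simp [smul_eq_mul]
  ring

/-- Gluing two functions at a point where they agree to first order. -/
lemma glue_at {F F' G G' : ℝ → ℝ} {a : ℝ} {D : Set ℝ}
    (hF : ∀ y ∈ D, a ≤ y → HasDerivAt F (F' y) y ∧ ContinuousAt F' y)
    (hG : ∀ y ∈ D, y ≤ a → HasDerivAt G (G' y) y ∧ ContinuousAt G' y)
    (h0 : F a = G a) (h1 : F' a = G' a) :
    ∀ y ∈ D, HasDerivAt (fun y => if a ≤ y then F y else G y) (if a ≤ y then F' y else G' y) y ∧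
      ContinuousAt (fun y => if a ≤ y then F' y else G' y) y := by
  intro y hy
  rcases lt_trichotomy y a with h | rfl | h
  · have e : ∀ᶠ x in 𝓝 y, ¬ a ≤ x := by
      filter_upwards [Iio_mem_nhds h] with x hx using not_le.2 hx
    obtain ⟨d, c⟩ := hG y hy h.le
    rw [if_neg (not_le.2 h)]
    exact ⟨d.congr_of_eventuallyEq (e.mono fun x hx => if_neg hx),
      c.congr (e.mono fun x hx => (if_neg hx).symm)⟩
  · obtain ⟨dF, cF⟩ := hF y hy le_rfl
    obtain ⟨dG, cG⟩ := hG y hy le_rfl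
    rw [if_pos le_rfl]
    have eL : ∀ (A B : ℝ → ℝ), A y = B y → ∀ x ∈ Iic y, (if y ≤ x then A x else B x) = B x := by
      intro A B hAB x hx
      split_ifs with h
      · rw [le_antisymm hx h, hAB]
      · rfl
    constructor
    · have hR : HasDerivWithinAt (fun x => if y ≤ x then F x else G x) (F' y) (Ici y) y :=
        dF.hasDerivWithinAt.congr (fun x hx => if_pos hx) (if_pos le_rfl)
      have hL : HasDerivWithinAt (fun x => if y ≤ x then F x else G x) (F' y) (Iic y) y := by
        rw [h1]
        exact dG.hasDerivWithinAt.congr (eL F G h0) (eL F G h0 y self_mem_Iic)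
      have := hL.union hR
      rwa [Iic_union_Ici, hasDerivWithinAt_univ] at this
    · rw [continuousAt_iff_continuous_left_right]
      exact ⟨cG.continuousWithinAt.congr (eL F' G' h1) (eL F' G' h1 y self_mem_Iic),
        cF.continuousWithinAt.congr (fun x hx => if_pos hx) (if_pos le_rfl)⟩
  · have e : ∀ᶠ x in 𝓝 y, a ≤ x := by
      filter_upwards [Ioi_mem_nhds h] with x hx using le_of_lt hx
    obtain ⟨d, c⟩ := hF y hy h.le
    rw [if_pos h.le]
    exact ⟨d.congr_of_eventuallyEq (e.mono fun x hx => if_pos hx),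
      c.congr (e.mono fun x hx => (if_pos hx).symm)⟩

/-! ### The flow of a scalar differential equation -/

/-- A bounded vector field that is Lipschitz in space has integral curves for all times. -/
lemma exists_global_solution {v : ℝ → ℝ → ℝ} {L K : NNReal} (hLip : ∀ t, LipschitzWith K (v t))
    (hc : ∀ x, Continuous fun t => v t x) (hb : ∀ t x, |v t x| ≤ L) (t₀ x₀ : ℝ) :
    ∃ α : ℝ → ℝ, α t₀ = x₀ ∧ ∀ t, HasDerivAt α (v t (α t)) t := by
  have loc : ∀ N : ℕ, ∃ α : ℝ → ℝ, α t₀ = x₀ ∧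
      ∀ t ∈ Ioo (t₀ - N) (t₀ + N), HasDerivAt α (v t (α t)) t := by
    intro N
    have hN : (0 : ℝ) ≤ N := N.cast_nonneg
    have hp : IsPicardLindelof v (tmin := t₀ - N) (tmax := t₀ + N)
        ⟨t₀, by constructor <;> linarith⟩ x₀ (L * N) 0 L K :=
      { lipschitzOnWith := fun t _ => (hLip t).lipschitzOnWith
        continuousOn := fun x _ => (hc x).continuousOn
        norm_le := fun t _ x _ => hb t x
        mul_max_le := by simp }
    obtain ⟨α, h0, hα⟩ := hp.exists_eq_forall_mem_Icc_hasDerivWithinAt₀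
    exact ⟨α, h0, fun t ht => (hα t (Ioo_subset_Icc_self ht)).hasDerivAt (Icc_mem_nhds ht.1 ht.2)⟩
  choose α h0 hα using loc
  have agree : ∀ N M : ℕ, 0 < N → N ≤ M → EqOn (α N) (α M) (Ioo (t₀ - N) (t₀ + N)) := by
    intro N M hN hNM
    have hN' : (0 : ℝ) < N := by exact_mod_cast hN
    have hNM' : (N : ℝ) ≤ M := by exact_mod_cast hNM
    refine ODE_solution_unique_of_mem_Ioo (v := v) (s := fun _ => univ) (K := K) (t₀ := t₀)
      (fun t _ => (hLip t).lipschitzOnWith) ⟨by linarith, by linarith⟩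
      (fun t ht => ⟨hα N t ht, trivial⟩)
      (fun t ht => ⟨hα M t ⟨by linarith [ht.1], by linarith [ht.2]⟩, trivial⟩)
      ((h0 N).trans (h0 M).symm)
  let n : ℝ → ℕ := fun t => ⌈|t - t₀|⌉₊ + 1
  have hn : ∀ t, |t - t₀| < n t := fun t => by
    have := Nat.le_ceil |t - t₀|
    simp only [n]; push_cast; linarith
  have hmem : ∀ (t : ℝ) (N : ℕ), |t - t₀| < N → t ∈ Ioo (t₀ - N) (t₀ + N) := fun t N h => by
    rw [abs_lt] at h; constructor <;> linarith [h.1, h.2]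
  have eq : ∀ (t : ℝ) (N : ℕ), |t - t₀| < N → α (n t) t = α N t := by
    intro t N hN
    have hN0 : 0 < N := by
      have := (abs_nonneg _).trans_lt hN
      exact_mod_cast this
    rcases le_total (n t) N with h | h
    · exact agree _ _ (Nat.succ_pos _) h (hmem _ _ (hn t))
    · exact (agree _ _ hN0 h (hmem _ _ hN)).symm
  refine ⟨fun t => α (n t) t, h0 _, fun t => ?_⟩
  have ev : ∀ᶠ s in 𝓝 t, |s - t₀| < n t :=
    (by fun_prop : Continuous fun s => |s - t₀|).continuousAt.eventually_lt_const (hn t)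
  exact (hα (n t) t (hmem _ _ (hn t))).congr_of_eventuallyEq (ev.mono fun s hs => eq s _ hs)

/-- The increment of a `C¹` function as its mean derivative times the increment of the variable. -/
lemma sub_eq_mul_integral {q q' : ℝ → ℝ} (hq : ∀ x, HasDerivAt q (q' x) x) (hc : Continuous q')
    (a b : ℝ) : q b - q a = (b - a) * ∫ θ in (0 : ℝ)..1, q' (a + θ * (b - a)) := by
  have h : ∀ θ ∈ uIcc (0 : ℝ) 1,
      HasDerivAt (fun θ => q (a + θ * (b - a))) (q' (a + θ * (b - a)) * (b - a)) θ := fun θ _ =>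
    (hq _).comp θ (by simpa using ((hasDerivAt_id θ).mul_const (b - a)).const_add a)
  have := intervalIntegral.integral_eq_sub_of_hasDerivAt h
    (Continuous.intervalIntegrable (by fun_prop) _ _)
  rw [intervalIntegral.integral_mul_const] at this
  simp only [one_mul, zero_mul, add_zero, add_sub_cancel] at this
  rw [← this, mul_comm]

/-- A speed `v(x, t)` on the plane, bounded and continuous with a bounded continuous `x`-derivative
`v'`. -/
structure PlaneSpeed (v v' : ℝ × ℝ → ℝ) : Prop where
  cont : Continuous v
  contDeriv : Continuous v'
  deriv : ∀ p : ℝ × ℝ, HasDerivAt (fun ξ => v (ξ, p.2)) (v' p) p.1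
  bound : ∃ L : ℝ, ∀ p, |v p| ≤ L
  boundDeriv : ∃ K : ℝ, ∀ p, |v' p| ≤ K

/-- The flow of `v` in Lagrangian coordinates: `Y (y, s)` is the position at time `s` of the
characteristic that starts at `y` at time `0`, and `X` recovers the label `y` from the position. -/
structure CharFlow (v v' : ℝ × ℝ → ℝ) where
  /-- position at time `s` of the characteristic issuing from `y` -/
  Y : ℝ × ℝ → ℝ
  /-- starting point of the characteristic through `(x, t)` -/
  X : ℝ × ℝ → ℝ
  Y_zero : ∀ y, Y (y, 0) = y
  hasDerivAt_Y : ∀ y s, HasDerivAt (fun s => Y (y, s)) (v (Y (y, s), s)) s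
  continuous_Y : Continuous Y
  hasDerivAt_Y_fst : ∀ y s, HasDerivAt (fun y => Y (y, s))
    (Real.exp (∫ r in (0 : ℝ)..s, v' (Y (y, r), r))) y
  X_Y : ∀ y s, X (Y (y, s), s) = y
  Y_X : ∀ x t, Y (X (x, t), t) = x
  continuous_X : Continuous X

/-- The flow exists, is continuously differentiable in the label, with the exponential of the
integral of `v'` along the characteristic as its derivative, and is invertible because it increases
in the label. -/
theorem PlaneSpeed.nonempty_charFlow {v v' : ℝ × ℝ → ℝ} (h : PlaneSpeed v v') :
    Nonempty (CharFlow v v') := by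
  obtain ⟨L, hL⟩ := h.bound
  obtain ⟨K, hK⟩ := h.boundDeriv
  have hL0 : 0 ≤ L := (abs_nonneg _).trans (hL 0)
  have hK0 : 0 ≤ K := (abs_nonneg _).trans (hK 0)
  have hc := h.cont
  have hc' := h.contDeriv
  have hLip : ∀ t, LipschitzWith K.toNNReal fun x => v (x, t) := fun t =>
    lipschitzWith_of_nnnorm_deriv_le (fun x => (h.deriv (x, t)).differentiableAt) fun x => by
      rw [(h.deriv (x, t)).deriv, ← NNReal.coe_le_coe, coe_nnnorm, Real.coe_toNNReal _ hK0]
      exact hK _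
  have ex := fun t₀ x₀ => exists_global_solution (v := fun t x => v (x, t)) (L := L.toNNReal) hLip
    (fun x => by fun_prop) (fun t x => by rw [Real.coe_toNNReal _ hL0]; exact hL _) t₀ x₀
  choose ω hω0 hω using ex
  have uniq : ∀ {α β : ℝ → ℝ}, (∀ t, HasDerivAt α (v (α t, t)) t) →
      (∀ t, HasDerivAt β (v (β t, t)) t) → ∀ t, α t = β t → α = β := fun hα hβ t e =>
    ODE_solution_unique_univ (v := fun t x => v (x, t)) (s := fun _ => univ)
      (fun t => (hLip t).lipschitzOnWith) (fun t => ⟨hα t, trivial⟩) (fun t => ⟨hβ t, trivial⟩) e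
  let Y : ℝ × ℝ → ℝ := fun p => ω 0 p.1 p.2
  let X : ℝ × ℝ → ℝ := fun p => ω p.2 p.1 0
  have Y0 : ∀ y, Y (y, 0) = y := fun y => hω0 0 y
  have dY : ∀ y s, HasDerivAt (fun s => Y (y, s)) (v (Y (y, s), s)) s := fun y s => hω 0 y s
  have XY : ∀ y s, X (Y (y, s), s) = y := fun y s => by
    have := uniq (hω s (ω 0 y s)) (hω 0 y) s (hω0 _ _)
    change ω s (ω 0 y s) 0 = y
    rw [this, hω0]
  have YX : ∀ x t, Y (X (x, t), t) = x := fun x t => by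
    have := uniq (hω 0 (ω t x 0)) (hω t x) 0 (hω0 _ _)
    change ω 0 (ω t x 0) t = x
    rw [this, hω0]
  clear_value Y X
  have cY : ∀ y, Continuous fun s => Y (y, s) := fun y =>
    continuous_iff_continuousAt.2 fun s => (dY y s).continuousAt
  -- The mean of `v'` between two characteristics. It is the coefficient of a linear equation for
  -- their difference, which is therefore `y' - y` times an exponential.
  let Q : ℝ → ℝ → ℝ → ℝ := fun y y' r =>
    ∫ θ in (0 : ℝ)..1, v' (Y (y, r) + θ * (Y (y', r) - Y (y, r)), r)
  have cQ : ∀ y y', Continuous (Q y y') := fun y y' => by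
    have a := cY y
    have b := cY y'
    exact intervalIntegral.continuous_parametric_intervalIntegral_of_continuous'
      (f := fun r θ => v' (Y (y, r) + θ * (Y (y', r) - Y (y, r)), r)) (by
        change Continuous fun p : ℝ × ℝ =>
          v' (Y (y, p.1) + p.2 * (Y (y', p.1) - Y (y, p.1)), p.1)
        have a' : Continuous fun p : ℝ × ℝ => Y (y, p.1) := a.comp continuous_fst
        have b' : Continuous fun p : ℝ × ℝ => Y (y', p.1) := b.comp continuous_fst
        exact hc'.comp ((a'.add (continuous_snd.mul (b'.sub a'))).prodMk continuous_fst)) 0 1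
  have dist_eq : ∀ y y' s,
      Y (y', s) - Y (y, s) = (y' - y) * Real.exp (∫ r in (0 : ℝ)..s, Q y y' r) := by
    intro y y' s
    have hd : ∀ s, HasDerivAt (fun s => (Y (y', s) - Y (y, s)) *
        Real.exp (-∫ r in (0 : ℝ)..s, Q y y' r)) 0 s := by
      intro s
      have h1 := (dY y' s).sub (dY y s)
      rw [sub_eq_mul_integral (q := fun ξ => v (ξ, s)) (q' := fun ξ => v' (ξ, s))
        (fun x => h.deriv (x, s)) (by fun_prop)] at h1
      have h2 : HasDerivAt (fun s => ∫ r in (0 : ℝ)..s, Q y y' r) (Q y y' s) s :=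
        intervalIntegral.integral_hasDerivAt_right ((cQ y y').intervalIntegrable _ _)
          ((cQ y y').stronglyMeasurableAtFilter _ _) (cQ y y').continuousAt
      refine (h1.mul h2.neg.exp).congr_deriv ?_
      simp only [Q, Pi.sub_apply, Pi.neg_apply]
      ring
    have hcst := is_const_of_deriv_eq_zero (fun s => (hd s).differentiableAt)
      (fun s => (hd s).deriv) s 0
    simp only [intervalIntegral.integral_same, neg_zero, Real.exp_zero, mul_one, Y0] at hcst
    rw [← hcst, mul_assoc, ← Real.exp_add]
    simp
  have hQb : ∀ y y' r, |Q y y' r| ≤ K := fun y y' r => by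
    have := intervalIntegral.norm_integral_le_of_norm_le_const (a := (0 : ℝ)) (b := 1)
      (f := fun θ => v' (Y (y, r) + θ * (Y (y', r) - Y (y, r)), r)) (C := K) (fun θ _ => hK _)
    simpa using this
  have cYy : ∀ s, Continuous fun y => Y (y, s) := by
    intro s
    have : LipschitzWith (Real.exp (K * |s|)).toNNReal fun y => Y (y, s) := by
      refine LipschitzWith.of_dist_le_mul fun y' y => ?_
      rw [Real.dist_eq, Real.dist_eq, dist_eq, abs_mul, Real.abs_exp,
        Real.coe_toNNReal _ (Real.exp_pos _).le, mul_comm]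
      have := intervalIntegral.norm_integral_le_of_norm_le_const (a := (0 : ℝ)) (b := s)
        (f := Q y y') (C := K) (fun r _ => hQb _ _ _)
      rw [sub_zero, Real.norm_eq_abs] at this
      gcongr
      exact (le_abs_self _).trans this
    exact this.continuous
  have contY : Continuous Y := by
    refine continuous_prod_of_continuous_lipschitzWith' Y L.toNNReal (fun y => ?_) cYy
    refine lipschitzWith_of_nnnorm_deriv_le (fun s => (dY y s).differentiableAt) fun s => ?_
    rw [(dY y s).deriv, ← NNReal.coe_le_coe, coe_nnnorm, Real.coe_toNNReal _ hL0]
    exact hL _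
  have dYy : ∀ y s, HasDerivAt (fun y => Y (y, s))
      (Real.exp (∫ r in (0 : ℝ)..s, v' (Y (y, r), r))) y := by
    intro y s
    have cQ3 : Continuous fun y' => Real.exp (∫ r in (0 : ℝ)..s, Q y y' r) := by
      have : Continuous (Function.uncurry fun (y' r : ℝ) => Q y y' r) :=
        intervalIntegral.continuous_parametric_intervalIntegral_of_continuous'
          (f := fun (p : ℝ × ℝ) θ => v' (Y (y, p.2) + θ * (Y (p.1, p.2) - Y (y, p.2)), p.2))
          (by
            change Continuous fun q : (ℝ × ℝ) × ℝ =>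
              v' (Y (y, q.1.2) + q.2 * (Y (q.1.1, q.1.2) - Y (y, q.1.2)), q.1.2)
            fun_prop) 0 1
      exact Real.continuous_exp.comp
        (intervalIntegral.continuous_parametric_intervalIntegral_of_continuous' this 0 s)
    have hval : Real.exp (∫ r in (0 : ℝ)..s, Q y y r) =
        Real.exp (∫ r in (0 : ℝ)..s, v' (Y (y, r), r)) := by simp [Q]
    rw [hasDerivAt_iff_tendsto_slope, ← hval]
    refine (cQ3.continuousAt.tendsto.mono_left nhdsWithin_le_nhds).congr' ?_
    filter_upwards [self_mem_nhdsWithin] with y' hy'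
    have : y' - y ≠ 0 := sub_ne_zero.2 hy'
    rw [slope_def_field, dist_eq]
    field_simp
  have mono : ∀ s, StrictMono fun y => Y (y, s) := fun s =>
    strictMono_of_deriv_pos fun y => by rw [(dYy y s).deriv]; exact Real.exp_pos _
  have contX : Continuous X := by
    rw [continuous_iff_continuousAt]
    rintro ⟨x, t⟩
    rw [Metric.continuousAt_iff']
    intro ε hε
    have hlt : ∀ {q : ℝ × ℝ} {c : ℝ}, Y (c, q.2) < q.1 ↔ c < X q := fun {q c} => by
      conv_lhs => rw [← YX q.1 q.2]
      exact (mono q.2).lt_iff_lt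
    have hgt : ∀ {q : ℝ × ℝ} {c : ℝ}, q.1 < Y (c, q.2) ↔ X q < c := fun {q c} => by
      conv_lhs => rw [← YX q.1 q.2]
      exact (mono q.2).lt_iff_lt
    have e1 : ∀ᶠ q : ℝ × ℝ in 𝓝 (x, t), Y (X (x, t) - ε, q.2) < q.1 :=
      ContinuousAt.eventually_lt (by fun_prop) (by fun_prop)
        ((hlt (q := (x, t))).2 (by linarith))
    have e2 : ∀ᶠ q : ℝ × ℝ in 𝓝 (x, t), q.1 < Y (X (x, t) + ε, q.2) :=
      ContinuousAt.eventually_lt (by fun_prop) (by fun_prop)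
        ((hgt (q := (x, t))).2 (by linarith))
    filter_upwards [e1, e2] with q h1 h2
    rw [hlt] at h1
    rw [hgt] at h2
    rw [Real.dist_eq, abs_lt]
    constructor <;> linarith
  exact ⟨⟨Y, X, Y0, dY, contY, dYy, XY, YX, contX⟩⟩

/-! ### The scalar transport equation -/

/-- Differentiation under the integral sign for a continuous partial derivative. -/
lemma hasDerivAt_integral_of_continuous {F F' : ℝ × ℝ → ℝ} (hF : Continuous F)
    (hF' : Continuous F') (hd : ∀ y s, HasDerivAt (fun y => F (y, s)) (F' (y, s)) y) (y t : ℝ) :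
    HasDerivAt (fun y => ∫ s in (0 : ℝ)..t, F (y, s)) (∫ s in (0 : ℝ)..t, F' (y, s)) y := by
  let Q : ℝ → ℝ → ℝ := fun y' s => ∫ θ in (0 : ℝ)..1, F' (y + θ * (y' - y), s)
  have cQ : Continuous (Function.uncurry Q) :=
    intervalIntegral.continuous_parametric_intervalIntegral_of_continuous'
      (f := fun (p : ℝ × ℝ) θ => F' (y + θ * (p.1 - y), p.2))
      (by change Continuous fun q : (ℝ × ℝ) × ℝ => F' (y + q.2 * (q.1.1 - y), q.1.2); fun_prop) 0 1
  have cI : Continuous fun y' => ∫ s in (0 : ℝ)..t, Q y' s :=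
    intervalIntegral.continuous_parametric_intervalIntegral_of_continuous' cQ 0 t
  have hval : ∫ s in (0 : ℝ)..t, Q y s = ∫ s in (0 : ℝ)..t, F' (y, s) := by simp [Q]
  rw [hasDerivAt_iff_tendsto_slope, ← hval]
  refine (cI.continuousAt.tendsto.mono_left nhdsWithin_le_nhds).congr' ?_
  filter_upwards [self_mem_nhdsWithin] with y' hy'
  have hne : y' - y ≠ 0 := sub_ne_zero.2 hy'
  have hi : ∀ y, IntervalIntegrable (fun s => F (y, s)) volume 0 t := fun y =>
    Continuous.intervalIntegrable (by fun_prop) _ _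
  rw [slope_def_field, ← intervalIntegral.integral_sub (hi _) (hi _)]
  have : ∀ s, F (y', s) - F (y, s) = (y' - y) * Q y' s := fun s =>
    sub_eq_mul_integral (fun y => hd y s) (by fun_prop) y y'
  simp only [this, intervalIntegral.integral_const_mul]
  field_simp

namespace CharFlow

variable {v v' : ℝ × ℝ → ℝ} (Φ : CharFlow v v')

/-- The `y`-derivative of the flow map. -/
noncomputable def jac (q : ℝ × ℝ) : ℝ := Real.exp (∫ r in (0 : ℝ)..q.2, v' (Φ.Y (q.1, r), r))

/-- The integral of `g` along the characteristic with label `y` up to time `t`. -/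
noncomputable def acc (g : ℝ × ℝ → ℝ) (q : ℝ × ℝ) : ℝ :=
  ∫ s in (0 : ℝ)..q.2, g (Φ.Y (q.1, s), s)

/-- The `y`-derivative of `acc g`, where `g'` is the `x`-derivative of `g`. -/
noncomputable def accDeriv (g' : ℝ × ℝ → ℝ) (q : ℝ × ℝ) : ℝ :=
  ∫ s in (0 : ℝ)..q.2, g' (Φ.Y (q.1, s), s) * Φ.jac (q.1, s)

lemma jac_pos (q : ℝ × ℝ) : 0 < Φ.jac q := Real.exp_pos _

lemma X_zero (x : ℝ) : Φ.X (x, 0) = x := by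
  have := Φ.X_Y x 0
  rwa [Φ.Y_zero] at this

lemma continuous_integral_char {F : ℝ × ℝ → ℝ} (hF : Continuous F) :
    Continuous fun q : ℝ × ℝ => ∫ s in (0 : ℝ)..q.2, F (q.1, s) :=
  intervalIntegral.continuous_parametric_intervalIntegral_of_continuous
    (f := fun (q : ℝ × ℝ) s => F (q.1, s))
    (by change Continuous fun p : (ℝ × ℝ) × ℝ => F (p.1.1, p.2); fun_prop) continuous_snd

lemma hasDerivAt_integral_char {F : ℝ × ℝ → ℝ} (hF : Continuous F) (y t : ℝ) :
    HasDerivAt (fun t => ∫ s in (0 : ℝ)..t, F (y, s)) (F (y, t)) t := by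
  have hc : Continuous fun s => F (y, s) := by fun_prop
  exact intervalIntegral.integral_hasDerivAt_right (hc.intervalIntegrable _ _)
    (hc.stronglyMeasurableAtFilter _ _) hc.continuousAt

lemma continuous_along {g : ℝ × ℝ → ℝ} (hg : Continuous g) :
    Continuous fun q : ℝ × ℝ => g (Φ.Y q, q.2) := by
  have := Φ.continuous_Y
  fun_prop

lemma continuous_jac (hv' : Continuous v') : Continuous Φ.jac :=
  Real.continuous_exp.comp (continuous_integral_char (Φ.continuous_along hv'))

lemma hasDerivAt_jac_snd (hv' : Continuous v') (y t : ℝ) :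
    HasDerivAt (fun t => Φ.jac (y, t)) (Φ.jac (y, t) * v' (Φ.Y (y, t), t)) t :=
  (hasDerivAt_integral_char (Φ.continuous_along hv') y t).exp

lemma hasDerivAt_X_fst (hv' : Continuous v') (p : ℝ × ℝ) :
    HasDerivAt (fun x => Φ.X (x, p.2)) (Φ.jac (Φ.X p, p.2))⁻¹ p.1 := by
  obtain ⟨x, t⟩ := p
  have hc : Continuous fun y => Φ.jac (y, t) := by
    have := Φ.continuous_jac hv'
    fun_prop
  have hs : HasStrictDerivAt (fun y => Φ.Y (y, t)) (Φ.jac (Φ.X (x, t), t)) (Φ.X (x, t)) :=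
    hasStrictDerivAt_of_hasDerivAt_of_continuousAt (f' := fun y => Φ.jac (y, t))
      (.of_forall fun y => Φ.hasDerivAt_Y_fst y t) hc.continuousAt
  have := hs.to_local_left_inverse (Φ.jac_pos _).ne' (g := fun x => Φ.X (x, t))
    (.of_forall fun y => Φ.X_Y y t)
  rw [Φ.Y_X] at this
  exact this.hasDerivAt

variable {g g' : ℝ × ℝ → ℝ}

lemma continuous_acc (hg : Continuous g) : Continuous (Φ.acc g) :=
  continuous_integral_char (Φ.continuous_along hg)

lemma continuous_accDeriv (hv' : Continuous v') (hg' : Continuous g') :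
    Continuous (Φ.accDeriv g') :=
  continuous_integral_char (F := fun q => g' (Φ.Y q, q.2) * Φ.jac q)
    ((Φ.continuous_along hg').mul (Φ.continuous_jac hv'))

lemma hasDerivAt_acc_snd (hg : Continuous g) (y t : ℝ) :
    HasDerivAt (fun t => Φ.acc g (y, t)) (g (Φ.Y (y, t), t)) t :=
  hasDerivAt_integral_char (Φ.continuous_along hg) y t

lemma hasDerivAt_accDeriv_snd (hv' : Continuous v') (hg' : Continuous g') (y t : ℝ) :
    HasDerivAt (fun t => Φ.accDeriv g' (y, t)) (g' (Φ.Y (y, t), t) * Φ.jac (y, t)) t :=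
  hasDerivAt_integral_char (F := fun q => g' (Φ.Y q, q.2) * Φ.jac q)
    ((Φ.continuous_along hg').mul (Φ.continuous_jac hv')) y t

lemma hasDerivAt_acc_fst (hv' : Continuous v') (hg : Continuous g) (hg' : Continuous g')
    (hd : ∀ p : ℝ × ℝ, HasDerivAt (fun ξ => g (ξ, p.2)) (g' p) p.1) (y t : ℝ) :
    HasDerivAt (fun y => Φ.acc g (y, t)) (Φ.accDeriv g' (y, t)) y :=
  hasDerivAt_integral_of_continuous (F := fun q => g (Φ.Y q, q.2))
    (F' := fun q => g' (Φ.Y q, q.2) * Φ.jac q) (Φ.continuous_along hg)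
    ((Φ.continuous_along hg').mul (Φ.continuous_jac hv'))
    (fun y s => HasDerivAt.comp (h₂ := fun ξ => g (ξ, s)) y (hd (Φ.Y (y, s), s))
      (Φ.hasDerivAt_Y_fst y s)) y t

/-- The label function is constant along characteristics: `∂_t X + v ∂_x X = 0`. -/
lemma hasDerivAt_X_snd (hv' : Continuous v') (x t : ℝ) :
    HasDerivAt (fun t => Φ.X (x, t)) (-(v (x, t) * (Φ.jac (Φ.X (x, t), t))⁻¹)) t := by
  have hY : Φ.Y (Φ.X (x, t), t) = x := Φ.Y_X x t
  have hj := Φ.continuous_jac hv'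
  have hX := Φ.continuous_X
  have := hasDerivAt_time_of_along (w := Φ.X) (z := fun p => (Φ.jac (Φ.X p, p.2))⁻¹)
    (η := fun s => Φ.Y (Φ.X (x, t), s)) (t := t) (l := v (x, t)) (g := 0)
    (.of_forall fun p => Φ.hasDerivAt_X_fst hv' p)
    (ContinuousAt.inv₀ (by fun_prop) (Φ.jac_pos _).ne')
    (by simpa only [hY] using Φ.hasDerivAt_Y (Φ.X (x, t)) t)
    (by simpa only [Φ.X_Y] using hasDerivAt_const t (Φ.X (x, t)))
  simpa only [hY, zero_sub] using this

/-- A solution of the transport equation with speed `v` and source `g` is `ψ ∘ X` plus the integral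
of `g` along characteristics. -/
noncomputable def sol (g : ℝ × ℝ → ℝ) (ψ : ℝ → ℝ) (p : ℝ × ℝ) : ℝ :=
  ψ (Φ.X p) + Φ.acc g (Φ.X p, p.2)

/-- The `x`-derivative of `sol g ψ`. -/
noncomputable def solDeriv (g' : ℝ × ℝ → ℝ) (ψ' : ℝ → ℝ) (p : ℝ × ℝ) : ℝ :=
  (ψ' (Φ.X p) + Φ.accDeriv g' (Φ.X p, p.2)) * (Φ.jac (Φ.X p, p.2))⁻¹

variable {ψ ψ' : ℝ → ℝ}

lemma hasDerivAt_sol_fst (hv' : Continuous v') (hg : Continuous g) (hg' : Continuous g')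
    (hd : ∀ p : ℝ × ℝ, HasDerivAt (fun ξ => g (ξ, p.2)) (g' p) p.1) {p : ℝ × ℝ}
    (hψ : HasDerivAt ψ (ψ' (Φ.X p)) (Φ.X p)) :
    HasDerivAt (fun ξ => Φ.sol g ψ (ξ, p.2)) (Φ.solDeriv g' ψ' p) p.1 := by
  have hX := Φ.hasDerivAt_X_fst hv' p
  have h := (hψ.add (Φ.hasDerivAt_acc_fst hv' hg hg' hd (Φ.X p) p.2)).comp p.1 hX
  exact h

lemma continuousAt_solDeriv (hv' : Continuous v') (hg' : Continuous g') {p : ℝ × ℝ}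
    (hψ : ContinuousAt ψ' (Φ.X p)) : ContinuousAt (Φ.solDeriv g' ψ') p := by
  have hX := Φ.continuous_X
  have hj := Φ.continuous_jac hv'
  have ha := Φ.continuous_accDeriv hv' hg'
  have h1 : ContinuousAt (fun p => ψ' (Φ.X p)) p := ContinuousAt.comp hψ hX.continuousAt
  exact (h1.add (by fun_prop)).mul (ContinuousAt.inv₀ (by fun_prop) (Φ.jac_pos _).ne')

lemma hasDerivAt_sol_along (hg : Continuous g) (p : ℝ × ℝ) :
    HasDerivAt (fun s => Φ.sol g ψ (Φ.Y (Φ.X p, s), s)) (g p) p.2 := by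
  have h := (Φ.hasDerivAt_acc_snd hg (Φ.X p) p.2).const_add (ψ (Φ.X p))
  rw [Φ.Y_X] at h
  simpa only [sol, Φ.X_Y] using h

lemma hasDerivAt_solDeriv_along (hv' : Continuous v') (hg' : Continuous g') (p : ℝ × ℝ) :
    HasDerivAt (fun s => Φ.solDeriv g' ψ' (Φ.Y (Φ.X p, s), s))
      (g' p - v' p * Φ.solDeriv g' ψ' p) p.2 := by
  have hne := (Φ.jac_pos (Φ.X p, p.2)).ne'
  have h := ((Φ.hasDerivAt_accDeriv_snd hv' hg' (Φ.X p) p.2).const_add (ψ' (Φ.X p))).mul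
    ((Φ.hasDerivAt_jac_snd hv' (Φ.X p) p.2).inv hne)
  rw [Φ.Y_X] at h
  simp only [solDeriv, Φ.X_Y]
  refine h.congr_deriv ?_
  simp only [Pi.inv_apply]
  field_simp
  ring

lemma hasDerivAt_sol_snd (hv' : Continuous v') (hg : Continuous g) (hg' : Continuous g')
    (hd : ∀ p : ℝ × ℝ, HasDerivAt (fun ξ => g (ξ, p.2)) (g' p) p.1) {p : ℝ × ℝ} {D : Set ℝ}
    (hD : IsOpen D) (hp : Φ.X p ∈ D)
    (hψ : ∀ y ∈ D, HasDerivAt ψ (ψ' y) y ∧ ContinuousAt ψ' y) :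
    HasDerivAt (fun s => Φ.sol g ψ (p.1, s)) (g p - v p * Φ.solDeriv g' ψ' p) p.2 := by
  have hY : Φ.Y (Φ.X p, p.2) = p.1 := Φ.Y_X p.1 p.2
  have hev : ∀ᶠ q in 𝓝 p, Φ.X q ∈ D := (hD.preimage Φ.continuous_X).mem_nhds hp
  have := hasDerivAt_time_of_along (w := Φ.sol g ψ) (z := Φ.solDeriv g' ψ')
    (η := fun s => Φ.Y (Φ.X p, s)) (t := p.2) (l := v p) (g := g p)
    (by rw [hY]; exact hev.mono fun q hq => Φ.hasDerivAt_sol_fst hv' hg hg' hd (hψ _ hq).1)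
    (by rw [hY]; exact Φ.continuousAt_solDeriv hv' hg' (hψ _ hp).2)
    (by simpa only [hY] using Φ.hasDerivAt_Y (Φ.X p) p.2)
    (Φ.hasDerivAt_sol_along hg p)
  simpa only [hY] using this

/-- The initial-boundary value problem for the scalar transport equation with speed `v` entering at
the side `x = a`. The labels `X (x, t)` on the inner side of `a` carry the initial data. The labels
beyond `a` are the values of `s ↦ X (a, s)`, so they carry the boundary data. By the compatibility
conditions the two pieces fit together to first order at the label `a`. -/
theorem exists_transport (hv : PlaneSpeed v v') {a : ℝ} (ha : a = 0 ∨ a = 1)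
    (hsgn : ∀ s, 0 < (1 - 2 * a) * v (a, s)) (hg : Continuous g) (hg' : Continuous g')
    (hd : ∀ p : ℝ × ℝ, HasDerivAt (fun ξ => g (ξ, p.2)) (g' p) p.1) {b b' φ φ' : ℝ → ℝ}
    (hb : ∀ s, HasDerivAt b (b' s) s) (hb' : Continuous b') (hφ : ∀ x, HasDerivAt φ (φ' x) x)
    (hφ' : Continuous φ') (h0 : φ a = b 0) (h1 : g (a, 0) - v (a, 0) * φ' a = b' 0) :
    ∃ ψ ψ' : ℝ → ℝ, ∃ D : Set ℝ, IsOpen D ∧ (∀ y ∈ D, HasDerivAt ψ (ψ' y) y ∧ ContinuousAt ψ' y) ∧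
      (∀ x ∈ Icc (0 : ℝ) 1, ∀ t ∈ Ici (0 : ℝ), Φ.X (x, t) ∈ D) ∧
      (∀ x ∈ Icc (0 : ℝ) 1, Φ.sol g ψ (x, 0) = φ x) ∧
      ∀ t ∈ Ici (0 : ℝ), Φ.sol g ψ (a, t) = b t := by
  have hv' := hv.contDeriv
  have hX := Φ.continuous_X
  have hY := Φ.continuous_Y
  have hj := Φ.continuous_jac hv'
  have hacc := Φ.continuous_accDeriv hv' hg'
  have hvc := hv.cont
  -- labels of the characteristics that enter at time `s`
  let σ : ℝ → ℝ := fun s => Φ.X (a, s)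
  let σ' : ℝ → ℝ := fun s => -(v (a, s) * (Φ.jac (Φ.X (a, s), s))⁻¹)
  have dσ : ∀ s, HasDerivAt σ (σ' s) s := fun s => Φ.hasDerivAt_X_snd hv' a s
  have cσ' : Continuous σ' :=
    ((by fun_prop : Continuous fun s => v (a, s)).mul
      (Continuous.inv₀ (by fun_prop) fun s => (Φ.jac_pos _).ne')).neg
  have sσ' : ∀ s, (1 - 2 * a) * σ' s < 0 := fun s => by
    have := mul_pos (hsgn s) (inv_pos.2 (Φ.jac_pos (Φ.X (a, s), s)))
    simp only [σ']
    linarith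
  have σ'0 : ∀ s, σ' s ≠ 0 := fun s h => by simpa [h] using sσ' s
  have anti : StrictAnti fun s => (1 - 2 * a) * σ s :=
    strictAnti_of_deriv_neg fun s => by rw [((dσ s).const_mul _).deriv]; exact sσ' s
  have σ0 : σ 0 = a := Φ.X_zero a
  have inj : Function.Injective σ := fun s t h => anti.injective (by simp only [h])
  have dsσ : ∀ s, HasStrictDerivAt σ (σ' s) s := fun s =>
    hasStrictDerivAt_of_hasDerivAt_of_continuousAt (.of_forall dσ) cσ'.continuousAt
  -- entrance time as a function of the label
  let θ : ℝ → ℝ := Function.invFun σ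
  have θσ : ∀ s, θ (σ s) = s := Function.leftInverse_invFun inj
  have dθ : ∀ s, HasDerivAt θ (σ' s)⁻¹ (σ s) := fun s =>
    ((dsσ s).to_local_left_inverse (σ'0 s) (.of_forall θσ)).hasDerivAt
  -- boundary data minus the integral of the source, transported to the labels
  let β : ℝ → ℝ := fun s => b s - Φ.acc g (σ s, s)
  let β' : ℝ → ℝ := fun s => b' s - (g (a, s) - v (a, s) *
    ((0 + Φ.accDeriv g' (σ s, s)) * (Φ.jac (σ s, s))⁻¹))
  have dβ : ∀ s, HasDerivAt β (β' s) s := fun s => by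
    have := Φ.hasDerivAt_sol_snd (ψ := fun _ => 0) (ψ' := fun _ => 0) (p := (a, s)) hv' hg hg' hd
      isOpen_univ trivial fun y _ => ⟨hasDerivAt_const y 0, continuousAt_const⟩
    simp only [sol, solDeriv, zero_add] at this
    simp only [β', zero_add]
    exact (hb s).sub this
  have hσc : Continuous σ := by fun_prop
  have cβ' : Continuous β' := by
    have : Continuous fun s => (Φ.jac (σ s, s))⁻¹ :=
      Continuous.inv₀ (by fun_prop) fun s => (Φ.jac_pos _).ne'
    fun_prop
  let G : ℝ → ℝ := fun y => β (θ y)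
  let G' : ℝ → ℝ := fun y => β' (θ y) * (σ' (θ y))⁻¹
  have hG : ∀ s, HasDerivAt G (G' (σ s)) (σ s) ∧ ContinuousAt G' (σ s) := fun s => by
    have c := (dθ s).continuousAt
    constructor
    · have h := (dβ (θ (σ s))).comp (σ s) (dθ s)
      simp only [G', θσ] at h ⊢
      exact h
    · have c1 : ContinuousAt (fun y => β' (θ y)) (σ s) := ContinuousAt.comp cβ'.continuousAt c
      have c2 : ContinuousAt (fun y => σ' (θ y)) (σ s) :=
        ContinuousAt.comp (g := σ') cσ'.continuousAt c
      exact c1.mul (c2.inv₀ (σ'0 _))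
  have θa : θ a = 0 := by rw [← σ0, θσ]
  have G0 : φ a = G a := by simp [G, β, θa, acc, h0]
  -- The compatibility condition of order one gives equal slopes.
  have G1 : φ' a = G' a := by
    have hva : v (a, 0) ≠ 0 := fun h => by simpa [h] using hsgn 0
    have : Φ.jac (σ 0, 0) = 1 := by simp [jac]
    have hj0 : Φ.jac (Φ.X (a, 0), 0) = 1 := by simp [jac]
    have ha0 : Φ.accDeriv g' (σ 0, 0) = 0 := by simp [accDeriv]
    simp only [G', θa, β', σ', ha0, hj0, ← h1]
    field_simp
    ring
  let D : Set ℝ := {y | 0 < (1 - 2 * a) * (y - a)} ∪ range σ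
  have hDo : IsOpen D := (isOpen_lt (by fun_prop) (by fun_prop)).union
    (isOpenMap_of_hasStrictDerivAt dsσ σ'0).isOpen_range
  have hDG : ∀ y ∈ D, (1 - 2 * a) * (y - a) ≤ 0 → HasDerivAt G (G' y) y ∧ ContinuousAt G' y := by
    rintro y (hy | ⟨s, rfl⟩) h
    · exact absurd hy (not_lt.2 h)
    · exact hG s
  have hF : ∀ y, HasDerivAt φ (φ' y) y ∧ ContinuousAt φ' y := fun y => ⟨hφ y, hφ'.continuousAt⟩
  have glued : ∃ ψ ψ' : ℝ → ℝ, (∀ y ∈ D, HasDerivAt ψ (ψ' y) y ∧ ContinuousAt ψ' y) ∧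
      (∀ y, 0 ≤ (1 - 2 * a) * (y - a) → ψ y = φ y) ∧
      ∀ y, (1 - 2 * a) * (y - a) ≤ 0 → ψ y = G y := by
    rcases ha with rfl | rfl
    · refine ⟨_, _, glue_at (D := D) (fun y _ _ => hF y)
        (fun y hy h => hDG y hy (by simpa using h)) G0 G1, fun y h => if_pos (by simpa using h),
        fun y h => ?_⟩
      have h' : y ≤ 0 := by simpa using h
      rcases h'.eq_or_lt with rfl | h''
      · rw [if_pos le_rfl, G0]
      · exact if_neg (not_le.2 h'')
    · refine ⟨_, _, glue_at (D := D) (fun y hy h => hDG y hy (by linarith))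
        (fun y _ _ => hF y) G0.symm G1.symm, fun y h => ?_, fun y h => if_pos (by linarith)⟩
      have h' : y ≤ 1 := by linarith
      rcases h'.eq_or_lt with rfl | h''
      · rw [if_pos le_rfl, G0]
      · exact if_neg (not_le.2 h'')
  obtain ⟨ψ, ψ', hψ, hψφ, hψG⟩ := glued
  have side : ∀ x ∈ Icc (0 : ℝ) 1, 0 ≤ (1 - 2 * a) * (x - a) := fun x hx => by
    rcases ha with rfl | rfl <;> linarith [hx.1, hx.2]
  refine ⟨ψ, ψ', D, hDo, hψ, fun x hx t ht => ?_, fun x hx => ?_, fun t ht => ?_⟩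
  · -- a characteristic with a label beyond `a` has crossed `x = a` before it reaches `x`
    by_cases hpos : 0 < (1 - 2 * a) * (Φ.X (x, t) - a)
    · exact Or.inl hpos
    · right
      have hc : ContinuousOn (fun s => (1 - 2 * a) * (Φ.Y (Φ.X (x, t), s) - a)) (Icc 0 t) := by
        fun_prop
      obtain ⟨s, -, hs⟩ := intermediate_value_Icc ht hc
        (show (0 : ℝ) ∈ _ from ⟨by rw [Φ.Y_zero]; exact not_lt.1 hpos,
          by rw [Φ.Y_X]; exact side x hx⟩)
      have hs' : Φ.Y (Φ.X (x, t), s) = a := by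
        rcases ha with rfl | rfl <;> linarith
      refine ⟨s, ?_⟩
      change Φ.X (a, s) = _
      conv_lhs => rw [← hs']
      exact Φ.X_Y _ _
  · simp only [sol, acc, Φ.X_zero, intervalIntegral.integral_same, add_zero]
    exact hψφ x (side x hx)
  · have hle : (1 - 2 * a) * (σ t - a) ≤ 0 := by
      have := anti.antitone ht
      simp only [σ0] at this
      linarith
    change ψ (σ t) + Φ.acc g (σ t, t) = b t
    rw [hψG _ hle]
    simp only [G, β, θσ]
    ring

end CharFlow

/-! ### Transport in a rectangle -/

/-- The extension to the plane of a function `g` on the rectangle `[0, 1] × [0, T]` that has the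
`x`-derivative `g'`: it is continuously differentiable in `x`, and constant in `t` outside
`[0, T]`. -/
noncomputable def planeExt (T : ℝ) (g g' : ℝ × ℝ → ℝ) (p : ℝ × ℝ) : ℝ :=
  ext 0 1 (fun ξ => g (ξ, max 0 (min T p.2))) (fun ξ => g' (ξ, max 0 (min T p.2))) p.1

/-- The `x`-derivative of `planeExt T g g'`. -/
noncomputable def planeExtDeriv (T : ℝ) (g' : ℝ × ℝ → ℝ) (p : ℝ × ℝ) : ℝ :=
  extDeriv 0 1 (fun ξ => g' (ξ, max 0 (min T p.2))) p.1

section planeExt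

variable {T : ℝ} {g g' : ℝ × ℝ → ℝ}

lemma planeExt_of_mem (g g' : ℝ × ℝ → ℝ) {p : ℝ × ℝ} (hp : p ∈ closedRect T) :
    planeExt T g g' p = g p := by
  rw [planeExt, ext_of_mem _ _ hp.1, clamp_of_mem hp.2]

lemma planeExtDeriv_of_mem (g' : ℝ × ℝ → ℝ) {p : ℝ × ℝ} (hp : p ∈ closedRect T) :
    planeExtDeriv T g' p = g' p := by
  rw [planeExtDeriv, extDeriv_of_mem _ hp.1, clamp_of_mem hp.2]

lemma clamp_mem_closedRect (hT : 0 ≤ T) (p : ℝ × ℝ) :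
    (max 0 (min 1 p.1), max 0 (min T p.2)) ∈ closedRect T :=
  ⟨clamp_mem zero_le_one _, clamp_mem hT _⟩

lemma continuous_clamp (hT : 0 ≤ T) (hg : ContinuousOn g (closedRect T)) :
    Continuous fun p : ℝ × ℝ => g (max 0 (min 1 p.1), max 0 (min T p.2)) :=
  hg.comp_continuous (by fun_prop) (clamp_mem_closedRect hT)

lemma continuous_planeExt (hT : 0 ≤ T) (hg : ContinuousOn g (closedRect T))
    (hg' : ContinuousOn g' (closedRect T)) : Continuous (planeExt T g g') :=
  (continuous_clamp hT hg).add ((continuous_clamp hT hg').mul (by fun_prop))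

lemma continuous_planeExtDeriv (hT : 0 ≤ T) (hg' : ContinuousOn g' (closedRect T)) :
    Continuous (planeExtDeriv T g') :=
  (continuous_clamp hT hg').mul (by fun_prop)

lemma hasDerivAt_planeExt (hT : 0 ≤ T) (hd : ∀ p ∈ closedRect T,
      HasDerivWithinAt (fun ξ => g (ξ, p.2)) (g' p) (Icc 0 1) p.1) (p : ℝ × ℝ) :
    HasDerivAt (fun ξ => planeExt T g g' (ξ, p.2)) (planeExtDeriv T g' p) p.1 :=
  hasDerivAt_ext (q := fun ξ => g (ξ, max 0 (min T p.2)))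
    (q' := fun ξ => g' (ξ, max 0 (min T p.2))) zero_lt_one
    (fun x hx => hd (x, max 0 (min T p.2)) ⟨hx, clamp_mem hT _⟩) p.1

lemma isCompact_closedRect (T : ℝ) : IsCompact (closedRect T) := isCompact_Icc.prod isCompact_Icc

lemma closedRect_subset (T : ℝ) : closedRect T ⊆ closedStrip :=
  prod_mono subset_rfl Icc_subset_Ici_self

/-- A continuous function on the rectangle is bounded. -/
lemma exists_bound_closedRect (hg : ContinuousOn g (closedRect T)) :
    ∃ C, 0 ≤ C ∧ ∀ p ∈ closedRect T, |g p| ≤ C := by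
  obtain ⟨C, hC⟩ := (isCompact_closedRect T).exists_bound_of_continuousOn hg
  exact ⟨max C 0, le_max_right _ _, fun p hp => (hC p hp).trans (le_max_left _ _)⟩

lemma planeSpeed_planeExt (hT : 0 ≤ T) (hg : ContinuousOn g (closedRect T))
    (hg' : ContinuousOn g' (closedRect T)) (hd : ∀ p ∈ closedRect T,
      HasDerivWithinAt (fun ξ => g (ξ, p.2)) (g' p) (Icc 0 1) p.1) :
    PlaneSpeed (planeExt T g g') (planeExtDeriv T g') := by
  obtain ⟨C, -, hC⟩ := exists_bound_closedRect hg
  obtain ⟨C', hC'0, hC'⟩ := exists_bound_closedRect hg'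
  refine ⟨continuous_planeExt hT hg hg', continuous_planeExtDeriv hT hg',
    hasDerivAt_planeExt hT hd, ⟨C + C', fun p => ?_⟩, ⟨C', fun p => ?_⟩⟩
  · refine (abs_add_le _ _).trans (add_le_add (hC _ (clamp_mem_closedRect hT p)) ?_)
    rw [abs_mul]
    exact (mul_le_of_le_one_right (abs_nonneg _) (Real.abs_sin_le_one _)).trans
      (hC' _ (clamp_mem_closedRect hT p))
  · change |_ * _| ≤ _
    rw [abs_mul]
    exact (mul_le_of_le_one_right (abs_nonneg _) (Real.abs_cos_le_one _)).trans
      (hC' _ (clamp_mem_closedRect hT p))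

end planeExt

/-- `χ p` is the characteristic of the speed `lam` through the point `p`, as a function of time; the
equation `χ' = lam (χ, s)` is required while the curve is in the rectangle `[0, 1] × [0, T]`. -/
structure IsChar (T : ℝ) (lam : ℝ × ℝ → ℝ) (χ : ℝ × ℝ → ℝ → ℝ) : Prop where
  self : ∀ p : ℝ × ℝ, χ p p.2 = p.1
  hasDerivAt : ∀ p s, (χ p s, s) ∈ closedRect T → HasDerivAt (χ p) (lam (χ p s, s)) s

/-- `w` solves `∂_t w + lam ∂_x w = g` in the rectangle `[0, 1] × [0, T]`, with `z = ∂_x w`; the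
solution `w` and its derivative `z` satisfy their equations along the characteristics `χ`. As `z`
need not be differentiable in `x` and `t` separately, its equation makes sense only in this form. -/
structure IsTransport (T : ℝ) (lam lam' : ℝ × ℝ → ℝ) (χ : ℝ × ℝ → ℝ → ℝ) (g g' w z : ℝ × ℝ → ℝ) :
    Prop where
  continuousOn : ContinuousOn w (closedRect T)
  continuousOn_deriv : ContinuousOn z (closedRect T)
  deriv_fst : ∀ p ∈ closedRect T, HasDerivWithinAt (fun ξ => w (ξ, p.2)) (z p) (Icc 0 1) p.1
  deriv_snd : ∀ p ∈ closedRect T,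
    HasDerivWithinAt (fun s => w (p.1, s)) (g p - lam p * z p) (Icc 0 T) p.2
  along : ∀ p ∈ closedRect T, HasDerivWithinAt (fun s => w (χ p s, s)) (g p) (Iic p.2) p.2
  along_deriv : ∀ p ∈ closedRect T,
    HasDerivWithinAt (fun s => z (χ p s, s)) (g' p - lam' p * z p) (Iic p.2) p.2

/-- The scalar initial-boundary value problem in a rectangle is solvable if the data are
continuously differentiable in `x`, respectively in `t`, and compatible. The characteristics do not
depend on the data. -/
theorem exists_isTransport {T : ℝ} (hT : 0 < T) {lam lam' : ℝ × ℝ → ℝ}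
    (hl : ContinuousOn lam (closedRect T)) (hl' : ContinuousOn lam' (closedRect T))
    (hld : ∀ p ∈ closedRect T, HasDerivWithinAt (fun ξ => lam (ξ, p.2)) (lam' p) (Icc 0 1) p.1)
    {a : ℝ} (ha : a = 0 ∨ a = 1) (hsgn : ∀ p ∈ closedRect T, 0 < (1 - 2 * a) * lam p) :
    ∃ χ, IsChar T lam χ ∧ ∀ (g g' : ℝ × ℝ → ℝ) (b b' φ φ' : ℝ → ℝ),
      ContinuousOn g (closedRect T) → ContinuousOn g' (closedRect T) →
      (∀ p ∈ closedRect T, HasDerivWithinAt (fun ξ => g (ξ, p.2)) (g' p) (Icc 0 1) p.1) →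
      (∀ t ∈ Icc 0 T, HasDerivWithinAt b (b' t) (Icc 0 T) t) → ContinuousOn b' (Icc 0 T) →
      (∀ x ∈ Icc (0 : ℝ) 1, HasDerivWithinAt φ (φ' x) (Icc 0 1) x) →
      ContinuousOn φ' (Icc 0 1) → φ a = b 0 → g (a, 0) - lam (a, 0) * φ' a = b' 0 →
      ∃ w z, IsTransport T lam lam' χ g g' w z ∧ (∀ x ∈ Icc (0 : ℝ) 1, w (x, 0) = φ x) ∧
        ∀ t ∈ Icc 0 T, w (a, t) = b t := by
  have hv := planeSpeed_planeExt hT.le hl hl' hld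
  obtain ⟨Φ⟩ := hv.nonempty_charFlow
  have hamem : a ∈ Icc (0 : ℝ) 1 := by rcases ha with rfl | rfl <;> simp
  have h0T : (0 : ℝ) ∈ Icc 0 T := ⟨le_rfl, hT.le⟩
  refine ⟨fun p s => Φ.Y (Φ.X p, s), ⟨fun p => Φ.Y_X p.1 p.2, fun p s hps => ?_⟩, ?_⟩
  · rw [← planeExt_of_mem lam lam' hps]
    exact Φ.hasDerivAt_Y _ _
  intro g g' b b' φ φ' hg hg' hgd hb hb' hφ hφ' h0 h1
  have cg := continuous_planeExt hT.le hg hg'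
  have cg' := continuous_planeExtDeriv hT.le hg'
  have dg := hasDerivAt_planeExt hT.le hgd
  have cExt : ∀ {l r : ℝ} {q' : ℝ → ℝ}, l ≤ r → ContinuousOn q' (Icc l r) →
      Continuous (extDeriv l r q') := fun hlr hq' =>
    (hq'.comp_continuous (by fun_prop) (clamp_mem hlr)).mul (by fun_prop)
  obtain ⟨ψ, ψ', D, hD, hψ, hmem, hini, hbd⟩ := Φ.exists_transport hv ha (g := planeExt T g g')
    (g' := planeExtDeriv T g') (b := ext 0 T b b') (b' := extDeriv 0 T b') (φ := ext 0 1 φ φ')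
    (φ' := extDeriv 0 1 φ') (fun s => by
      have hm : (a, max 0 (min T s)) ∈ closedRect T := ⟨hamem, clamp_mem hT.le s⟩
      have := hsgn _ hm
      rw [← ext_of_mem (fun ξ => lam (ξ, max 0 (min T s)))
        (fun ξ => lam' (ξ, max 0 (min T s))) hamem] at this
      exact this) cg cg' dg (hasDerivAt_ext hT hb) (cExt hT.le hb')
    (hasDerivAt_ext zero_lt_one hφ) (cExt zero_le_one hφ')
    (by rw [ext_of_mem _ _ hamem, ext_of_mem _ _ h0T, h0])
    (by rw [planeExt_of_mem _ _ ⟨hamem, h0T⟩, planeExt_of_mem _ _ ⟨hamem, h0T⟩,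
          extDeriv_of_mem _ hamem, extDeriv_of_mem _ h0T, h1])
  have hmem' : ∀ p ∈ closedRect T, Φ.X p ∈ D := fun p hp => hmem p.1 hp.1 p.2 hp.2.1
  have hX := Φ.continuous_X
  have hacc := Φ.continuous_acc cg
  refine ⟨Φ.sol (planeExt T g g') ψ, Φ.solDeriv (planeExtDeriv T g') ψ', ⟨?_, ?_, ?_, ?_, ?_, ?_⟩,
    ?_, ?_⟩
  · intro p hp
    have h1 : ContinuousAt (fun p => ψ (Φ.X p)) p :=
      ContinuousAt.comp (hψ _ (hmem' p hp)).1.continuousAt hX.continuousAt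
    exact (h1.add (by fun_prop)).continuousWithinAt
  · exact fun p hp =>
      (Φ.continuousAt_solDeriv hv.contDeriv cg' (hψ _ (hmem' p hp)).2).continuousWithinAt
  · exact fun p hp =>
      (Φ.hasDerivAt_sol_fst hv.contDeriv cg cg' dg (hψ _ (hmem' p hp)).1).hasDerivWithinAt
  · intro p hp
    have := Φ.hasDerivAt_sol_snd hv.contDeriv cg cg' dg hD (hmem' p hp) hψ
    rw [planeExt_of_mem _ _ hp, planeExt_of_mem _ _ hp] at this
    exact this.hasDerivWithinAt
  · intro p hp
    have := Φ.hasDerivAt_sol_along (ψ := ψ) cg p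
    rw [planeExt_of_mem _ _ hp] at this
    exact this.hasDerivWithinAt
  · intro p hp
    have := Φ.hasDerivAt_solDeriv_along (ψ' := ψ') hv.contDeriv cg' p
    rw [planeExtDeriv_of_mem _ hp, planeExtDeriv_of_mem _ hp] at this
    exact this.hasDerivWithinAt
  · intro x hx
    rw [hini x hx, ext_of_mem _ _ hx]
  · intro t ht
    rw [hbd t ht.1, ext_of_mem _ _ ht]

/-! ### A weighted maximum principle along characteristics -/

/-- The weight `exp (γ t - μ |x - a|)`, written for `0 ≤ x ≤ 1` and `a ∈ {0, 1}`: then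
`(1 - 2 a) (x - a) = |x - a|`. -/
noncomputable def wt (γ μ a : ℝ) (p : ℝ × ℝ) : ℝ :=
  Real.exp (γ * p.2 - μ * ((1 - 2 * a) * (p.1 - a)))

lemma wt_pos (γ μ a : ℝ) (p : ℝ × ℝ) : 0 < wt γ μ a p := Real.exp_pos _

section IsChar

variable {T a : ℝ} {lam : ℝ × ℝ → ℝ} {χ : ℝ × ℝ → ℝ → ℝ} {p : ℝ × ℝ}

lemma IsChar.hasDerivAt_self (hχ : IsChar T lam χ) (hp : p ∈ closedRect T) :
    HasDerivAt (χ p) (lam p) p.2 := by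
  have := hχ.hasDerivAt p p.2 (by rw [hχ.self]; exact hp)
  rwa [hχ.self] at this

/-- Away from the inflow side and the initial time, the backward characteristic runs through the
interior of the rectangle for a short time, even if it starts on the outflow side. -/
lemma IsChar.eventually_mem (ha : a = 0 ∨ a = 1) (hχ : IsChar T lam χ)
    (hsgn : ∀ p ∈ closedRect T, 0 < (1 - 2 * a) * lam p) (hp : p ∈ closedRect T)
    (hxa : p.1 ≠ a) (ht : 0 < p.2) :
    ∀ᶠ s in 𝓝[<] p.2, (χ p s, s) ∈ Ioo (0 : ℝ) 1 ×ˢ Ioo 0 T := by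
  have hself := hχ.self p
  have hd := hχ.hasDerivAt_self hp
  have hslope : Tendsto (fun s => (1 - 2 * a) * slope (χ p) p.2 s) (𝓝[<] p.2)
      (𝓝 ((1 - 2 * a) * lam p)) :=
    ((hasDerivAt_iff_tendsto_slope.1 hd).mono_left
      (nhdsWithin_mono _ fun s hs => ne_of_lt hs)).const_mul _
  have e1 := hslope.eventually_const_lt (hsgn _ hp)
  have hx1 := hp.1.1
  have hx2 := hp.1.2
  have e2 : ∀ᶠ s in 𝓝[<] p.2, 0 < (1 - 2 * a) * (χ p s - a) := by
    have hc : ContinuousAt (fun s => (1 - 2 * a) * (χ p s - a)) p.2 := by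
      have := hd.continuousAt
      fun_prop
    refine (hc.eventually_const_lt ?_).filter_mono nhdsWithin_le_nhds
    simp only [hself]
    rcases ha with rfl | rfl
    · have := lt_of_le_of_ne hx1 hxa.symm
      linarith
    · have := lt_of_le_of_ne hx2 hxa
      linarith
  have e3 : ∀ᶠ s in 𝓝[<] p.2, 0 < s := (eventually_gt_nhds ht).filter_mono nhdsWithin_le_nhds
  filter_upwards [e1, e2, e3, self_mem_nhdsWithin] with s h1 h2 h3 h4
  have h4' : s - p.2 < 0 := sub_neg.2 h4
  rw [slope_def_field, hself, ← mul_div_assoc] at h1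
  have h5 : (1 - 2 * a) * (χ p s - p.1) < 0 := by
    by_contra! h
    exact absurd h1 (not_lt.2 (div_nonpos_of_nonneg_of_nonpos h h4'.le))
  refine ⟨?_, h3, lt_of_lt_of_le h4 hp.2.2⟩
  rcases ha with rfl | rfl
  · constructor <;> simp only <;> linarith
  · constructor <;> simp only <;> linarith

end IsChar

/-- If `w` exceeds `c` times the weight somewhere, then consider the maximum of their quotient. It
is not attained at the initial time or at the inflow side, and anywhere else the quotient is
strictly decreasing along the backward characteristic, against maximality. -/
lemma le_wt_of_along {T Λ Λ₁ γ μ c a : ℝ} {lam w r : ℝ × ℝ → ℝ} {χ : ℝ × ℝ → ℝ → ℝ}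
    (ha : a = 0 ∨ a = 1) (hχ : IsChar T lam χ) (hsgn : ∀ p ∈ closedRect T, 0 < (1 - 2 * a) * lam p)
    (hΛ : ∀ p ∈ closedRect T, |lam p| ≤ Λ) (hμ : 0 ≤ μ) {κ : ℝ} (hκ : 0 < κ)
    (hγ : μ * Λ + Λ₁ + κ ≤ γ) (hc : 0 ≤ c) (hw : ContinuousOn w (closedRect T))
    (hwr : ∀ p ∈ closedRect T, p.1 ≠ a → 0 < p.2 →
      HasDerivWithinAt (fun s => w (χ p s, s)) (r p) (Iic p.2) p.2)
    (hr : ∀ p ∈ closedRect T, p.1 ≠ a → 0 < p.2 → r p ≤ Λ₁ * |w p| + κ * c * wt γ μ a p)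
    (hin : ∀ t ∈ Icc 0 T, w (a, t) ≤ c * wt γ μ a (a, t))
    (hini : ∀ x ∈ Icc (0 : ℝ) 1, w (x, 0) ≤ c * wt γ μ a (x, 0)) :
    ∀ p ∈ closedRect T, w p ≤ c * wt γ μ a p := by
  set E : ℝ × ℝ → ℝ := fun p => Real.exp (-(γ * p.2 - μ * ((1 - 2 * a) * (p.1 - a)))) with hE
  have hEw : ∀ p, E p * wt γ μ a p = 1 := fun p => by
    rw [hE, wt, ← Real.exp_add]; simp
  have hEpos : ∀ p, 0 < E p := fun p => Real.exp_pos _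
  have key : ∀ p, w p * E p ≤ c ↔ w p ≤ c * wt γ μ a p := fun p => by
    rw [← mul_le_mul_iff_of_pos_right (wt_pos γ μ a p), mul_assoc, hEw, mul_one]
  intro p₀ hp₀
  have hEc : Continuous E := by fun_prop
  obtain ⟨p, hp, hmax⟩ := (isCompact_closedRect T).exists_isMaxOn ⟨p₀, hp₀⟩
    (hw.mul hEc.continuousOn)
  rw [← key]
  refine (hmax hp₀).trans ?_
  by_contra! hgt
  have hnot : ¬ w p ≤ c * wt γ μ a p := fun h => (not_le.2 hgt) ((key p).2 h)
  obtain ⟨x, t⟩ := p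
  have hxa : x ≠ a := by
    rintro rfl; exact hnot (hin t hp.2)
  have ht : 0 < t := by
    rcases hp.2.1.eq_or_lt with h | h
    · simp only at h
      subst h
      exact absurd (hini x hp.1) hnot
    · exact h
  have hself : χ (x, t) t = x := hχ.self (x, t)
  have hd : HasDerivAt (χ (x, t)) (lam (x, t)) t := hχ.hasDerivAt_self hp
  have hmem : ∀ᶠ s in 𝓝[<] t, (χ (x, t) s, s) ∈ closedRect T :=
    (hχ.eventually_mem ha hsgn hp hxa ht).mono fun s hs =>
      ⟨Ioo_subset_Icc_self hs.1, Ioo_subset_Icc_self hs.2⟩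
  -- derivative of the quotient along the characteristic
  have hdq : HasDerivWithinAt (fun s => w (χ (x, t) s, s) * E (χ (x, t) s, s))
      (r (x, t) * E (x, t) + w (x, t) *
        (E (x, t) * -(γ - μ * ((1 - 2 * a) * lam (x, t))))) (Iic t) t := by
    have hdE : HasDerivAt (fun s => E (χ (x, t) s, s))
        (E (χ (x, t) t, t) * -(γ - μ * ((1 - 2 * a) * lam (x, t)))) t := by
      have := (((hasDerivAt_id t).const_mul γ).sub
        ((((hd.sub_const a).const_mul (1 - 2 * a))).const_mul μ)).neg.exp
      refine this.congr_deriv ?_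
      simp [hE]
    have := (hwr (x, t) hp hxa ht).mul hdE.hasDerivWithinAt
    simp only [hself] at this
    exact this
  -- The left derivative at the maximum is nonnegative. The bounds of `r` and the choice of `γ` make
  -- it negative.
  have hnonneg : 0 ≤ r (x, t) * E (x, t) + w (x, t) *
        (E (x, t) * -(γ - μ * ((1 - 2 * a) * lam (x, t)))) := by
    have hs := hasDerivWithinAt_iff_tendsto_slope.1 hdq
    rw [Iic_sdiff_right] at hs
    refine ge_of_tendsto hs ?_
    filter_upwards [hmem, self_mem_nhdsWithin] with s h1 h2
    rw [slope_def_field]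
    refine div_nonneg_of_nonpos ?_ (sub_neg.2 h2).le
    rw [hself, sub_nonpos]
    exact hmax h1
  have hwpos : 0 < w (x, t) := by
    by_contra! h
    exact hnot (h.trans (mul_nonneg hc (wt_pos _ _ _ _).le))
  have hr' := hr (x, t) hp hxa ht
  rw [abs_of_pos hwpos] at hr'
  have hlam : μ * ((1 - 2 * a) * lam (x, t)) ≤ μ * Λ := by
    refine mul_le_mul_of_nonneg_left (le_trans ?_ (hΛ _ hp)) hμ
    rcases ha with rfl | rfl
    · simpa using le_abs_self _
    · have := neg_le_abs (lam (x, t)); linarith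
  have h1 : r (x, t) * E (x, t) ≤ Λ₁ * (w (x, t) * E (x, t)) + κ * c := by
    have := mul_le_mul_of_nonneg_right hr' (hEpos (x, t)).le
    have h2 : κ * c * wt γ μ a (x, t) * E (x, t) = κ * c := by
      rw [mul_assoc, mul_comm (wt _ _ _ _), hEw, mul_one]
    linarith
  have hq : 0 < w (x, t) * E (x, t) := mul_pos hwpos (hEpos _)
  have h3 : 0 ≤ (Λ₁ - γ + μ * Λ) * (w (x, t) * E (x, t)) + κ * c := by
    have h4 := mul_le_mul_of_nonneg_right hlam hq.le
    linarith
  have h5 : (Λ₁ - γ + μ * Λ) * (w (x, t) * E (x, t)) ≤ -κ * (w (x, t) * E (x, t)) :=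
    mul_le_mul_of_nonneg_right (by linarith) hq.le
  have h6 : κ * c < κ * (w (x, t) * E (x, t)) := mul_lt_mul_of_pos_left hgt hκ
  linarith

/-- Two-sided form of `le_wt_of_along`. -/
lemma abs_le_wt_of_along {T Λ Λ₁ γ μ c a : ℝ} {lam w r : ℝ × ℝ → ℝ} {χ : ℝ × ℝ → ℝ → ℝ}
    (ha : a = 0 ∨ a = 1) (hχ : IsChar T lam χ) (hsgn : ∀ p ∈ closedRect T, 0 < (1 - 2 * a) * lam p)
    (hΛ : ∀ p ∈ closedRect T, |lam p| ≤ Λ) (hμ : 0 ≤ μ) {κ : ℝ} (hκ : 0 < κ)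
    (hγ : μ * Λ + Λ₁ + κ ≤ γ) (hc : 0 ≤ c) (hw : ContinuousOn w (closedRect T))
    (hwr : ∀ p ∈ closedRect T, p.1 ≠ a → 0 < p.2 →
      HasDerivWithinAt (fun s => w (χ p s, s)) (r p) (Iic p.2) p.2)
    (hr : ∀ p ∈ closedRect T, p.1 ≠ a → 0 < p.2 → |r p| ≤ Λ₁ * |w p| + κ * c * wt γ μ a p)
    (hin : ∀ t ∈ Icc 0 T, |w (a, t)| ≤ c * wt γ μ a (a, t))
    (hini : ∀ x ∈ Icc (0 : ℝ) 1, |w (x, 0)| ≤ c * wt γ μ a (x, 0)) :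
    ∀ p ∈ closedRect T, |w p| ≤ c * wt γ μ a p := by
  intro p hp
  refine abs_le'.2 ⟨?_, ?_⟩
  · exact le_wt_of_along ha hχ hsgn hΛ hμ hκ hγ hc hw hwr
      (fun p hp h1 h2 => (le_abs_self _).trans (hr p hp h1 h2))
      (fun t ht => (le_abs_self _).trans (hin t ht))
      (fun x hx => (le_abs_self _).trans (hini x hx)) p hp
  · exact le_wt_of_along (w := fun p => -w p) (r := fun p => -r p) ha hχ hsgn hΛ hμ hκ hγ hc hw.neg
      (fun p hp h1 h2 => (hwr p hp h1 h2).neg)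
      (fun p hp h1 h2 => by rw [abs_neg]; exact (neg_le_abs _).trans (hr p hp h1 h2))
      (fun t ht => (neg_le_abs _).trans (hin t ht))
      (fun x hx => (neg_le_abs _).trans (hini x hx)) p hp

/-! ### One step of the iteration -/

section vectors

variable {n : ℕ}

/-- The vector of the values at `q` of `n` functions. -/
noncomputable def vec (u : Fin n → ℝ × ℝ → ℝ) (q : ℝ × ℝ) : E n := WithLp.toLp 2 fun i => u i q

/-- The vector of the values at time `t` at the outflow sides. -/
noncomputable def outVec (k : ℕ) (u : Fin n → ℝ × ℝ → ℝ) (t : ℝ) : E n :=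
  WithLp.toLp 2 fun i => u i (outflow k i, t)

lemma continuousOn_toLp {X : Type*} [TopologicalSpace X] {s : Set X} {y : Fin n → X → ℝ}
    (h : ∀ i, ContinuousOn (y i) s) :
    ContinuousOn (fun x => (WithLp.toLp 2 fun i => y i x : E n)) s :=
  (PiLp.continuous_toLp 2 fun _ : Fin n => ℝ).comp_continuousOn (continuousOn_pi.2 h)

lemma hasDerivWithinAt_toLp {y : Fin n → ℝ → ℝ} {y' : Fin n → ℝ} {s : Set ℝ} {x : ℝ}
    (h : ∀ i, HasDerivWithinAt (y i) (y' i) s x) :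
    HasDerivWithinAt (fun x => (WithLp.toLp 2 fun i => y i x : E n)) (WithLp.toLp 2 y') s x :=
  ((PiLp.continuousLinearEquiv 2 ℝ fun _ : Fin n => ℝ).symm.toContinuousLinearMap.hasFDerivAt
    (x := fun i => y i x)).comp_hasDerivWithinAt x (hasDerivWithinAt_pi.2 h)

lemma hasDerivWithinAt_apply {y : ℝ → E n} {y' : E n} {s : Set ℝ} {x : ℝ}
    (h : HasDerivWithinAt y y' s x) (i : Fin n) :
    HasDerivWithinAt (fun x => y x i) (y' i) s x :=
  ((EuclideanSpace.proj i : E n →L[ℝ] ℝ).hasFDerivAt (x := y x)).comp_hasDerivWithinAt x h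

lemma continuousOn_apply {X : Type*} [TopologicalSpace X] {s : Set X} {y : X → E n}
    (h : ContinuousOn y s) (i : Fin n) : ContinuousOn (fun x => y x i) s :=
  (EuclideanSpace.proj i : E n →L[ℝ] ℝ).continuous.comp_continuousOn h

lemma inflow_eq (k : ℕ) (i : Fin n) : inflow k i = 0 ∨ inflow k i = 1 := by
  unfold inflow; split_ifs <;> simp

lemma outflow_eq (k : ℕ) (i : Fin n) : outflow k i = 1 - inflow k i := by
  unfold inflow outflow; split_ifs <;> simp

lemma inflow_mem (k : ℕ) (i : Fin n) : inflow k i ∈ Icc (0 : ℝ) 1 := by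
  rcases inflow_eq k i with h | h <;> simp [h]

lemma outflow_mem (k : ℕ) (i : Fin n) : outflow k i ∈ Icc (0 : ℝ) 1 := by
  rcases inflow_eq k i with h | h <;> simp [outflow_eq, h]

end vectors

/-- The data of the problem: speeds, source, initial and boundary functions that satisfy the
regularity, sign, growth and compatibility conditions. -/
structure Admissible {n : ℕ} (k : ℕ) (lam : Fin n → ℝ × ℝ → ℝ) (f : ℝ × ℝ → E n → E n)
    (φ : ℝ → E n) (h : ℝ → E n → E n) : Prop where
  speed : ∀ i, SpeedRegular (lam i)
  neg : ∀ i : Fin n, i.val < k → ∀ p ∈ closedStrip, lam i p < 0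
  pos : ∀ i : Fin n, k ≤ i.val → ∀ p ∈ closedStrip, 0 < lam i p
  source : SourceRegular f
  init : ContDiffOn ℝ 1 φ (Icc 0 1)
  bdry : BoundaryRegular h
  bdryGrad : BoundaryGradBounded h
  growth : SourceGradGrowth f
  compat₀ : ZeroOrderCompatible k φ h
  compat₁ : FirstOrderCompatible k lam f φ h

/-- The `x`-derivative of a speed. -/
noncomputable def speedDeriv (l : ℝ × ℝ → ℝ) (p : ℝ × ℝ) : ℝ :=
  derivWithin (fun ξ => l (ξ, p.2)) (Icc 0 1) p.1

section derivatives

variable {n : ℕ}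

/-- The `x`-derivative of the source. -/
noncomputable def srcX (f : ℝ × ℝ → E n → E n) (p : ℝ × ℝ) (y : E n) : E n :=
  derivWithin (fun ξ => f (ξ, p.2) y) (Icc 0 1) p.1

/-- The total derivative of the boundary function. -/
noncomputable def bdryD (h : ℝ → E n → E n) (t : ℝ) (y : E n) : ℝ × E n →L[ℝ] E n :=
  fderivWithin ℝ (fun q : ℝ × E n => h q.1 q.2) (Ici 0 ×ˢ univ) (t, y)

/-- The derivatives of the components of the initial function. -/
noncomputable def initD (φ : ℝ → E n) (i : Fin n) (x : ℝ) : ℝ :=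
  derivWithin (fun ξ => φ ξ i) (Icc 0 1) x

variable {f : ℝ × ℝ → E n → E n} {h : ℝ → E n → E n} {φ : ℝ → E n}

lemma SpeedRegular.hasDerivWithinAt {l : ℝ × ℝ → ℝ} (hl : SpeedRegular l) {p : ℝ × ℝ}
    (hp : p ∈ closedStrip) :
    HasDerivWithinAt (fun ξ => l (ξ, p.2)) (speedDeriv l p) (Icc 0 1) p.1 :=
  (hl.2.1 p.1 hp.1 p.2 hp.2).hasDerivWithinAt

/-- The chain rule for `ξ ↦ f (ξ, t) (y ξ)`. -/
lemma SourceRegular.hasDerivWithinAt_comp (hf : SourceRegular f) {p : ℝ × ℝ} (hp : p ∈ closedStrip)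
    {y : ℝ → E n} {y' : E n} (hy : HasDerivWithinAt y y' (Icc 0 1) p.1) :
    HasDerivWithinAt (fun ξ => f (ξ, p.2) (y ξ))
      (srcX f p (y p.1) + fderiv ℝ (f p) (y p.1) y') (Icc 0 1) p.1 := by
  obtain ⟨x, t⟩ := p
  have hc : ContinuousOn (fun q : ℝ × E n => ContinuousLinearMap.toSpanSingleton ℝ
      (srcX f (q.1, t) q.2)) (Icc 0 1 ×ˢ univ) := by
    have h1 : ContinuousOn (fun q : ℝ × E n => srcX f (q.1, t) q.2) (Icc 0 1 ×ˢ univ) :=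
      hf.2.2.1.comp (f := fun q : ℝ × E n => ((q.1, t), q.2)) (by fun_prop)
        fun q hq => ⟨⟨hq.1, hp.2⟩, trivial⟩
    exact (ContinuousLinearMap.toSpanSingletonCLE (𝕜 := ℝ) (E := E n)).continuous.comp_continuousOn
      h1
  have key := hasFDerivWithinAt_of_partial (convex_Icc (0 : ℝ) 1) (t := (univ : Set (E n)))
    (f := fun ξ y => f (ξ, t) y) (u := (x, y x)) ⟨hp.1, trivial⟩
    (fun ξ hξ z _ => (hf.2.1 ξ hξ t hp.2 z).hasDerivWithinAt.hasFDerivWithinAt)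
    (hc (x, y x) ⟨hp.1, trivial⟩) (f₂ := fderiv ℝ (f (x, t)) (y x))
    (hf.2.2.2.1 (x, t) hp (y x)).hasFDerivAt.hasFDerivWithinAt
  have hcurve : HasDerivWithinAt (fun ξ => (ξ, y ξ)) ((1 : ℝ), y') (Icc 0 1) x :=
    (hasDerivWithinAt_id x _).prodMk hy
  have := key.comp_hasDerivWithinAt_of_eq x hcurve (fun ξ hξ => ⟨hξ, trivial⟩) rfl
  refine HasDerivWithinAt.congr_deriv this ?_
  simp

lemma uniqueDiffOn_bdry : UniqueDiffOn ℝ (Ici (0 : ℝ) ×ˢ (univ : Set (E n))) :=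
  (uniqueDiffOn_Ici 0).prod uniqueDiffOn_univ

lemma BoundaryRegular.hasFDerivWithinAt (hh : BoundaryRegular h) {t : ℝ} (ht : 0 ≤ t) (y : E n) :
    HasFDerivWithinAt (fun q : ℝ × E n => h q.1 q.2) (bdryD h t y) (Ici 0 ×ˢ univ) (t, y) :=
  (hh.differentiableOn one_ne_zero (t, y) ⟨ht, trivial⟩).hasFDerivWithinAt

lemma BoundaryRegular.continuousOn_bdryD (hh : BoundaryRegular h) :
    ContinuousOn (fun q : ℝ × E n => bdryD h q.1 q.2) (Ici 0 ×ˢ univ) :=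
  hh.continuousOn_fderivWithin uniqueDiffOn_bdry le_rfl

/-- The chain rule for `s ↦ h s (y s)`. -/
lemma BoundaryRegular.hasDerivWithinAt_comp (hh : BoundaryRegular h) {T t : ℝ} (ht : 0 ≤ t)
    {y : ℝ → E n} {y' : E n} (hy : HasDerivWithinAt y y' (Icc 0 T) t) :
    HasDerivWithinAt (fun s => h s (y s)) (bdryD h t (y t) (1, y')) (Icc 0 T) t :=
  (hh.hasFDerivWithinAt ht (y t)).comp_hasDerivWithinAt_of_eq (f := fun s => (s, y s)) t
    ((hasDerivWithinAt_id t _).prodMk hy) (fun _ hs => ⟨hs.1, trivial⟩) rfl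

lemma BoundaryRegular.hasFDerivAt (hh : BoundaryRegular h) {t : ℝ} (ht : 0 ≤ t) (y : E n) :
    HasFDerivAt (h t) ((bdryD h t y).comp (ContinuousLinearMap.inr ℝ ℝ (E n))) y := by
  have := (hh.hasFDerivWithinAt ht y).comp (s := univ) (f := fun y : E n => (t, y)) y
    (hasFDerivAt_prodMk_right t y).hasFDerivWithinAt (fun _ _ => ⟨ht, trivial⟩)
  rwa [hasFDerivWithinAt_univ] at this

/-- The right-hand side of the first-order compatibility condition as a total derivative. -/
lemma BoundaryRegular.derivWithin_add_fderiv (hh : BoundaryRegular h) (y w : E n) (i : Fin n) :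
    derivWithin (fun t => h t y i) (Ici 0) 0 + fderiv ℝ (fun z => h 0 z i) y w =
      bdryD h 0 y (1, w) i := by
  have h1 : HasDerivWithinAt (fun t => h t y) (bdryD h 0 y (1, 0)) (Ici 0) 0 :=
    (hh.hasFDerivWithinAt le_rfl y).comp_hasDerivWithinAt_of_eq (f := fun s => (s, y)) 0
      ((hasDerivWithinAt_id 0 _).prodMk (hasDerivWithinAt_const 0 _ y))
      (fun _ hs => ⟨hs, trivial⟩) rfl
  have h2 : HasFDerivAt (fun z => h 0 z i) ((EuclideanSpace.proj i : E n →L[ℝ] ℝ).comp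
      ((bdryD h 0 y).comp (ContinuousLinearMap.inr ℝ ℝ (E n)))) y :=
    (EuclideanSpace.proj i : E n →L[ℝ] ℝ).hasFDerivAt.comp y (hh.hasFDerivAt le_rfl y)
  rw [(hasDerivWithinAt_apply h1 i).derivWithin (uniqueDiffWithinAt_Ici 0), h2.fderiv]
  have : ((1 : ℝ), w) = (1, 0) + (0, w) := by simp
  rw [this, map_add]
  rfl

lemma hasDerivWithinAt_initD (hφ : ContDiffOn ℝ 1 φ (Icc 0 1)) (i : Fin n) {x : ℝ}
    (hx : x ∈ Icc (0 : ℝ) 1) : HasDerivWithinAt (fun ξ => φ ξ i) (initD φ i x) (Icc 0 1) x :=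
  ((contDiffOn_euclidean.1 hφ i).differentiableOn one_ne_zero x hx).hasDerivWithinAt

lemma continuousOn_initD (hφ : ContDiffOn ℝ 1 φ (Icc 0 1)) (i : Fin n) :
    ContinuousOn (initD φ i) (Icc 0 1) :=
  ((contDiffOn_one_iff_derivWithin (uniqueDiffOn_Icc zero_lt_one)).1
    (contDiffOn_euclidean.1 hφ i)).2

end derivatives

variable {n k : ℕ} {lam : Fin n → ℝ × ℝ → ℝ} {f : ℝ × ℝ → E n → E n} {φ : ℝ → E n}
  {h : ℝ → E n → E n}

lemma Admissible.sign (H : Admissible k lam f φ h) (i : Fin n) {p : ℝ × ℝ} (hp : p ∈ closedStrip) :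
    0 < (1 - 2 * inflow k i) * lam i p := by
  unfold inflow
  split_ifs with hi
  · have := H.neg i hi p hp
    linarith
  · have := H.pos i (not_lt.1 hi) p hp
    linarith

/-- An iterate: the components `u` of the approximate solution with their partial derivatives
`z = ∂_x u` and `p = ∂_t u`. -/
structure Iterate (n : ℕ) where
  /-- the components -/
  u : Fin n → ℝ × ℝ → ℝ
  /-- the `x`-derivatives -/
  z : Fin n → ℝ × ℝ → ℝ
  /-- the `t`-derivatives -/
  p : Fin n → ℝ × ℝ → ℝ

/-- The iterate is `C¹` in the rectangle, has the prescribed initial values, and at the outflow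
corners its time derivative is the one that the differential equations prescribe. -/
structure Iterate.IsRegular (k : ℕ) (lam : Fin n → ℝ × ℝ → ℝ) (f : ℝ × ℝ → E n → E n)
    (φ : ℝ → E n) (T : ℝ) (s : Iterate n) : Prop where
  cont_u : ∀ i, ContinuousOn (s.u i) (closedRect T)
  cont_z : ∀ i, ContinuousOn (s.z i) (closedRect T)
  cont_p : ∀ i, ContinuousOn (s.p i) (closedRect T)
  deriv_fst : ∀ i, ∀ q ∈ closedRect T,
    HasDerivWithinAt (fun ξ => s.u i (ξ, q.2)) (s.z i q) (Icc 0 1) q.1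
  deriv_snd : ∀ i, ∀ q ∈ closedRect T,
    HasDerivWithinAt (fun r => s.u i (q.1, r)) (s.p i q) (Icc 0 T) q.2
  init : ∀ i, ∀ x ∈ Icc (0 : ℝ) 1, s.u i (x, 0) = φ x i
  corner : ∀ i, s.p i (outflow k i, 0) = initialVelocity lam f φ (outflow k i) i

/-- The source term of an iterate. -/
noncomputable def Iterate.src (f : ℝ × ℝ → E n → E n) (s : Iterate n) (i : Fin n) (q : ℝ × ℝ) : ℝ :=
  f q (vec s.u q) i

/-- The `x`-derivative of the source term of an iterate. -/
noncomputable def Iterate.srcDeriv (f : ℝ × ℝ → E n → E n) (s : Iterate n) (i : Fin n)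
    (q : ℝ × ℝ) : ℝ :=
  (srcX f q (vec s.u q) + fderiv ℝ (f q) (vec s.u q) (vec s.z q)) i

/-- `s'` solves the linear transport equations whose source and boundary values are computed
from `s`. The derivative `s'.z` has the inflow values that the differential equations and the
differentiated boundary conditions prescribe. -/
structure Iterate.IsStep (k : ℕ) (lam : Fin n → ℝ × ℝ → ℝ) (f : ℝ × ℝ → E n → E n)
    (φ : ℝ → E n) (h : ℝ → E n → E n) (T : ℝ) (χ : Fin n → ℝ × ℝ → ℝ → ℝ) (s s' : Iterate n) :
    Prop where
  transport : ∀ i, IsTransport T (lam i) (speedDeriv (lam i)) (χ i) (s.src f i) (s.srcDeriv f i)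
    (s'.u i) (s'.z i)
  time : ∀ i q, s'.p i q = s.src f i q - lam i q * s'.z i q
  init : ∀ i, ∀ x ∈ Icc (0 : ℝ) 1, s'.u i (x, 0) = φ x i
  init_z : ∀ i, ∀ x ∈ Icc (0 : ℝ) 1, s'.z i (x, 0) = initD φ i x
  bdry : ∀ i, ∀ t ∈ Icc 0 T, s'.u i (inflow k i, t) = h t (outVec k s.u t) i
  bdry_z : ∀ i, ∀ t ∈ Icc 0 T, lam i (inflow k i, t) * s'.z i (inflow k i, t) =
    s.src f i (inflow k i, t) - bdryD h t (outVec k s.u t) (1, outVec k s.p t) i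

/-- Characteristics of all speeds along which the scalar problems are solvable. -/
def IsCharFamily (k : ℕ) (lam : Fin n → ℝ × ℝ → ℝ) (T : ℝ) (χ : Fin n → ℝ × ℝ → ℝ → ℝ) : Prop :=
  ∀ i, IsChar T (lam i) (χ i) ∧ ∀ (g g' : ℝ × ℝ → ℝ) (b b' φ φ' : ℝ → ℝ),
      ContinuousOn g (closedRect T) → ContinuousOn g' (closedRect T) →
      (∀ p ∈ closedRect T, HasDerivWithinAt (fun ξ => g (ξ, p.2)) (g' p) (Icc 0 1) p.1) →
      (∀ t ∈ Icc 0 T, HasDerivWithinAt b (b' t) (Icc 0 T) t) → ContinuousOn b' (Icc 0 T) →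
      (∀ x ∈ Icc (0 : ℝ) 1, HasDerivWithinAt φ (φ' x) (Icc 0 1) x) →
      ContinuousOn φ' (Icc 0 1) → φ (inflow k i) = b 0 →
      g (inflow k i, 0) - lam i (inflow k i, 0) * φ' (inflow k i) = b' 0 →
      ∃ w z, IsTransport T (lam i) (speedDeriv (lam i)) (χ i) g g' w z ∧
        (∀ x ∈ Icc (0 : ℝ) 1, w (x, 0) = φ x) ∧ ∀ t ∈ Icc 0 T, w (inflow k i, t) = b t

lemma Admissible.exists_isCharFamily (H : Admissible k lam f φ h) {T : ℝ} (hT : 0 < T) :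
    ∃ χ, IsCharFamily k lam T χ := by
  have hsub := closedRect_subset T
  have := fun i => exists_isTransport hT ((H.speed i).1.mono hsub) ((H.speed i).2.2.mono hsub)
    (fun p hp => (H.speed i).hasDerivWithinAt (hsub hp)) (inflow_eq k i)
    (fun p hp => H.sign i (hsub hp))
  choose χ hχ using this
  exact ⟨χ, hχ⟩

section step

variable {T : ℝ} {s : Iterate n}

lemma Iterate.IsRegular.continuousOn_vec (hs : s.IsRegular k lam f φ T) :
    ContinuousOn (fun q => (q, vec s.u q)) (closedRect T) :=
  continuousOn_id.prodMk (continuousOn_toLp hs.cont_u)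

lemma Iterate.IsRegular.continuousOn_src (H : Admissible k lam f φ h)
    (hs : s.IsRegular k lam f φ T) (i : Fin n) : ContinuousOn (s.src f i) (closedRect T) :=
  continuousOn_apply (H.source.1.comp hs.continuousOn_vec
    fun _ hq => ⟨closedRect_subset T hq, trivial⟩) i

lemma Iterate.IsRegular.continuousOn_srcDeriv (H : Admissible k lam f φ h)
    (hs : s.IsRegular k lam f φ T) (i : Fin n) : ContinuousOn (s.srcDeriv f i) (closedRect T) := by
  have hm : MapsTo (fun q => (q, vec s.u q)) (closedRect T) (closedStrip ×ˢ univ) :=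
    fun _ hq => ⟨closedRect_subset T hq, trivial⟩
  exact continuousOn_apply ((H.source.2.2.1.comp hs.continuousOn_vec hm).add
    ((H.source.2.2.2.2.comp hs.continuousOn_vec hm).clm_apply (continuousOn_toLp hs.cont_z))) i

lemma mem_side {x t : ℝ} (hx : x ∈ Icc (0 : ℝ) 1) (ht : t ∈ Icc 0 T) : (x, t) ∈ closedRect T :=
  ⟨hx, ht⟩

lemma continuousOn_outVec {w : Fin n → ℝ × ℝ → ℝ} (hw : ∀ i, ContinuousOn (w i) (closedRect T)) :
    ContinuousOn (outVec k w) (Icc 0 T) :=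
  continuousOn_toLp fun i => (hw i).comp (by fun_prop) fun _ ht => mem_side (outflow_mem k i) ht

/-- The scalar problems with the source and boundary values of an iterate have compatible data, so
the next iterate exists. -/
theorem Iterate.IsRegular.exists_step (H : Admissible k lam f φ h) (hT : 0 < T)
    {χ : Fin n → ℝ × ℝ → ℝ → ℝ} (hχ : IsCharFamily k lam T χ) (hs : s.IsRegular k lam f φ T) :
    ∃ s' : Iterate n, s'.IsRegular k lam f φ T ∧ s.IsStep k lam f φ h T χ s' := by
  have h0T : (0 : ℝ) ∈ Icc 0 T := ⟨le_rfl, hT.le⟩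
  have hin := inflow_mem (n := n) k
  have hout := outflow_mem (n := n) k
  have vec0 : ∀ x ∈ Icc (0 : ℝ) 1, vec s.u (x, 0) = φ x := fun x hx => by
    ext i; exact hs.init i x hx
  have out0 : outVec k s.u 0 = outTrace k φ := by
    ext i; exact hs.init i _ (hout i)
  have pout0 : outVec k s.p 0 = outTrace k (initialVelocity lam f φ) := by
    ext i; exact hs.corner i
  have dOut : ∀ t ∈ Icc 0 T, HasDerivWithinAt (outVec k s.u) (outVec k s.p t) (Icc 0 T) t :=
    fun t ht => hasDerivWithinAt_toLp fun i => hs.deriv_snd i _ (mem_side (hout i) ht)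
  have dB : ∀ t ∈ Icc 0 T, HasDerivWithinAt (fun t => h t (outVec k s.u t))
      (bdryD h t (outVec k s.u t) (1, outVec k s.p t)) (Icc 0 T) t := fun t ht =>
    H.bdry.hasDerivWithinAt_comp ht.1 (dOut t ht)
  have src0 : ∀ i, ∀ x ∈ Icc (0 : ℝ) 1, s.src f i (x, 0) - lam i (x, 0) * initD φ i x =
      initialVelocity lam f φ x i := fun i x hx => by
    rw [Iterate.src, vec0 x hx]; rfl
  have sol := fun i => (hχ i).2 (s.src f i) (s.srcDeriv f i) (fun t => h t (outVec k s.u t) i)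
    (fun t => bdryD h t (outVec k s.u t) (1, outVec k s.p t) i) (fun x => φ x i) (initD φ i)
    (hs.continuousOn_src H i) (hs.continuousOn_srcDeriv H i)
    (fun p hp => hasDerivWithinAt_apply (H.source.hasDerivWithinAt_comp (closedRect_subset T hp)
      (y := fun ξ => vec s.u (ξ, p.2)) (y' := vec s.z p)
      (hasDerivWithinAt_toLp fun j => hs.deriv_fst j p hp)) i)
    (fun t ht => hasDerivWithinAt_apply (dB t ht) i)
    (continuousOn_apply ((H.bdry.continuousOn_bdryD.comp
      (continuousOn_id.prodMk (continuousOn_outVec hs.cont_u))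
      fun t ht => ⟨ht.1, trivial⟩).clm_apply
        (continuousOn_const.prodMk (continuousOn_outVec hs.cont_p))) i)
    (fun x hx => hasDerivWithinAt_initD H.init i hx) (continuousOn_initD H.init i)
    (by rw [H.compat₀ i, out0])
    (by rw [src0 i _ (hin i), H.compat₁ i, H.bdry.derivWithin_add_fderiv, out0, pout0])
  choose w z hwz hini hbd using sol
  have hz0 : ∀ i, ∀ x ∈ Icc (0 : ℝ) 1, z i (x, 0) = initD φ i x := fun i x hx => by
    have h1 := ((hwz i).deriv_fst (x, 0) (mem_side hx h0T)).derivWithin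
      (uniqueDiffOn_Icc zero_lt_one x hx)
    have h2 : HasDerivWithinAt (fun ξ => w i (ξ, 0)) (initD φ i x) (Icc 0 1) x :=
      (hasDerivWithinAt_initD H.init i hx).congr (hini i) (hini i x hx)
    rw [← h1, ← h2.derivWithin (uniqueDiffOn_Icc zero_lt_one x hx)]
  refine ⟨⟨w, z, fun i q => s.src f i q - lam i q * z i q⟩, ⟨fun i => (hwz i).continuousOn,
    fun i => (hwz i).continuousOn_deriv, fun i => ?_, fun i => (hwz i).deriv_fst,
    fun i => (hwz i).deriv_snd, hini, fun i => ?_⟩, ⟨hwz, fun i q => rfl, hini, hz0, hbd, ?_⟩⟩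
  · exact (hs.continuousOn_src H i).sub (((H.speed i).1.mono (closedRect_subset T)).mul
      (hwz i).continuousOn_deriv)
  · change s.src f i _ - lam i _ * z i _ = _
    rw [hz0 i _ (hout i), src0 i _ (hout i)]
  · intro i t ht
    have h1 := ((hwz i).deriv_snd _ (mem_side (hin i) ht)).derivWithin (uniqueDiffOn_Icc hT t ht)
    have h2 : HasDerivWithinAt (fun r => w i (inflow k i, r)) _ (Icc 0 T) t :=
      (hasDerivWithinAt_apply (dB t ht) i).congr (hbd i) (hbd i t ht)
    rw [h2.derivWithin (uniqueDiffOn_Icc hT t ht)] at h1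
    rw [h1]
    ring

end step

/-! ### Weighted estimates for the system -/

/-- Bounds for the speeds and for the boundary function up to time `T`, and a spatial weight `μ`
that beats the Lipschitz constant of the reflection at the boundary. -/
structure RectBounds {n : ℕ} (k : ℕ) (lam : Fin n → ℝ × ℝ → ℝ) (h : ℝ → E n → E n) (T : ℝ) where
  /-- bound of the speeds -/
  Λ : ℝ
  /-- bound of the `x`-derivatives of the speeds -/
  Λ₁ : ℝ
  /-- lower bound of the absolute values of the speeds -/
  ℓ : ℝ
  /-- Lipschitz constant of the boundary function -/
  L : ℝ
  /-- the spatial weight -/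
  μ : ℝ
  Λ_nonneg : 0 ≤ Λ
  Λ₁_nonneg : 0 ≤ Λ₁
  ℓ_pos : 0 < ℓ
  L_nonneg : 0 ≤ L
  μ_nonneg : 0 ≤ μ
  speed_le : ∀ i, ∀ p ∈ closedRect T, |lam i p| ≤ Λ
  speedDeriv_le : ∀ i, ∀ p ∈ closedRect T, |speedDeriv (lam i) p| ≤ Λ₁
  le_speed : ∀ i, ∀ p ∈ closedRect T, ℓ ≤ |lam i p|
  bdry_le : ∀ t ∈ Icc 0 T, ∀ y : E n, ‖fderiv ℝ (h t) y‖ ≤ L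
  weight_le : L * n * Real.exp (-μ) ≤ 1 / 4
  weight_le' : L * n * (Λ + 1) * Real.exp (-μ) ≤ ℓ / 4

lemma exists_common_bound {S : Set (ℝ × ℝ)} {w : Fin n → ℝ × ℝ → ℝ}
    (hw : ∀ i, ∃ C, 0 ≤ C ∧ ∀ p ∈ S, |w i p| ≤ C) :
    ∃ C, 0 ≤ C ∧ ∀ i, ∀ p ∈ S, |w i p| ≤ C := by
  choose C hC0 hC using hw
  exact ⟨∑ i, C i, Finset.sum_nonneg fun i _ => hC0 i, fun i p hp => (hC i p hp).trans
    (Finset.single_le_sum (f := C) (fun j _ => hC0 j) (Finset.mem_univ i))⟩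

theorem Admissible.nonempty_rectBounds (H : Admissible k lam f φ h) (T : ℝ) :
    Nonempty (RectBounds k lam h T) := by
  have hsub := closedRect_subset T
  have hne : ∀ i, ∀ p ∈ closedRect T, lam i p ≠ 0 := fun i p hp h0 => by
    simpa [h0] using H.sign i (hsub hp)
  obtain ⟨Λ, hΛ0, hΛ⟩ := exists_common_bound fun i =>
    exists_bound_closedRect ((H.speed i).1.mono hsub)
  obtain ⟨Λ₁, hΛ₁0, hΛ₁⟩ := exists_common_bound fun i =>
    exists_bound_closedRect (g := speedDeriv (lam i)) ((H.speed i).2.2.mono hsub)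
  obtain ⟨M, hM0, hM⟩ := exists_common_bound fun i =>
    exists_bound_closedRect (((H.speed i).1.mono hsub).inv₀ (hne i))
  obtain ⟨L, hL⟩ := H.bdryGrad (Icc 0 T) isCompact_Icc Icc_subset_Ici_self
  have hℓ : 0 < (M + 1)⁻¹ := by positivity
  set A : ℝ := (max L 0 * n + max L 0 * n * (Λ + 1)) with hA
  have hA0 : 0 ≤ A := by positivity
  have hlim : Tendsto (fun μ : ℝ => A * Real.exp (-μ)) atTop (𝓝 0) := by
    simpa using (Real.tendsto_exp_neg_atTop_nhds_zero).const_mul A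
  obtain ⟨μ, hμ, hμ0⟩ := ((hlim.eventually_lt_const
    (show (0 : ℝ) < min (1 / 4) ((M + 1)⁻¹ / 4) by positivity)).and (eventually_ge_atTop 0)).exists
  have hle : ∀ x, x ≤ A → x * Real.exp (-μ) ≤ min (1 / 4) ((M + 1)⁻¹ / 4) := fun x hx =>
    (mul_le_mul_of_nonneg_right hx (Real.exp_pos _).le).trans hμ.le
  refine ⟨⟨Λ, Λ₁, (M + 1)⁻¹, max L 0, μ, hΛ0, hΛ₁0, hℓ, le_max_right _ _, hμ0, hΛ, hΛ₁,
    fun i p hp => ?_, fun t ht y => (hL t ht y).trans (le_max_left _ _),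
    (hle _ (le_add_of_nonneg_right (by positivity))).trans (min_le_left _ _),
    (hle _ (le_add_of_nonneg_left (by positivity))).trans (min_le_right _ _)⟩⟩
  have h1 : |lam i p|⁻¹ ≤ M + 1 := by
    have := hM i p hp
    simp only [Pi.inv_apply, abs_inv] at this
    linarith
  exact inv_le_of_inv_le₀ (abs_pos.2 (hne i p hp)) h1

/-- The components of `w` are bounded by `c` times the weights that belong to their inflow sides. -/
def WtBound (k : ℕ) (γ μ T : ℝ) (w : Fin n → ℝ × ℝ → ℝ) (c : ℝ) : Prop :=
  ∀ i, ∀ p ∈ closedRect T, |w i p| ≤ c * wt γ μ (inflow k i) p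

lemma norm_toLp_le_sum (a : Fin n → ℝ) : ‖(WithLp.toLp 2 a : E n)‖ ≤ ∑ i, |a i| := by
  rw [EuclideanSpace.norm_eq]
  refine Real.sqrt_le_iff.2 ⟨Finset.sum_nonneg fun i _ => abs_nonneg _, ?_⟩
  simpa using Finset.sum_sq_le_sq_sum_of_nonneg (s := Finset.univ) (f := fun i => |a i|)
    (fun i _ => abs_nonneg _)

lemma norm_toLp_le {a : Fin n → ℝ} {C : ℝ} (ha : ∀ i, |a i| ≤ C) :
    ‖(WithLp.toLp 2 a : E n)‖ ≤ n * C :=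
  (norm_toLp_le_sum a).trans
    ((Finset.sum_le_sum fun i _ => ha i).trans (by simp))

lemma abs_apply_le_norm (y : E n) (i : Fin n) : |y i| ≤ ‖y‖ := PiLp.norm_apply_le y i

section weights

variable {γ μ T c : ℝ} {i : Fin n} {p : ℝ × ℝ} {t : ℝ} {w : Fin n → ℝ × ℝ → ℝ}

lemma dist_inflow_mem (k : ℕ) (i : Fin n) (hp : p ∈ closedRect T) :
    (1 - 2 * inflow k i) * (p.1 - inflow k i) ∈ Icc (0 : ℝ) 1 := by
  have h1 := hp.1.1
  have h2 := hp.1.2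
  rcases inflow_eq k i with h | h <;> rw [h] <;> constructor <;> linarith

lemma wt_le_exp (hμ : 0 ≤ μ) (hp : p ∈ closedRect T) :
    wt γ μ (inflow k i) p ≤ Real.exp (γ * p.2) := by
  refine Real.exp_le_exp.2 ?_
  have := mul_nonneg hμ (dist_inflow_mem k i hp).1
  linarith

lemma exp_le_wt (hμ : 0 ≤ μ) (hp : p ∈ closedRect T) :
    Real.exp (γ * p.2) ≤ Real.exp μ * wt γ μ (inflow k i) p := by
  rw [wt, ← Real.exp_add]
  refine Real.exp_le_exp.2 ?_
  have := mul_le_mul_of_nonneg_left (dist_inflow_mem k i hp).2 hμ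
  linarith

lemma one_le_wt (hγ : 0 ≤ γ) (hμ : 0 ≤ μ) (hp : p ∈ closedRect T) :
    1 ≤ Real.exp μ * wt γ μ (inflow k i) p :=
  (Real.one_le_exp (mul_nonneg hγ hp.2.1)).trans (exp_le_wt hμ hp)

lemma wt_inflow (k : ℕ) (i : Fin n) (t : ℝ) :
    wt γ μ (inflow k i) (inflow k i, t) = Real.exp (γ * t) := by
  simp [wt]

lemma wt_outflow (k : ℕ) (i : Fin n) (t : ℝ) :
    wt γ μ (inflow k i) (outflow k i, t) = Real.exp (γ * t) * Real.exp (-μ) := by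
  rw [wt, ← Real.exp_add]
  congr 1
  rcases inflow_eq k i with h | h <;> rw [outflow_eq, h] <;> ring

lemma WtBound.norm_vec_le (hμ : 0 ≤ μ) (hc : 0 ≤ c) (hw : WtBound k γ μ T w c)
    (hp : p ∈ closedRect T) : ‖vec w p‖ ≤ n * c * Real.exp (γ * p.2) := by
  rw [mul_assoc]
  exact norm_toLp_le fun i => (hw i p hp).trans (mul_le_mul_of_nonneg_left (wt_le_exp hμ hp) hc)

lemma WtBound.norm_outVec_le (hw : WtBound k γ μ T w c) (ht : t ∈ Icc 0 T) :
    ‖outVec k w t‖ ≤ n * c * Real.exp (-μ) * Real.exp (γ * t) := by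
  have : ‖outVec k w t‖ ≤ n * (c * (Real.exp (γ * t) * Real.exp (-μ))) :=
    norm_toLp_le fun i => (hw i _ (mem_side (outflow_mem k i) ht)).trans_eq (by rw [wt_outflow])
  linarith

end weights

namespace RectBounds

variable {T : ℝ} (B : RectBounds k lam h T)

/-- Rate of the exponential weight in time that is adapted to the Lipschitz constant `K` of the
source. -/
noncomputable def rate (K : ℝ) : ℝ :=
  B.μ * B.Λ + B.Λ₁ + (1 + 4 * n * K * Real.exp B.μ)

lemma rate_nonneg {K : ℝ} (hK : 0 ≤ K) : 0 ≤ B.rate K := by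
  have h1 := B.Λ_nonneg
  have h2 := B.Λ₁_nonneg
  have h3 := B.μ_nonneg
  unfold rate
  positivity

/-- The basic estimate: the weights turn a system of transport equations into a contraction with the
factor `1 / 4`, up to the contribution of inhomogeneities of size `ε`. -/
theorem wtBound_of_along {φ : ℝ → E n} (H : Admissible k lam f φ h)
    {χ : Fin n → ℝ × ℝ → ℝ → ℝ} (hχ : ∀ i, IsChar T (lam i) (χ i)) {K c ε : ℝ} (hK : 0 ≤ K)
    (hc : 0 ≤ c) (hε : 0 ≤ ε) {w r : Fin n → ℝ × ℝ → ℝ}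
    (hw : ∀ i, ContinuousOn (w i) (closedRect T))
    (hwr : ∀ i, ∀ p ∈ closedRect T, p.1 ≠ inflow k i → 0 < p.2 →
      HasDerivWithinAt (fun s => w i (χ i p s, s)) (r i p) (Iic p.2) p.2)
    (hr : ∀ i, ∀ p ∈ closedRect T, p.1 ≠ inflow k i → 0 < p.2 →
      |r i p| ≤ B.Λ₁ * |w i p| + n * K * c * Real.exp (B.rate K * p.2) + ε)
    (hin : ∀ i, ∀ t ∈ Icc 0 T, |w i (inflow k i, t)| ≤ c / 4 * Real.exp (B.rate K * t) + ε)
    (hini : ∀ i, ∀ x ∈ Icc (0 : ℝ) 1, |w i (x, 0)| ≤ ε) (hT : 0 ≤ T) :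
    WtBound k (B.rate K) B.μ T w (c / 4 + ε * Real.exp B.μ) := by
  intro i
  have hγ := B.rate_nonneg hK
  have hμ := B.μ_nonneg
  have heμ : 1 ≤ Real.exp B.μ := Real.one_le_exp hμ
  have hsub := closedRect_subset T
  refine abs_le_wt_of_along (inflow_eq k i) (hχ i) (fun p hp => H.sign i (hsub hp))
    (B.speed_le i) hμ (κ := 1 + 4 * n * K * Real.exp B.μ) (by positivity) (le_refl (B.rate K))
    (by positivity) (hw i) (hwr i) (fun p hp h1 h2 => ?_) (fun t ht => ?_) (fun x hx => ?_)
  · refine (hr i p hp h1 h2).trans ?_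
    rw [add_assoc]
    refine add_le_add le_rfl ?_
    set W := wt (B.rate K) B.μ (inflow k i) p
    have hW : 0 < W := wt_pos _ _ _ _
    have e1 : Real.exp (B.rate K * p.2) ≤ Real.exp B.μ * W := exp_le_wt hμ hp
    have e2 : (1 : ℝ) ≤ Real.exp B.μ * W := one_le_wt hγ hμ hp
    calc n * K * c * Real.exp (B.rate K * p.2) + ε
        ≤ n * K * c * (Real.exp B.μ * W) + ε * (Real.exp B.μ * W) := by
          refine add_le_add (mul_le_mul_of_nonneg_left e1 (by positivity)) ?_
          exact le_mul_of_one_le_right hε e2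
      _ ≤ n * K * c * (Real.exp B.μ * W) + ε * (Real.exp B.μ * W) +
          (c / 4 * W + 4 * n * K * Real.exp B.μ * (ε * Real.exp B.μ) * W) :=
          le_add_of_nonneg_right (by positivity)
      _ = _ := by ring
  · rw [wt_inflow]
    refine (hin i t ht).trans ?_
    rw [add_mul]
    refine add_le_add le_rfl ?_
    have : (1 : ℝ) ≤ Real.exp (B.rate K * t) := Real.one_le_exp (mul_nonneg hγ ht.1)
    rw [mul_assoc]
    refine le_mul_of_one_le_right hε ?_
    exact one_le_mul_of_one_le_of_one_le heμ this
  · refine (hini i x hx).trans ?_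
    have e2 : (1 : ℝ) ≤ Real.exp B.μ * wt (B.rate K) B.μ (inflow k i) (x, 0) :=
      one_le_wt hγ hμ (mem_side hx ⟨le_rfl, hT⟩)
    have hW := wt_pos (B.rate K) B.μ (inflow k i) (x, 0)
    rw [add_mul, mul_assoc ε]
    exact (le_mul_of_one_le_right hε e2).trans (le_add_of_nonneg_left (by positivity))

lemma norm_bdry_sub_le (hh : BoundaryRegular h) {t : ℝ} (ht : t ∈ Icc 0 T) (y₁ y₂ : E n) :
    ‖h t y₁ - h t y₂‖ ≤ B.L * ‖y₁ - y₂‖ :=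
  convex_univ.norm_image_sub_le_of_norm_fderiv_le
    (fun y _ => (hh.hasFDerivAt ht.1 y).differentiableAt) (fun y _ => B.bdry_le t ht y)
    (mem_univ _) (mem_univ _)

lemma norm_bdryD_le (hh : BoundaryRegular h) {t : ℝ} (ht : t ∈ Icc 0 T) (y w : E n) :
    ‖bdryD h t y (0, w)‖ ≤ B.L * ‖w‖ := by
  have h1 := (hh.hasFDerivAt ht.1 y).fderiv
  have : bdryD h t y (0, w) = fderiv ℝ (h t) y w := by rw [h1]; rfl
  rw [this]
  exact (ContinuousLinearMap.le_opNorm _ _).trans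
    (mul_le_mul_of_nonneg_right (B.bdry_le t ht y) (norm_nonneg _))

lemma reflection_le {c : ℝ} (hc : 0 ≤ c) {w : Fin n → ℝ × ℝ → ℝ} {γ t : ℝ}
    (hw : WtBound k γ B.μ T w c) (ht : t ∈ Icc 0 T) :
    B.L * ‖outVec k w t‖ ≤ c / 4 * Real.exp (γ * t) := by
  have h1 := mul_le_mul_of_nonneg_left (hw.norm_outVec_le ht) B.L_nonneg
  have h2 := mul_le_mul_of_nonneg_right B.weight_le
    (mul_nonneg hc (Real.exp_pos (γ * t)).le)
  linarith

lemma reflection_le' {c : ℝ} (hc : 0 ≤ c) {w : Fin n → ℝ × ℝ → ℝ} {γ t : ℝ}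
    (hw : WtBound k γ B.μ T w ((B.Λ + 1) * c)) (ht : t ∈ Icc 0 T) :
    B.L * ‖outVec k w t‖ ≤ B.ℓ * (c / 4 * Real.exp (γ * t)) := by
  have h1 := mul_le_mul_of_nonneg_left (hw.norm_outVec_le ht) B.L_nonneg
  have h2 := mul_le_mul_of_nonneg_right B.weight_le'
    (mul_nonneg hc (Real.exp_pos (γ * t)).le)
  linarith

end RectBounds

lemma SourceRegular.norm_sub_le (hf : SourceRegular f) {R K : ℝ} {p : ℝ × ℝ}
    (hp : p ∈ closedStrip) (hK : ∀ y : E n, ‖y‖ ≤ R → ‖fderiv ℝ (f p) y‖ ≤ K) {y₁ y₂ : E n}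
    (h₁ : ‖y₁‖ ≤ R) (h₂ : ‖y₂‖ ≤ R) : ‖f p y₁ - f p y₂‖ ≤ K * ‖y₁ - y₂‖ :=
  (convex_closedBall (0 : E n) R).norm_image_sub_le_of_norm_fderiv_le
    (fun y _ => hf.2.2.2.1 p hp y) (fun y hy => hK y (mem_closedBall_zero_iff.1 hy))
    (mem_closedBall_zero_iff.2 h₂) (mem_closedBall_zero_iff.2 h₁)

variable {T : ℝ}

/-! ### Invariant bounds and contraction -/

/-- `w` solves the transport equations whose source and boundary values are computed from `v`, in
the sense of differentiation along characteristics. -/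
structure Solves (k : ℕ) (f : ℝ × ℝ → E n → E n) (φ : ℝ → E n) (h : ℝ → E n → E n) (T : ℝ)
    (χ : Fin n → ℝ × ℝ → ℝ → ℝ) (v w : Fin n → ℝ × ℝ → ℝ) : Prop where
  cont : ∀ i, ContinuousOn (w i) (closedRect T)
  along : ∀ i, ∀ p ∈ closedRect T, p.1 ≠ inflow k i → 0 < p.2 →
    HasDerivWithinAt (fun s => w i (χ i p s, s)) (f p (vec v p) i) (Iic p.2) p.2
  init : ∀ i, ∀ x ∈ Icc (0 : ℝ) 1, w i (x, 0) = φ x i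
  bdry : ∀ i, ∀ t ∈ Icc 0 T, w i (inflow k i, t) = h t (outVec k v t) i

lemma Iterate.IsStep.solves {χ : Fin n → ℝ × ℝ → ℝ → ℝ} {s s' : Iterate n}
    (hs : s.IsStep k lam f φ h T χ s') : Solves k f φ h T χ s.u s'.u :=
  ⟨fun i => (hs.transport i).continuousOn, fun i p hp _ _ => (hs.transport i).along p hp,
    hs.init, hs.bdry⟩

section estimates

variable (H : Admissible k lam f φ h) (B : RectBounds k lam h T) (hT : 0 ≤ T)
  {χ : Fin n → ℝ × ℝ → ℝ → ℝ} (hχ : ∀ i, IsChar T (lam i) (χ i)) {K R : ℝ} (hK : 0 ≤ K)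
  (hKR : ∀ p ∈ closedRect T, ∀ y : E n, ‖y‖ ≤ R → ‖fderiv ℝ (f p) y‖ ≤ K)

include H hT hχ hK hKR

/-- A bound by `N` is reproduced if `N` is large compared with the data; the bound does not depend
on the Lipschitz constant `K` of the source, which only enters the weight. -/
theorem Solves.wtBound {v w : Fin n → ℝ × ℝ → ℝ} (hw : Solves k f φ h T χ v w) {N ε : ℝ}
    (hN : 0 ≤ N) (hε : 0 ≤ ε) (hR : ∀ p ∈ closedRect T, ‖vec v p‖ ≤ R) (hR0 : 0 ≤ R)
    (hf0 : ∀ p ∈ closedRect T, ‖f p 0‖ ≤ ε) (hh0 : ∀ t ∈ Icc 0 T, ‖h t 0‖ ≤ ε)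
    (hφ0 : ∀ i, ∀ x ∈ Icc (0 : ℝ) 1, |φ x i| ≤ ε)
    (hv : WtBound k (B.rate K) B.μ T v N) :
    WtBound k (B.rate K) B.μ T w (N / 4 + ε * Real.exp B.μ) := by
  refine B.wtBound_of_along H hχ hK hN hε hw.cont hw.along (fun i p hp _ _ => ?_)
    (fun i t ht => ?_) (fun i x hx => by rw [hw.init i x hx]; exact hφ0 i x hx) hT
  · have h1 := H.source.norm_sub_le (closedRect_subset T hp) (hKR p hp) (hR p hp)
      (y₂ := 0) (by simpa using hR0)
    have h2 := mul_le_mul_of_nonneg_left (hv.norm_vec_le B.μ_nonneg hN hp) hK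
    have h3 : ‖f p (vec v p)‖ ≤ ‖f p (vec v p) - f p 0‖ + ‖f p 0‖ := by
      simpa using norm_add_le (f p (vec v p) - f p 0) (f p 0)
    rw [sub_zero] at h1
    have h4 := abs_apply_le_norm (f p (vec v p)) i
    have h5 := hf0 p hp
    have h6 := mul_nonneg B.Λ₁_nonneg (abs_nonneg (w i p))
    linarith
  · rw [hw.bdry i t ht]
    have h1 := B.norm_bdry_sub_le H.bdry ht (outVec k v t) 0
    have h2 := B.reflection_le hN hv ht
    have h3 : ‖h t (outVec k v t)‖ ≤ ‖h t (outVec k v t) - h t 0‖ + ‖h t 0‖ := by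
      simpa using norm_add_le (h t (outVec k v t) - h t 0) (h t 0)
    rw [sub_zero] at h1
    have h4 := abs_apply_le_norm (h t (outVec k v t)) i
    have h5 := hh0 t ht
    linarith

/-- The solution operator of the linear transport problems is a contraction. -/
theorem Solves.wtBound_sub {v₁ v₂ w₁ w₂ : Fin n → ℝ × ℝ → ℝ} (h₁ : Solves k f φ h T χ v₁ w₁)
    (h₂ : Solves k f φ h T χ v₂ w₂) {c : ℝ} (hc : 0 ≤ c)
    (hR₁ : ∀ p ∈ closedRect T, ‖vec v₁ p‖ ≤ R) (hR₂ : ∀ p ∈ closedRect T, ‖vec v₂ p‖ ≤ R)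
    (hv : WtBound k (B.rate K) B.μ T (fun i p => v₁ i p - v₂ i p) c) :
    WtBound k (B.rate K) B.μ T (fun i p => w₁ i p - w₂ i p) (c / 4) := by
  have := B.wtBound_of_along H hχ hK hc le_rfl (w := fun i p => w₁ i p - w₂ i p)
    (r := fun i p => f p (vec v₁ p) i - f p (vec v₂ p) i)
    (fun i => (h₁.cont i).sub (h₂.cont i))
    (fun i p hp h1 h2 => (h₁.along i p hp h1 h2).sub (h₂.along i p hp h1 h2))
    (fun i p hp _ _ => ?_) (fun i t ht => ?_)
    (fun i x hx => by simp [h₁.init i x hx, h₂.init i x hx]) hT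
  · simpa using this
  · have h1 := H.source.norm_sub_le (closedRect_subset T hp) (hKR p hp) (hR₁ p hp) (hR₂ p hp)
    have h2 := mul_le_mul_of_nonneg_left (hv.norm_vec_le B.μ_nonneg hc hp) hK
    have h3 : ‖f p (vec v₁ p) - f p (vec v₂ p)‖ ≤ K * ‖vec (fun i p => v₁ i p - v₂ i p) p‖ := h1
    have h4 := abs_apply_le_norm (f p (vec v₁ p) - f p (vec v₂ p)) i
    have h6 := mul_nonneg B.Λ₁_nonneg (abs_nonneg (w₁ i p - w₂ i p))
    rw [PiLp.sub_apply] at h4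
    linarith
  · rw [h₁.bdry i t ht, h₂.bdry i t ht]
    have h1 : _ ≤ B.L * ‖outVec k (fun i p => v₁ i p - v₂ i p) t‖ :=
      B.norm_bdry_sub_le H.bdry ht (outVec k v₁ t) (outVec k v₂ t)
    have h2 := B.reflection_le hc hv ht
    have h4 := abs_apply_le_norm (h t (outVec k v₁ t) - h t (outVec k v₂ t)) i
    rw [PiLp.sub_apply] at h4
    linarith

omit hKR in
/-- The estimate for `x`-derivatives `z'` and `t`-derivatives `p'` that satisfy linear equations
with coefficients computed from `z` and `p`. The bound of `t`-derivatives is `Λ + 1` times the bound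
of `x`-derivatives, as `p' = g - λ z'` with `|λ| ≤ Λ`, and the summand `1` absorbs `ε`. Division by
the speed at the inflow side is compensated by `RectBounds.weight_le'`. -/
theorem wtBound_derivatives {z p z' p' r : Fin n → ℝ × ℝ → ℝ} {c ε : ℝ} (hc : 0 ≤ c) (hε : 0 ≤ ε)
    (hz' : ∀ i, ContinuousOn (z' i) (closedRect T))
    (hzr : ∀ i, ∀ q ∈ closedRect T,
      HasDerivWithinAt (fun s => z' i (χ i q s, s)) (r i q) (Iic q.2) q.2)
    (hr : ∀ i, ∀ q ∈ closedRect T, |r i q| ≤ B.Λ₁ * |z' i q| + K * ‖vec z q‖ + ε)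
    (hin : ∀ i, ∀ t ∈ Icc 0 T, |lam i (inflow k i, t) * z' i (inflow k i, t)| ≤
      B.L * ‖outVec k p t‖ + B.ℓ * ε)
    (hini : ∀ i, ∀ x ∈ Icc (0 : ℝ) 1, |z' i (x, 0)| ≤ ε)
    (hp' : ∀ i, ∀ q ∈ closedRect T, |p' i q| ≤ B.Λ * |z' i q| + ε)
    (hz : WtBound k (B.rate K) B.μ T z c) (hp : WtBound k (B.rate K) B.μ T p ((B.Λ + 1) * c)) :
    WtBound k (B.rate K) B.μ T z' (c / 4 + ε * Real.exp B.μ) ∧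
      WtBound k (B.rate K) B.μ T p' ((B.Λ + 1) * (c / 4 + ε * Real.exp B.μ)) := by
  have key : WtBound k (B.rate K) B.μ T z' (c / 4 + ε * Real.exp B.μ) := by
    refine B.wtBound_of_along H hχ hK hc hε hz' (fun i q hq _ _ => hzr i q hq)
      (fun i q hq _ _ => ?_) (fun i t ht => ?_) hini hT
    · have h2 := mul_le_mul_of_nonneg_left (hz.norm_vec_le B.μ_nonneg hc hq) hK
      have := hr i q hq
      linarith
    · have h1 := hin i t ht
      have h2 := B.reflection_le' hc hp ht
      rw [abs_mul] at h1
      have h3 := mul_le_mul_of_nonneg_right (B.le_speed i _ (mem_side (inflow_mem k i) ht))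
        (abs_nonneg (z' i (inflow k i, t)))
      refine le_of_mul_le_mul_left ?_ B.ℓ_pos
      linarith
  refine ⟨key, fun i q hq => (hp' i q hq).trans ?_⟩
  have h1 := mul_le_mul_of_nonneg_left (key i q hq) B.Λ_nonneg
  have h2 := one_le_wt (k := k) (i := i) (B.rate_nonneg hK) B.μ_nonneg hq
  have h3 := le_mul_of_one_le_right hε h2
  have h4 := mul_nonneg hc (wt_pos (B.rate K) B.μ (inflow k i) q).le
  linarith

/-- A bound for the derivatives of the iterates that one step reproduces. -/
theorem Iterate.IsStep.wtBound_derivatives {s s' : Iterate n} (hs : s.IsStep k lam f φ h T χ s')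
    {c ε : ℝ} (hc : 2 * (ε * Real.exp B.μ) ≤ c) (hε : 0 ≤ ε)
    (hR : ∀ p ∈ closedRect T, ‖vec s.u p‖ ≤ R) (hR' : ∀ t ∈ Icc 0 T, ‖outVec k s.u t‖ ≤ R)
    (hf0 : ∀ p ∈ closedRect T, ∀ y : E n, ‖y‖ ≤ R → ‖f p y‖ ≤ ε ∧ ‖srcX f p y‖ ≤ ε)
    (hh0 : ∀ t ∈ Icc 0 T, ∀ y : E n, ‖y‖ ≤ R → ∀ p ∈ closedRect T, ∀ y' : E n, ‖y'‖ ≤ R →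
      ‖f p y'‖ + ‖bdryD h t y (1, 0)‖ ≤ B.ℓ * ε)
    (hφ0 : ∀ i, ∀ x ∈ Icc (0 : ℝ) 1, |initD φ i x| ≤ ε)
    (hz : WtBound k (B.rate K) B.μ T s.z c)
    (hp : WtBound k (B.rate K) B.μ T s.p ((B.Λ + 1) * c)) :
    WtBound k (B.rate K) B.μ T s'.z c ∧ WtBound k (B.rate K) B.μ T s'.p ((B.Λ + 1) * c) := by
  have hμ := B.μ_nonneg
  have hΛ := B.Λ_nonneg
  have hc0 : 0 ≤ c := le_trans (by positivity) hc
  have key := HypIBVP.wtBound_derivatives H B hT hχ hK (z := s.z) (p := s.p) (z' := s'.z)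
    (p' := s'.p) hc0 hε (fun i => (hs.transport i).continuousOn_deriv)
    (fun i => (hs.transport i).along_deriv) (fun i q hq => ?_) (fun i t ht => ?_)
    (fun i x hx => by rw [hs.init_z i x hx]; exact hφ0 i x hx) (fun i q hq => ?_) hz hp
  · have hle : c / 4 + ε * Real.exp B.μ ≤ c := by linarith
    have hle' : (B.Λ + 1) * (c / 4 + ε * Real.exp B.μ) ≤ (B.Λ + 1) * c :=
      mul_le_mul_of_nonneg_left hle (by positivity)
    exact ⟨fun i q hq => (key.1 i q hq).trans (mul_le_mul_of_nonneg_right hle (wt_pos _ _ _ _).le),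
      fun i q hq => (key.2 i q hq).trans (mul_le_mul_of_nonneg_right hle' (wt_pos _ _ _ _).le)⟩
  · have h1 : |s.srcDeriv f i q| ≤ ε + K * ‖vec s.z q‖ := by
      refine (abs_apply_le_norm _ i).trans ((norm_add_le _ _).trans (add_le_add ?_ ?_))
      · exact (hf0 q hq _ (hR q hq)).2
      · exact (ContinuousLinearMap.le_opNorm _ _).trans
          (mul_le_mul_of_nonneg_right (hKR q hq _ (hR q hq)) (norm_nonneg _))
    have h2 := mul_le_mul_of_nonneg_right (B.speedDeriv_le i q hq) (abs_nonneg (s'.z i q))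
    rw [← abs_mul] at h2
    have h3 := abs_sub (s.srcDeriv f i q) (speedDeriv (lam i) q * s'.z i q)
    linarith
  · rw [hs.bdry_z i t ht]
    have hm := mem_side (T := T) (inflow_mem k i) ht
    have h0 := hh0 t ht _ (hR' t ht) _ hm _ (hR _ hm)
    have e : ((1 : ℝ), outVec k s.p t) = (1, 0) + (0, outVec k s.p t) := by simp
    have h1 : ‖bdryD h t (outVec k s.u t) (1, outVec k s.p t)‖ ≤
        ‖bdryD h t (outVec k s.u t) (1, 0)‖ + B.L * ‖outVec k s.p t‖ := by
      rw [e, map_add]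
      exact (norm_add_le _ _).trans (add_le_add le_rfl (B.norm_bdryD_le H.bdry ht _ _))
    have h2 := abs_apply_le_norm (bdryD h t (outVec k s.u t) (1, outVec k s.p t)) i
    have h3 : |s.src f i (inflow k i, t)| ≤ _ := abs_apply_le_norm _ i
    have h4 := abs_sub (s.src f i (inflow k i, t))
      (bdryD h t (outVec k s.u t) (1, outVec k s.p t) i)
    linarith
  · rw [hs.time i q]
    have h1 : |s.src f i q| ≤ ε := (abs_apply_le_norm _ i).trans (hf0 q hq _ (hR q hq)).1
    have h2 := mul_le_mul_of_nonneg_right (B.speed_le i q hq) (abs_nonneg (s'.z i q))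
    rw [← abs_mul] at h2
    have h3 := abs_sub (s.src f i q) (lam i q * s'.z i q)
    linarith

/-- The derivatives of two iterates contract, up to an error `ε` that is small if the iterates
themselves are close to each other. -/
theorem Iterate.IsStep.wtBound_derivatives_sub {s₁ s₂ s₁' s₂' : Iterate n}
    (h₁ : s₁.IsStep k lam f φ h T χ s₁') (h₂ : s₂.IsStep k lam f φ h T χ s₂') {c ε η M : ℝ}
    (hc : 0 ≤ c) (hM : 0 ≤ M) (hη : 0 ≤ η) (hηε : η * (1 + M) ≤ ε) (hηℓ : η * (2 + M) ≤ B.ℓ * ε)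
    (hR₂ : ∀ p ∈ closedRect T, ‖vec s₂.u p‖ ≤ R)
    (hz₁ : ∀ p ∈ closedRect T, ‖vec s₁.z p‖ ≤ M) (hp₁ : ∀ t ∈ Icc 0 T, ‖outVec k s₁.p t‖ ≤ M)
    (hf : ∀ p ∈ closedRect T, ‖f p (vec s₁.u p) - f p (vec s₂.u p)‖ ≤ η)
    (hfx : ∀ p ∈ closedRect T, ‖srcX f p (vec s₁.u p) - srcX f p (vec s₂.u p)‖ ≤ η)
    (hfy : ∀ p ∈ closedRect T,
      ‖fderiv ℝ (f p) (vec s₁.u p) - fderiv ℝ (f p) (vec s₂.u p)‖ ≤ η)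
    (hb : ∀ t ∈ Icc 0 T, ‖bdryD h t (outVec k s₁.u t) - bdryD h t (outVec k s₂.u t)‖ ≤ η)
    (hz : WtBound k (B.rate K) B.μ T (fun i p => s₁.z i p - s₂.z i p) c)
    (hp : WtBound k (B.rate K) B.μ T (fun i p => s₁.p i p - s₂.p i p) ((B.Λ + 1) * c)) :
    WtBound k (B.rate K) B.μ T (fun i p => s₁'.z i p - s₂'.z i p) (c / 4 + ε * Real.exp B.μ) ∧
      WtBound k (B.rate K) B.μ T (fun i p => s₁'.p i p - s₂'.p i p)
        ((B.Λ + 1) * (c / 4 + ε * Real.exp B.μ)) := by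
  have hηM : 0 ≤ η * M := mul_nonneg hη hM
  have hε : 0 ≤ ε := by linarith
  have hsrc : ∀ i, ∀ q ∈ closedRect T, |s₁.src f i q - s₂.src f i q| ≤ η := fun i q hq =>
    (abs_apply_le_norm (f q (vec s₁.u q) - f q (vec s₂.u q)) i).trans (hf q hq)
  refine HypIBVP.wtBound_derivatives H B hT hχ hK hc hε
    (fun i => (h₁.transport i).continuousOn_deriv.sub (h₂.transport i).continuousOn_deriv)
    (fun i q hq => ((h₁.transport i).along_deriv q hq).sub ((h₂.transport i).along_deriv q hq))
    (fun i q hq => ?_) (fun i t ht => ?_)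
    (fun i x hx => by simpa [h₁.init_z i x hx, h₂.init_z i x hx] using hε) (fun i q hq => ?_) hz hp
  · have h1 : |s₁.srcDeriv f i q - s₂.srcDeriv f i q| ≤
        η + η * M + K * ‖vec (fun i p => s₁.z i p - s₂.z i p) q‖ := by
      refine (abs_apply_le_norm ((srcX f q (vec s₁.u q) + fderiv ℝ (f q) (vec s₁.u q) (vec s₁.z q))
        - (srcX f q (vec s₂.u q) + fderiv ℝ (f q) (vec s₂.u q) (vec s₂.z q))) i).trans ?_
      have e : (srcX f q (vec s₁.u q) + fderiv ℝ (f q) (vec s₁.u q) (vec s₁.z q))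
          - (srcX f q (vec s₂.u q) + fderiv ℝ (f q) (vec s₂.u q) (vec s₂.z q)) =
          (srcX f q (vec s₁.u q) - srcX f q (vec s₂.u q)) +
          (fderiv ℝ (f q) (vec s₁.u q) - fderiv ℝ (f q) (vec s₂.u q)) (vec s₁.z q) +
          fderiv ℝ (f q) (vec s₂.u q) (vec s₁.z q - vec s₂.z q) := by
        rw [sub_apply, map_sub]; abel
      rw [e]
      refine (norm_add₃_le).trans (add_le_add (add_le_add (hfx q hq) ?_) ?_)
      · exact (ContinuousLinearMap.le_opNorm _ _).trans
          (mul_le_mul (hfy q hq) (hz₁ q hq) (norm_nonneg _) hη)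
      · exact (ContinuousLinearMap.le_opNorm _ _).trans
          (mul_le_mul_of_nonneg_right (hKR q hq _ (hR₂ q hq)) (norm_nonneg _))
    have h2 := mul_le_mul_of_nonneg_right (B.speedDeriv_le i q hq)
      (abs_nonneg (s₁'.z i q - s₂'.z i q))
    rw [← abs_mul] at h2
    have h3 := abs_sub (s₁.srcDeriv f i q - s₂.srcDeriv f i q)
      (speedDeriv (lam i) q * (s₁'.z i q - s₂'.z i q))
    have e : s₁.srcDeriv f i q - speedDeriv (lam i) q * s₁'.z i q -
        (s₂.srcDeriv f i q - speedDeriv (lam i) q * s₂'.z i q) =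
        s₁.srcDeriv f i q - s₂.srcDeriv f i q -
          speedDeriv (lam i) q * (s₁'.z i q - s₂'.z i q) := by ring
    rw [e]
    linarith
  · have hm := mem_side (T := T) (inflow_mem k i) ht
    have e : lam i (inflow k i, t) * (s₁'.z i (inflow k i, t) - s₂'.z i (inflow k i, t)) =
        (s₁.src f i (inflow k i, t) - s₂.src f i (inflow k i, t)) -
        (bdryD h t (outVec k s₁.u t) (1, outVec k s₁.p t) -
          bdryD h t (outVec k s₂.u t) (1, outVec k s₂.p t)) i := by
      rw [mul_sub, h₁.bdry_z i t ht, h₂.bdry_z i t ht, PiLp.sub_apply]; ring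
    have e2 : bdryD h t (outVec k s₁.u t) (1, outVec k s₁.p t) -
          bdryD h t (outVec k s₂.u t) (1, outVec k s₂.p t) =
        (bdryD h t (outVec k s₁.u t) - bdryD h t (outVec k s₂.u t)) (1, outVec k s₁.p t) +
        bdryD h t (outVec k s₂.u t) (0, outVec k s₁.p t - outVec k s₂.p t) := by
      have : ((0 : ℝ), outVec k s₁.p t - outVec k s₂.p t) =
          (1, outVec k s₁.p t) - (1, outVec k s₂.p t) := by simp
      rw [this, map_sub, sub_apply]; abel
    have h1 : ‖bdryD h t (outVec k s₁.u t) (1, outVec k s₁.p t) -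
          bdryD h t (outVec k s₂.u t) (1, outVec k s₂.p t)‖ ≤
        η * (1 + M) + B.L * ‖outVec k (fun i p => s₁.p i p - s₂.p i p) t‖ := by
      rw [e2]
      refine (norm_add_le _ _).trans (add_le_add ?_ (B.norm_bdryD_le H.bdry ht _ _))
      refine (ContinuousLinearMap.le_opNorm _ _).trans (mul_le_mul (hb t ht) ?_ (norm_nonneg _) hη)
      rw [Prod.norm_def]
      refine max_le (by simpa using hM) ((hp₁ t ht).trans (by linarith))
    have h2 := abs_apply_le_norm (bdryD h t (outVec k s₁.u t) (1, outVec k s₁.p t) -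
          bdryD h t (outVec k s₂.u t) (1, outVec k s₂.p t)) i
    have h3 := hsrc i _ hm
    have h4 := abs_sub (s₁.src f i (inflow k i, t) - s₂.src f i (inflow k i, t))
      ((bdryD h t (outVec k s₁.u t) (1, outVec k s₁.p t) -
          bdryD h t (outVec k s₂.u t) (1, outVec k s₂.p t)) i)
    rw [e]
    linarith
  · have e : s₁'.p i q - s₂'.p i q =
        (s₁.src f i q - s₂.src f i q) - lam i q * (s₁'.z i q - s₂'.z i q) := by
      rw [h₁.time i q, h₂.time i q]; ring
    rw [e]
    have h1 := hsrc i q hq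
    have h2 := mul_le_mul_of_nonneg_right (B.speed_le i q hq)
      (abs_nonneg (s₁'.z i q - s₂'.z i q))
    rw [← abs_mul] at h2
    have h3 := abs_sub (s₁.src f i q - s₂.src f i q) (lam i q * (s₁'.z i q - s₂'.z i q))
    linarith

end estimates

/-! ### Convergence of the iteration -/

lemma exists_tendstoUniformlyOn {X : Type*} {S : Set X} {q : ℕ → X → ℝ}
    (hq : ∀ ε > 0, ∃ M, ∀ j ≥ M, ∀ l ≥ M, ∀ x ∈ S, |q j x - q l x| ≤ ε) :
    ∃ Q, TendstoUniformlyOn q Q atTop S := by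
  have hc : UniformCauchySeqOn q atTop S := by
    rw [Metric.uniformCauchySeqOn_iff]
    intro ε hε
    obtain ⟨M, hM⟩ := hq (ε / 2) (by positivity)
    exact ⟨M, fun j hj l hl x hx => (hM j hj l hl x hx).trans_lt (by linarith)⟩
  have hlim : ∀ x, ∃ Q, x ∈ S → Tendsto (fun m => q m x) atTop (𝓝 Q) := fun x => by
    by_cases hx : x ∈ S
    · obtain ⟨Q, hQ⟩ := cauchySeq_tendsto_of_complete (hc.cauchySeq hx)
      exact ⟨Q, fun _ => hQ⟩
    · exact ⟨0, fun h => absurd h hx⟩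
  choose Q hQ using hlim
  exact ⟨Q, hc.tendstoUniformlyOn_of_tendsto fun x hx => hQ x hx⟩

/-- Uniform continuity in the last variable on compact sets. -/
lemma exists_delta {X F : Type*} [PseudoMetricSpace X] [NormedAddCommGroup F] {A : Set X}
    (hA : IsCompact A) {G : X → E n → F} {S : Set X} (hAS : A ⊆ S)
    (hG : ContinuousOn (fun q : X × E n => G q.1 q.2) (S ×ˢ univ)) (R : ℝ) {η : ℝ} (hη : 0 < η) :
    ∃ δ > 0, ∀ p ∈ A, ∀ y₁ y₂ : E n, ‖y₁‖ ≤ R → ‖y₂‖ ≤ R → ‖y₁ - y₂‖ < δ →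
      ‖G p y₁ - G p y₂‖ ≤ η := by
  have hu := (hA.prod (isCompact_closedBall (0 : E n) R)).uniformContinuousOn_of_continuous
    (hG.mono (prod_mono hAS (subset_univ _)))
  obtain ⟨δ, hδ, h⟩ := Metric.uniformContinuousOn_iff.1 hu η hη
  refine ⟨δ, hδ, fun p hp y₁ y₂ h₁ h₂ h12 => ?_⟩
  have := h (p, y₁) ⟨hp, mem_closedBall_zero_iff.2 h₁⟩ (p, y₂) ⟨hp, mem_closedBall_zero_iff.2 h₂⟩
    (by rw [Prod.dist_eq, dist_self, dist_eq_norm]; exact max_lt hδ h12)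
  rw [dist_eq_norm] at this
  exact this.le

/-- A continuous function is bounded on compact sets. -/
lemma exists_bound_ball {X F : Type*} [PseudoMetricSpace X] [NormedAddCommGroup F] {A : Set X}
    (hA : IsCompact A) {G : X → E n → F} {S : Set X} (hAS : A ⊆ S)
    (hG : ContinuousOn (fun q : X × E n => G q.1 q.2) (S ×ˢ univ)) (R : ℝ) :
    ∃ C, 0 ≤ C ∧ ∀ p ∈ A, ∀ y : E n, ‖y‖ ≤ R → ‖G p y‖ ≤ C := by
  obtain ⟨C, hC⟩ := (hA.prod (isCompact_closedBall (0 : E n) R)).exists_bound_of_continuousOn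
    (hG.mono (prod_mono hAS (subset_univ _)))
  exact ⟨max C 0, le_max_right _ _, fun p hp y hy =>
    (hC (p, y) ⟨hp, mem_closedBall_zero_iff.2 hy⟩).trans (le_max_left _ _)⟩

/-- The initial approximation: the function `φ` plus a term that is linear in time and produces the
required time derivatives at the outflow corners. -/
noncomputable def Iterate.start (k : ℕ) (lam : Fin n → ℝ × ℝ → ℝ) (f : ℝ × ℝ → E n → E n)
    (φ : ℝ → E n) : Iterate n where
  u i q := φ q.1 i + q.2 * initialVelocity lam f φ (outflow k i) i
  z i q := initD φ i q.1
  p i _ := initialVelocity lam f φ (outflow k i) i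

lemma Admissible.isRegular_start (H : Admissible k lam f φ h) (T : ℝ) :
    (Iterate.start k lam f φ).IsRegular k lam f φ T := by
  have hφ : ∀ i, ContinuousOn (fun q : ℝ × ℝ => φ q.1 i) (closedRect T) := fun i =>
    continuousOn_apply (H.init.continuousOn.comp continuousOn_fst fun q hq => hq.1) i
  refine ⟨fun i => (hφ i).add (by fun_prop), fun i => ?_, fun i => continuousOn_const,
    fun i q hq => ?_, fun i q hq => ?_, fun i x hx => by simp [Iterate.start], fun i => rfl⟩
  · exact (continuousOn_initD H.init i).comp continuousOn_fst fun q hq => hq.1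
  · exact (hasDerivWithinAt_initD H.init i hq.1).add_const
      (q.2 * initialVelocity lam f φ (outflow k i) i)
  · have := (((hasDerivAt_id q.2).mul_const
      (initialVelocity lam f φ (outflow k i) i)).const_add
      (φ q.1 i)).hasDerivWithinAt (s := Icc 0 T)
    rw [one_mul] at this
    exact this

lemma WtBound.abs_le {γ μ c : ℝ} {w : Fin n → ℝ × ℝ → ℝ} (hγ : 0 ≤ γ) (hμ : 0 ≤ μ) (hc : 0 ≤ c)
    (hw : WtBound k γ μ T w c) (i : Fin n) {p : ℝ × ℝ} (hp : p ∈ closedRect T) :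
    |w i p| ≤ c * Real.exp (γ * T) :=
  (hw i p hp).trans (mul_le_mul_of_nonneg_left ((wt_le_exp hμ hp).trans
    (Real.exp_le_exp.2 (mul_le_mul_of_nonneg_left hp.2.2 hγ))) hc)

lemma wtBound_of_abs_le {γ μ c C : ℝ} {w : Fin n → ℝ × ℝ → ℝ} (hγ : 0 ≤ γ) (hμ : 0 ≤ μ)
    (hC : 0 ≤ C) (hc : C * Real.exp μ ≤ c) (hw : ∀ i, ∀ p ∈ closedRect T, |w i p| ≤ C) :
    WtBound k γ μ T w c := fun i p hp => by
  have h1 := le_mul_of_one_le_right hC (one_le_wt (k := k) (i := i) hγ hμ hp)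
  have h2 := mul_le_mul_of_nonneg_right hc (wt_pos γ μ (inflow k i) p).le
  linarith [hw i p hp]

lemma WtBound.mono {γ μ c c' : ℝ} {w : Fin n → ℝ × ℝ → ℝ} (hw : WtBound k γ μ T w c)
    (hc : c ≤ c') : WtBound k γ μ T w c' := fun i p hp =>
  (hw i p hp).trans (mul_le_mul_of_nonneg_right hc (wt_pos _ _ _ _).le)

lemma WtBound.sub {γ μ c : ℝ} {w₁ w₂ : Fin n → ℝ × ℝ → ℝ} (h₁ : WtBound k γ μ T w₁ c)
    (h₂ : WtBound k γ μ T w₂ c) : WtBound k γ μ T (fun i p => w₁ i p - w₂ i p) (2 * c) :=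
  fun i p hp => by
    have := abs_sub (w₁ i p) (w₂ i p)
    linarith [h₁ i p hp, h₂ i p hp]

/-- Iterates that converge uniformly with their derivatives have a `C¹` limit, which solves the
problem. -/
theorem exists_limit (H : Admissible k lam f φ h) (hT : 0 < T) {χ : Fin n → ℝ × ℝ → ℝ → ℝ}
    {S : ℕ → Iterate n} (hS : ∀ m, (S m).IsRegular k lam f φ T)
    (hstep : ∀ m, (S m).IsStep k lam f φ h T χ (S (m + 1)))
    (hu : ∀ i, ∃ Q, TendstoUniformlyOn (fun m => (S m).u i) Q atTop (closedRect T))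
    (hz : ∀ i, ∃ Q, TendstoUniformlyOn (fun m => (S m).z i) Q atTop (closedRect T))
    (hp : ∀ i, ∃ Q, TendstoUniformlyOn (fun m => (S m).p i) Q atTop (closedRect T)) :
    ∃ s : Iterate n, s.IsRegular k lam f φ T ∧
      (∀ i, ∀ q ∈ closedRect T, s.p i q + lam i q * s.z i q = s.src f i q) ∧
      ∀ i, ∀ t ∈ Icc 0 T, s.u i (inflow k i, t) = h t (outVec k s.u t) i := by
  choose u hu using hu
  choose z hz using hz
  choose p hp using hp
  have h0T : (0 : ℝ) ∈ Icc 0 T := ⟨le_rfl, hT.le⟩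
  have hin := inflow_mem (n := n) k
  have hout := outflow_mem (n := n) k
  have toVec : ∀ (a : Fin n → ℕ → ℝ) (A : Fin n → ℝ), (∀ i, Tendsto (a i) atTop (𝓝 (A i))) →
      Tendsto (fun m => (WithLp.toLp 2 fun i => a i m : E n)) atTop (𝓝 (WithLp.toLp 2 A)) :=
    fun a A hA => ((PiLp.continuous_toLp 2 fun _ : Fin n => ℝ).tendsto A).comp
      (tendsto_pi_nhds.2 hA)
  have comp_tendsto : ∀ {y : ℕ → E n} {Y : E n} (i : Fin n), Tendsto y atTop (𝓝 Y) →
      Tendsto (fun m => y m i) atTop (𝓝 (Y i)) := fun i hy =>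
    ((EuclideanSpace.proj i : E n →L[ℝ] ℝ).continuous.tendsto _).comp hy
  refine ⟨⟨u, z, p⟩, ⟨fun i => ?_, fun i => ?_, fun i => ?_, fun i q hq => ?_, fun i q hq => ?_,
    fun i x hx => ?_, fun i => ?_⟩, fun i q hq => ?_, fun i t ht => ?_⟩
  · exact (hu i).continuousOn (.of_forall fun m => (hS m).cont_u i)
  · exact (hz i).continuousOn (.of_forall fun m => (hS m).cont_z i)
  · exact (hp i).continuousOn (.of_forall fun m => (hS m).cont_p i)
  · refine hasDerivWithinAt_Icc_of_tendstoUniformlyOn zero_lt_one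
      (q := fun m ξ => (S m).u i (ξ, q.2)) (q' := fun m ξ => (S m).z i (ξ, q.2))
      (Q' := fun ξ => z i (ξ, q.2))
      (fun m x hx => (hS m).deriv_fst i (x, q.2) ⟨hx, hq.2⟩)
      (fun x hx => (hu i).tendsto_at (x := (x, q.2)) ⟨hx, hq.2⟩) ?_ q.1 hq.1
    exact ((hz i).comp fun ξ => (ξ, q.2)).mono fun ξ hξ => ⟨hξ, hq.2⟩
  · refine hasDerivWithinAt_Icc_of_tendstoUniformlyOn hT
      (q := fun m r => (S m).u i (q.1, r)) (q' := fun m r => (S m).p i (q.1, r))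
      (Q' := fun r => p i (q.1, r))
      (fun m r hr => (hS m).deriv_snd i (q.1, r) ⟨hq.1, hr⟩)
      (fun r hr => (hu i).tendsto_at (x := (q.1, r)) ⟨hq.1, hr⟩) ?_ q.2 hq.2
    exact ((hp i).comp fun r => (q.1, r)).mono fun r hr => ⟨hq.1, hr⟩
  · refine tendsto_nhds_unique ((hu i).tendsto_at (mem_side hx h0T)) ?_
    simp only [(hS _).init i x hx]
    exact tendsto_const_nhds
  · refine tendsto_nhds_unique ((hp i).tendsto_at (mem_side (hout i) h0T)) ?_
    simp only [(hS _).corner i]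
    exact tendsto_const_nhds
  · have hf : Continuous (f q) :=
      (H.source.2.2.2.1 q (closedRect_subset T hq)).continuous
    have h1 : Tendsto (fun m => (S m).src f i q) atTop (𝓝 (f q (vec u q) i)) :=
      comp_tendsto i ((hf.tendsto _).comp
        (toVec (fun i m => (S m).u i q) _ fun j => (hu j).tendsto_at hq))
    have h2 := (((hp i).tendsto_at hq).add (((hz i).tendsto_at hq).const_mul (lam i q))).comp
      (tendsto_add_atTop_nat 1)
    refine tendsto_nhds_unique (h2.congr fun m => ?_) h1
    simp only [Function.comp, (hstep m).time i q]
    ring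
  · have hh : Continuous (h t) :=
      continuous_iff_continuousAt.2 fun y => (H.bdry.hasFDerivAt ht.1 y).continuousAt
    have h1 : Tendsto (fun m => h t (outVec k (S m).u t) i) atTop (𝓝 (h t (outVec k u t) i)) :=
      comp_tendsto i ((hh.tendsto _).comp
        (toVec (fun i m => (S m).u i (outflow k i, t)) _ fun j =>
          (hu j).tendsto_at (mem_side (hout j) ht)))
    have h2 := ((hu i).tendsto_at (mem_side (hin i) ht)).comp (tendsto_add_atTop_nat 1)
    refine tendsto_nhds_unique (h2.congr fun m => ?_) h1
    exact (hstep m).bdry i t ht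

/-- The iteration converges as soon as the radius `R` is compatible with the growth that the weight
of rate `B.rate K` allows, where `K` bounds the `y`-derivative of the source in the ball of
radius `R`. -/
theorem exists_solution_of_radius (H : Admissible k lam f φ h) (hT : 0 < T)
    (B : RectBounds k lam h T) : ∃ N, 0 ≤ N ∧ ∀ K R : ℝ, 0 ≤ K →
      (∀ p ∈ closedRect T, ∀ y : E n, ‖y‖ ≤ R → ‖fderiv ℝ (f p) y‖ ≤ K) →
      n * (N * Real.exp (B.rate K * T)) ≤ R →
      ∃ s : Iterate n, s.IsRegular k lam f φ T ∧
        (∀ i, ∀ q ∈ closedRect T, s.p i q + lam i q * s.z i q = s.src f i q) ∧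
        ∀ i, ∀ t ∈ Icc 0 T, s.u i (inflow k i, t) = h t (outVec k s.u t) i := by
  have hsub := closedRect_subset T
  have hμ := B.μ_nonneg
  have hΛ := B.Λ_nonneg
  have hreg0 := H.isRegular_start T
  obtain ⟨χ, hχ⟩ := H.exists_isCharFamily hT
  have hχ' : ∀ i, IsChar T (lam i) (χ i) := fun i => (hχ i).1
  -- the sequence of iterates
  have next := fun s : {s : Iterate n // s.IsRegular k lam f φ T} => s.2.exists_step H hT hχ
  choose F hFreg hFstep using next
  let S' : ℕ → {s : Iterate n // s.IsRegular k lam f φ T} := fun m =>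
    Nat.rec ⟨Iterate.start k lam f φ, hreg0⟩ (fun _ s => ⟨F s, hFreg s⟩) m
  let S : ℕ → Iterate n := fun m => (S' m).1
  have hS : ∀ m, (S m).IsRegular k lam f φ T := fun m => (S' m).2
  have hstep : ∀ m, (S m).IsStep k lam f φ h T χ (S (m + 1)) := fun m => hFstep (S' m)
  have hS0 : S 0 = Iterate.start k lam f φ := rfl
  clear_value S
  -- bounds of the data
  obtain ⟨F0, hF00, hF0⟩ := exists_bound_ball (isCompact_closedRect T) hsub H.source.1 0
  obtain ⟨H0, hH00, hH0⟩ := exists_bound_ball isCompact_Icc (A := Icc 0 T)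
    Icc_subset_Ici_self H.bdry.continuousOn 0
  obtain ⟨C0, hC00, hC0⟩ := exists_common_bound fun i => exists_bound_closedRect (hreg0.cont_u i)
  set ε₀ : ℝ := F0 + H0 + C0 with hε₀
  have hε₀0 : 0 ≤ ε₀ := by positivity
  refine ⟨2 * (ε₀ * Real.exp B.μ), by positivity, fun K R hK hKR hNR => ?_⟩
  set N : ℝ := 2 * (ε₀ * Real.exp B.μ) with hN
  have hN0 : 0 ≤ N := by positivity
  have hγ := B.rate_nonneg hK
  have hR0 : 0 ≤ R := le_trans (by positivity) hNR
  have inR : ∀ {w : Fin n → ℝ × ℝ → ℝ}, WtBound k (B.rate K) B.μ T w N →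
      (∀ p ∈ closedRect T, ‖vec w p‖ ≤ R) ∧ ∀ t ∈ Icc 0 T, ‖outVec k w t‖ ≤ R := fun hw =>
    ⟨fun p hp => (norm_toLp_le fun i => hw.abs_le hγ hμ hN0 i hp).trans hNR,
      fun t ht => (norm_toLp_le fun i => hw.abs_le hγ hμ hN0 i
        (mem_side (outflow_mem k i) ht)).trans hNR⟩
  -- all iterates obey the same bound
  have hφ0 : ∀ i, ∀ x ∈ Icc (0 : ℝ) 1, |φ x i| ≤ ε₀ := fun i x hx => by
    have := hC0 i (x, 0) (mem_side hx ⟨le_rfl, hT.le⟩)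
    rw [hreg0.init i x hx] at this
    linarith
  have hbound : ∀ m, WtBound k (B.rate K) B.μ T (S m).u N := by
    intro m
    induction m with
    | zero =>
      rw [hS0]
      refine wtBound_of_abs_le hγ hμ hC00 ?_ hC0
      have := mul_le_mul_of_nonneg_right (show C0 ≤ ε₀ by linarith) (Real.exp_pos B.μ).le
      have : 0 ≤ ε₀ * Real.exp B.μ := by positivity
      linarith
    | succ m ih =>
      refine ((hstep m).solves.wtBound H B hT.le hχ' hK hKR hN0 hε₀0 (inR ih).1 hR0
        (fun p hp => (hF0 p hp 0 (by simp)).trans (by linarith))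
        (fun t ht => (hH0 t ht 0 (by simp)).trans (by linarith)) hφ0 ih).mono ?_
      linarith
  have hcauchy : ∀ m, ∀ j ≥ m, ∀ l ≥ m, WtBound k (B.rate K) B.μ T
      (fun i p => (S j).u i p - (S l).u i p) (2 * N * (1 / 4) ^ m) := by
    intro m
    induction m with
    | zero =>
      intro j _ l _
      simpa using (hbound j).sub (hbound l)
    | succ m ih =>
      intro j hj l hl
      obtain ⟨j, rfl⟩ : ∃ j', j = j' + 1 := ⟨j - 1, by omega⟩
      obtain ⟨l, rfl⟩ : ∃ l', l = l' + 1 := ⟨l - 1, by omega⟩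
      refine ((hstep j).solves.wtBound_sub H B hT.le hχ' hK hKR (hstep l).solves (by positivity)
        (inR (hbound j)).1 (inR (hbound l)).1 (ih j (by omega) l (by omega))).mono ?_
      rw [pow_succ]
      linarith
  have small : ∀ (C r : ℝ), 0 ≤ r → r < 1 → ∀ ε > 0, ∃ m : ℕ, C * r ^ m ≤ ε := by
    intro C r hr0 hr1 ε hε
    have := (tendsto_pow_atTop_nhds_zero_of_lt_one hr0 hr1).const_mul C
    rw [mul_zero] at this
    exact ((this.eventually_lt_const hε).mono fun _ h => h.le).exists
  have hclose : ∀ ε > 0, ∃ M, ∀ j ≥ M, ∀ l ≥ M, ∀ i, ∀ p ∈ closedRect T,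
      |(S j).u i p - (S l).u i p| ≤ ε := by
    intro ε hε
    obtain ⟨m, hm⟩ := small (2 * N * Real.exp (B.rate K * T)) (1 / 4) (by norm_num) (by norm_num)
      ε hε
    refine ⟨m, fun j hj l hl i p hp => ((hcauchy m j hj l hl).abs_le hγ hμ (by positivity) i
      hp).trans ?_⟩
    linarith
  -- bounds of the derivatives
  obtain ⟨F1, hF10, hF1⟩ := exists_bound_ball (isCompact_closedRect T) hsub H.source.1 R
  obtain ⟨F2, hF20, hF2⟩ := exists_bound_ball (isCompact_closedRect T) hsub
    (G := srcX f) H.source.2.2.1 R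
  obtain ⟨H1, hH10, hH1⟩ := exists_bound_ball isCompact_Icc (A := Icc 0 T)
    Icc_subset_Ici_self (H.bdry.continuousOn_bdryD.clm_apply
      (continuousOn_const (c := ((1 : ℝ), (0 : E n))))) (G := fun t y => bdryD h t y (1, 0)) R
  obtain ⟨C1, hC10, hC1⟩ := exists_common_bound fun i => exists_bound_closedRect (hreg0.cont_z i)
  obtain ⟨C2, hC20, hC2⟩ := exists_common_bound fun i => exists_bound_closedRect (hreg0.cont_p i)
  have hℓ := B.ℓ_pos
  set ε₁ : ℝ := F1 + F2 + (F1 + H1) / B.ℓ + C1 + C2 with hε₁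
  have hd0 : 0 ≤ (F1 + H1) / B.ℓ := by positivity
  have hε₁0 : 0 ≤ ε₁ := by positivity
  set c : ℝ := 2 * (ε₁ * Real.exp B.μ) with hc
  have hc0 : 0 ≤ c := by positivity
  have hdbound : ∀ m, WtBound k (B.rate K) B.μ T (S m).z c ∧
      WtBound k (B.rate K) B.μ T (S m).p ((B.Λ + 1) * c) := by
    intro m
    induction m with
    | zero =>
      rw [hS0]
      have h1 := mul_le_mul_of_nonneg_right (show C1 ≤ ε₁ by linarith) (Real.exp_pos B.μ).le
      have h2 := mul_le_mul_of_nonneg_right (show C2 ≤ ε₁ by linarith) (Real.exp_pos B.μ).le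
      have h3 : 0 ≤ ε₁ * Real.exp B.μ := by positivity
      have h4 : 0 ≤ B.Λ * c := by positivity
      exact ⟨wtBound_of_abs_le hγ hμ hC10 (by linarith) hC1,
        wtBound_of_abs_le hγ hμ hC20 (by linarith) hC2⟩
    | succ m ih =>
      refine (hstep m).wtBound_derivatives H B hT.le hχ' hK hKR (ε := ε₁) le_rfl hε₁0
        (inR (hbound m)).1 (inR (hbound m)).2
        (fun p hp y hy => ⟨(hF1 p hp y hy).trans (by linarith),
          (hF2 p hp y hy).trans (by linarith)⟩)
        (fun t ht y hy p hp y' hy' => ?_) (fun i x hx => ?_) ih.1 ih.2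
      · have h1 := hF1 p hp y' hy'
        have h2 := hH1 t ht y hy
        have h3 : B.ℓ * ((F1 + H1) / B.ℓ) ≤ B.ℓ * ε₁ :=
          mul_le_mul_of_nonneg_left (by linarith) hℓ.le
        rw [mul_div_cancel₀ _ hℓ.ne'] at h3
        linarith
      · have : |initD φ i x| ≤ C1 := hC1 i (x, 0) (mem_side hx ⟨le_rfl, hT.le⟩)
        linarith
  set M : ℝ := n * ((B.Λ + 1) * c * Real.exp (B.rate K * T)) with hM
  have hM0 : 0 ≤ M := by positivity
  have hcΛ : c ≤ (B.Λ + 1) * c := by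
    have : 0 ≤ B.Λ * c := by positivity
    linarith
  have hzM : ∀ m, ∀ p ∈ closedRect T, ‖vec (S m).z p‖ ≤ M := fun m p hp =>
    norm_toLp_le fun i => ((hdbound m).1.mono hcΛ).abs_le hγ hμ (by positivity) i hp
  have hpM : ∀ m, ∀ t ∈ Icc 0 T, ‖outVec k (S m).p t‖ ≤ M := fun m t ht =>
    norm_toLp_le fun i => (hdbound m).2.abs_le hγ hμ (by positivity) i
      (mem_side (outflow_mem k i) ht)
  -- the coefficients of the equations for the derivatives converge uniformly
  have hcoef : ∀ η > 0, ∃ M', ∀ j ≥ M', ∀ l ≥ M',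
      (∀ p ∈ closedRect T, ‖f p (vec (S j).u p) - f p (vec (S l).u p)‖ ≤ η) ∧
      (∀ p ∈ closedRect T, ‖srcX f p (vec (S j).u p) - srcX f p (vec (S l).u p)‖ ≤ η) ∧
      (∀ p ∈ closedRect T,
        ‖fderiv ℝ (f p) (vec (S j).u p) - fderiv ℝ (f p) (vec (S l).u p)‖ ≤ η) ∧
      ∀ t ∈ Icc 0 T,
        ‖bdryD h t (outVec k (S j).u t) - bdryD h t (outVec k (S l).u t)‖ ≤ η := by
    intro η hη
    obtain ⟨δ₁, hδ₁, h1⟩ := exists_delta (isCompact_closedRect T) hsub H.source.1 R hη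
    obtain ⟨δ₂, hδ₂, h2⟩ := exists_delta (isCompact_closedRect T) hsub (G := srcX f)
      H.source.2.2.1 R hη
    obtain ⟨δ₃, hδ₃, h3⟩ := exists_delta (isCompact_closedRect T) hsub
      (G := fun p y => fderiv ℝ (f p) y) H.source.2.2.2.2 R hη
    obtain ⟨δ₄, hδ₄, h4⟩ := exists_delta isCompact_Icc (A := Icc 0 T) Icc_subset_Ici_self
      H.bdry.continuousOn_bdryD R hη
    set δ := min (min δ₁ δ₂) (min δ₃ δ₄) with hδ
    have hδ0 : 0 < δ := by positivity
    have le1 : δ ≤ δ₁ := (min_le_left _ _).trans (min_le_left _ _)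
    have le2 : δ ≤ δ₂ := (min_le_left _ _).trans (min_le_right _ _)
    have le3 : δ ≤ δ₃ := (min_le_right _ _).trans (min_le_left _ _)
    have le4 : δ ≤ δ₄ := (min_le_right _ _).trans (min_le_right _ _)
    obtain ⟨M', hM'⟩ := hclose (δ / (n + 1)) (by positivity)
    refine ⟨M', fun j hj l hl => ?_⟩
    have hlt : n * (δ / (n + 1)) < δ := by
      have : (0 : ℝ) < n + 1 := by positivity
      rw [mul_div_assoc', div_lt_iff₀ this]
      linarith
    have hv : ∀ p ∈ closedRect T, ‖vec (S j).u p - vec (S l).u p‖ < δ := fun p hp =>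
      lt_of_le_of_lt (norm_toLp_le fun i => hM' j hj l hl i p hp) hlt
    have hv' : ∀ t ∈ Icc 0 T, ‖outVec k (S j).u t - outVec k (S l).u t‖ < δ := fun t ht =>
      lt_of_le_of_lt (norm_toLp_le fun i => hM' j hj l hl i _
        (mem_side (outflow_mem k i) ht)) hlt
    have bj := inR (hbound j)
    have bl := inR (hbound l)
    exact ⟨fun p hp => h1 p hp _ _ (bj.1 p hp) (bl.1 p hp) ((hv p hp).trans_le le1),
      fun p hp => h2 p hp _ _ (bj.1 p hp) (bl.1 p hp) ((hv p hp).trans_le le2),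
      fun p hp => h3 p hp _ _ (bj.1 p hp) (bl.1 p hp) ((hv p hp).trans_le le3),
      fun t ht => h4 t ht _ _ (bj.2 t ht) (bl.2 t ht) ((hv' t ht).trans_le le4)⟩
  have hdcauchy : ∀ m : ℕ, ∃ M', ∀ j ≥ M', ∀ l ≥ M',
      WtBound k (B.rate K) B.μ T (fun i p => (S j).z i p - (S l).z i p)
        (2 * (c + 1) * (1 / 2) ^ m) ∧
      WtBound k (B.rate K) B.μ T (fun i p => (S j).p i p - (S l).p i p)
        ((B.Λ + 1) * (2 * (c + 1) * (1 / 2) ^ m)) := by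
    intro m
    induction m with
    | zero =>
      refine ⟨0, fun j _ l _ => ⟨((hdbound j).1.sub (hdbound l).1).mono (by simp),
        ((hdbound j).2.sub (hdbound l).2).mono ?_⟩⟩
      simp only [pow_zero, mul_one]
      linarith
    | succ m ih =>
      obtain ⟨M₁, hM₁⟩ := ih
      set D : ℝ := 2 * (c + 1) * (1 / 2) ^ m with hD
      have hD0 : 0 < D := by positivity
      set ε : ℝ := D / 4 * Real.exp (-B.μ) with hε
      have hε0 : 0 < ε := by positivity
      have hεe : ε * Real.exp B.μ = D / 4 := by
        rw [hε, mul_assoc, ← Real.exp_add]; simp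
      set η : ℝ := min (ε / (1 + M)) (B.ℓ * ε / (2 + M)) with hη
      have hη0 : 0 < η := by positivity
      obtain ⟨M₂, hM₂⟩ := hcoef η hη0
      refine ⟨max M₁ M₂ + 1, fun j hj l hl => ?_⟩
      obtain ⟨j, rfl⟩ : ∃ j', j = j' + 1 := ⟨j - 1, by omega⟩
      obtain ⟨l, rfl⟩ : ∃ l', l = l' + 1 := ⟨l - 1, by omega⟩
      have hj1 : max M₁ M₂ ≤ j := by omega
      have hl1 : max M₁ M₂ ≤ l := by omega
      obtain ⟨e1, e2⟩ := hM₁ j ((le_max_left _ _).trans hj1) l ((le_max_left _ _).trans hl1)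
      obtain ⟨c1, c2, c3, c4⟩ :=
        hM₂ j ((le_max_right _ _).trans hj1) l ((le_max_right _ _).trans hl1)
      have key := (hstep j).wtBound_derivatives_sub H B hT.le hχ' hK hKR (hstep l) hD0.le hM0
        hη0.le ((le_div_iff₀ (by positivity)).1 (min_le_left _ _))
        ((le_div_iff₀ (by positivity)).1 (min_le_right _ _)) (inR (hbound l)).1 (hzM j) (hpM j)
        c1 c2 c3 c4 e1 e2
      have e : D / 4 + ε * Real.exp B.μ = 2 * (c + 1) * (1 / 2) ^ (m + 1) := by
        rw [hεe, pow_succ, hD]; ring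
      rwa [e] at key
  have hdclose : ∀ ε > 0, ∃ M', ∀ j ≥ M', ∀ l ≥ M', ∀ i, ∀ p ∈ closedRect T,
      |(S j).z i p - (S l).z i p| ≤ ε ∧ |(S j).p i p - (S l).p i p| ≤ ε := by
    intro ε hε
    obtain ⟨m, hm⟩ := small ((B.Λ + 1) * (2 * (c + 1)) * Real.exp (B.rate K * T)) (1 / 2)
      (by norm_num) (by norm_num) ε hε
    obtain ⟨M', hM'⟩ := hdcauchy m
    refine ⟨M', fun j hj l hl i p hp => ?_⟩
    obtain ⟨e1, e2⟩ := hM' j hj l hl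
    have e1' := e1.mono (c' := (B.Λ + 1) * (2 * (c + 1) * (1 / 2) ^ m)) (by
      have : 0 ≤ B.Λ * (2 * (c + 1) * (1 / 2) ^ m) := by positivity
      linarith)
    exact ⟨(e1'.abs_le hγ hμ (by positivity) i hp).trans (by linarith),
      (e2.abs_le hγ hμ (by positivity) i hp).trans (by linarith)⟩
  refine exists_limit H hT hS hstep (fun i => exists_tendstoUniformlyOn fun ε hε => ?_)
    (fun i => exists_tendstoUniformlyOn fun ε hε => ?_)
    (fun i => exists_tendstoUniformlyOn fun ε hε => ?_)
  · obtain ⟨M', hM'⟩ := hclose ε hε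
    exact ⟨M', fun j hj l hl p hp => hM' j hj l hl i p hp⟩
  · obtain ⟨M', hM'⟩ := hdclose ε hε
    exact ⟨M', fun j hj l hl p hp => (hM' j hj l hl i p hp).1⟩
  · obtain ⟨M', hM'⟩ := hdclose ε hε
    exact ⟨M', fun j hj l hl p hp => (hM' j hj l hl i p hp).2⟩

/-! ### The choice of the radius -/

/-- A power of a logarithm is eventually smaller than the identity. -/
lemma exists_mul_add_log_rpow_le {b d s C : ℝ} (hb : 0 ≤ b) (hd : 0 ≤ d) (hs : 0 ≤ s) :
    ∃ R ≥ 1, C * (b + d * Real.log R) ^ s ≤ R := by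
  -- With `log R ≤ R ^ e / e` and `e s ≤ 1 / 2` the left-hand side is at most a multiple of `√R`.
  set e : ℝ := 1 / (2 * (s + 1)) with he
  have he0 : 0 < e := by positivity
  have hes : e * s ≤ 1 / 2 := by
    rw [he, div_mul_eq_mul_div, div_le_div_iff₀ (by positivity) (by norm_num)]
    linarith
  set M : ℝ := |C| * (b + d / e) ^ s with hM
  have hM0 : 0 ≤ M := by positivity
  have hR1 : (1 : ℝ) ≤ M ^ 2 + 1 := by nlinarith
  refine ⟨M ^ 2 + 1, hR1, ?_⟩
  set R := M ^ 2 + 1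
  have hR0 : (0 : ℝ) < R := by linarith
  have hlog := Real.log_le_rpow_div hR0.le he0
  have hlog0 := Real.log_nonneg hR1
  have hRe : 1 ≤ R ^ e := Real.one_le_rpow hR1 he0.le
  have h1 : b + d * Real.log R ≤ (b + d / e) * R ^ e := by
    have h2 := mul_le_mul_of_nonneg_left hlog hd
    have h3 := le_mul_of_one_le_right hb hRe
    have h4 : d * (R ^ e / e) = d / e * R ^ e := by ring
    linarith
  have h2 : (b + d * Real.log R) ^ s ≤ (b + d / e) ^ s * R ^ (e * s) := by
    rw [Real.rpow_mul hR0.le, ← Real.mul_rpow (by positivity) (by positivity)]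
    exact Real.rpow_le_rpow (by positivity) h1 hs
  have h3 : R ^ (e * s) ≤ Real.sqrt R := by
    rw [Real.sqrt_eq_rpow]
    exact Real.rpow_le_rpow_of_exponent_le hR1 hes
  have h4 : M ≤ Real.sqrt R := Real.le_sqrt_of_sq_le (by simp [R])
  calc C * (b + d * Real.log R) ^ s ≤ |C| * (b + d * Real.log R) ^ s :=
        mul_le_mul_of_nonneg_right (le_abs_self C) (by positivity)
    _ ≤ |C| * ((b + d / e) ^ s * Real.sqrt R) := by gcongr; exact h2.trans (by gcongr)
    _ = M * Real.sqrt R := by rw [hM]; ring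
    _ ≤ Real.sqrt R * Real.sqrt R := by gcongr
    _ = R := Real.mul_self_sqrt hR0.le

/-- The growth condition enters here: the exponential of `q K`, where `K` bounds the `y`-derivative
of the source in the ball of radius `R`, is at most a power of `log R`. Therefore there is a radius
that exceeds the a priori bound which holds as long as the solution stays in that ball. -/
theorem SourceGradGrowth.exists_radius (hg : SourceGradGrowth f) (hT : 0 < T) (A C : ℝ) {q : ℝ}
    (hq : 0 ≤ q) : ∃ K R : ℝ, 0 ≤ K ∧
      (∀ p ∈ closedRect T, ∀ y : E n, ‖y‖ ≤ R → ‖fderiv ℝ (f p) y‖ ≤ K) ∧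
      C * Real.exp (A + q * K) ≤ R := by
  obtain ⟨Cf, hCf, d, c, hc, hF⟩ := hg T hT
  have hb : ∀ j, ∃ a, 0 ≤ a ∧ ∀ p ∈ closedRect T, |c j p| ≤ a := fun j =>
    exists_bound_closedRect (hc j).continuousOn
  choose a ha0 ha using hb
  -- The summand `3` makes the iterated logarithm of `s * R ^ d` nonnegative.
  set s : ℝ := ∑ j ∈ Finset.range (d + 1), a j + 3 with hs
  have hs3 : 3 ≤ s := le_add_of_nonneg_left (Finset.sum_nonneg fun j _ => ha0 j)
  have hlogs : 1 ≤ Real.log s := by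
    rw [Real.le_log_iff_exp_le (by linarith)]
    linarith [Real.exp_one_lt_d9]
  obtain ⟨R, hR1, hR⟩ := exists_mul_add_log_rpow_le (C := C * Real.exp A)
    (zero_le_one.trans hlogs) (Nat.cast_nonneg d) (mul_nonneg hq hCf.le)
  have hlogR := Real.log_nonneg hR1
  have hR0 : (0 : ℝ) < R := by linarith
  set G : ℝ := Real.log s + d * Real.log R with hG
  have hG1 : 1 ≤ G := by
    have := mul_nonneg (Nat.cast_nonneg (α := ℝ) d) hlogR
    linarith
  have hGeq : Real.log (s * R ^ d) = G := by
    rw [Real.log_mul (by linarith) (by positivity), Real.log_pow]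
  refine ⟨Cf * Real.log G, R, mul_nonneg hCf.le (Real.log_nonneg hG1), fun p hp y hy => ?_, ?_⟩
  · obtain ⟨h1, h2⟩ := hF p hp y
    refine h2.trans (mul_le_mul_of_nonneg_left ?_ hCf.le)
    refine Real.log_le_log (Real.log_pos h1) ?_
    rw [← hGeq]
    refine Real.log_le_log (by linarith) ?_
    calc ∑ j ∈ Finset.range (d + 1), c j p * ‖y‖ ^ j
        ≤ ∑ j ∈ Finset.range (d + 1), a j * R ^ d := by
          refine Finset.sum_le_sum fun j hj => ?_
          refine mul_le_mul ((le_abs_self _).trans (ha j p hp)) ?_ (by positivity) (ha0 j)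
          exact (pow_le_pow_left₀ (norm_nonneg _) hy j).trans
            (pow_le_pow_right₀ hR1 (by simpa [Nat.lt_succ_iff] using hj))
      _ ≤ s * R ^ d := by
          rw [← Finset.sum_mul]
          exact mul_le_mul_of_nonneg_right (by linarith) (by positivity)
  · rw [Real.exp_add, ← mul_assoc]
    have : Real.exp (q * (Cf * Real.log G)) = G ^ (q * Cf) := by
      rw [Real.rpow_def_of_pos (by linarith)]
      congr 1
      ring
    rwa [this]

/-- The problem has a `C¹` solution up to any time `T`. -/
theorem Admissible.exists_iterate (H : Admissible k lam f φ h) (hT : 0 < T) :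
    ∃ s : Iterate n, s.IsRegular k lam f φ T ∧
      (∀ i, ∀ q ∈ closedRect T, s.p i q + lam i q * s.z i q = s.src f i q) ∧
      ∀ i, ∀ t ∈ Icc 0 T, s.u i (inflow k i, t) = h t (outVec k s.u t) i := by
  obtain ⟨B⟩ := H.nonempty_rectBounds T
  obtain ⟨N, -, hN⟩ := exists_solution_of_radius H hT B
  obtain ⟨K, R, hK, hKR, hR⟩ := H.growth.exists_radius hT ((B.μ * B.Λ + B.Λ₁ + 1) * T) (n * N)
    (q := 4 * n * Real.exp B.μ * T) (by positivity)
  refine hN K R hK hKR (le_trans (le_of_eq ?_) hR)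
  rw [mul_assoc, RectBounds.rate]
  ring_nf

/-! ### Solutions up to a finite time and their uniqueness -/

/-- A solution up to time `T` that is continuous in the closed rectangle and differentiable in its
interior. The differential equations say that the derivative in the direction `(λ_i, 1)` is `f_i`.
-/
structure IsLocalSolution (k : ℕ) (lam : Fin n → ℝ × ℝ → ℝ) (f : ℝ × ℝ → E n → E n) (φ : ℝ → E n)
    (h : ℝ → E n → E n) (T : ℝ) (w : ℝ × ℝ → E n) : Prop where
  cont : ContinuousOn w (closedRect T)
  pde : ∀ q ∈ Ioo (0 : ℝ) 1 ×ˢ Ioo 0 T, ∀ i, ∃ A : ℝ × ℝ →L[ℝ] ℝ,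
    HasFDerivAt (fun q => w q i) A q ∧ A (lam i q, 1) = f q (w q) i
  init : ∀ x ∈ Icc (0 : ℝ) 1, w (x, 0) = φ x
  bdry : ∀ t ∈ Icc 0 T, ∀ i, w (inflow k i, t) i = h t (outTrace k fun x => w (x, t)) i

lemma IsLocalSolution.mono {w : ℝ × ℝ → E n} {T' : ℝ} (hw : IsLocalSolution k lam f φ h T' w)
    (hTT : T ≤ T') : IsLocalSolution k lam f φ h T w where
  cont := hw.cont.mono (prod_mono subset_rfl (Icc_subset_Icc_right hTT))
  pde q hq := hw.pde q ⟨hq.1, hq.2.1, hq.2.2.trans_le hTT⟩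
  init := hw.init
  bdry t ht := hw.bdry t ⟨ht.1, ht.2.trans hTT⟩

/-- A solution can be differentiated along characteristics from the left up to the end of the time
interval and up to the outflow side, because the derivative extends continuously. -/
lemma IsLocalSolution.solves (H : Admissible k lam f φ h) {χ : Fin n → ℝ × ℝ → ℝ → ℝ}
    (hχ : ∀ i, IsChar T (lam i) (χ i)) {w : ℝ × ℝ → E n} (hw : IsLocalSolution k lam f φ h T w) :
    Solves k f φ h T χ (fun i q => w q i) (fun i q => w q i) where
  cont i := continuousOn_apply hw.cont i
  init i x hx := by rw [hw.init x hx]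
  bdry i t ht := hw.bdry t ht i
  along := by
    intro i p hp hpa hp0
    have hev := (hχ i).eventually_mem (inflow_eq k i)
      (fun q hq => H.sign i (closedRect_subset T hq)) hp hpa hp0
    have hd := (hχ i).hasDerivAt_self hp
    have hself := (hχ i).self p
    have hdw : ∀ s, (χ i p s, s) ∈ Ioo (0 : ℝ) 1 ×ˢ Ioo 0 T →
        HasDerivAt (fun s => w (χ i p s, s) i) (f (χ i p s, s) (w (χ i p s, s)) i) s := by
      intro s hs
      obtain ⟨A, hA, hAf⟩ := hw.pde _ hs i
      have hcurve := ((hχ i).hasDerivAt p s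
        ⟨Ioo_subset_Icc_self hs.1, Ioo_subset_Icc_self hs.2⟩).prodMk (hasDerivAt_id s)
      rw [← hAf]
      exact hA.comp_hasDerivAt_of_eq (f := fun s => (χ i p s, s)) s hcurve rfl
    have hlim : Tendsto (fun s => (χ i p s, s)) (𝓝[<] p.2) (𝓝[closedRect T] p) := by
      refine tendsto_nhdsWithin_iff.2 ⟨?_, hev.mono fun s hs =>
        ⟨Ioo_subset_Icc_self hs.1, Ioo_subset_Icc_self hs.2⟩⟩
      have : ContinuousAt (fun s => (χ i p s, s)) p.2 := hd.continuousAt.prodMk continuousAt_id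
      have h2 := this.tendsto
      rw [hself] at h2
      exact h2.mono_left nhdsWithin_le_nhds
    have hsub : {s | (χ i p s, s) ∈ Ioo (0 : ℝ) 1 ×ˢ Ioo 0 T ∧ s < p.2} ∈ 𝓝[<] p.2 :=
      hev.and self_mem_nhdsWithin
    refine hasDerivWithinAt_Iic_of_tendsto_deriv (fun s hs =>
      (hdw s hs.1).differentiableAt.differentiableWithinAt) ?_ hsub ?_
    · have hc := (continuousOn_apply hw.cont i p hp).tendsto.comp hlim
      have : w (χ i p p.2, p.2) i = w p i := by rw [hself]
      change Tendsto _ _ (𝓝 (w (χ i p p.2, p.2) i))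
      rw [this]
      exact hc.mono_left (nhdsWithin_mono _ fun s hs => hs.2)
    · have hcf : ContinuousOn (fun q => f q (w q) i) (closedRect T) :=
        continuousOn_apply (H.source.1.comp (continuousOn_id.prodMk hw.cont)
          fun q hq => ⟨closedRect_subset T hq, trivial⟩) i
      exact ((hcf p hp).tendsto.comp hlim).congr' (hev.mono fun s hs => (hdw s hs).deriv.symm)

/-- Two solutions stay in a common ball, where the source is Lipschitz continuous, so the
contraction estimate shows that their difference vanishes. -/
theorem IsLocalSolution.eqOn (H : Admissible k lam f φ h) (hT : 0 < T) {w₁ w₂ : ℝ × ℝ → E n}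
    (h₁ : IsLocalSolution k lam f φ h T w₁) (h₂ : IsLocalSolution k lam f φ h T w₂) :
    EqOn w₁ w₂ (closedRect T) := by
  obtain ⟨B⟩ := H.nonempty_rectBounds T
  obtain ⟨χ, hχ⟩ := H.exists_isCharFamily hT
  have hχ' : ∀ i, IsChar T (lam i) (χ i) := fun i => (hχ i).1
  obtain ⟨R₁, hR₁⟩ := (isCompact_closedRect T).exists_bound_of_continuousOn h₁.cont
  obtain ⟨R₂, hR₂⟩ := (isCompact_closedRect T).exists_bound_of_continuousOn h₂.cont
  obtain ⟨K, hK, hKR⟩ := exists_bound_ball (isCompact_closedRect T) (closedRect_subset T)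
    (G := fun p y => fderiv ℝ (f p) y) H.source.2.2.2.2 (max R₁ R₂)
  have hγ := B.rate_nonneg hK
  have hμ := B.μ_nonneg
  obtain ⟨C, hC0, hC⟩ := exists_common_bound fun i =>
    exists_bound_closedRect ((continuousOn_apply h₁.cont i).sub (continuousOn_apply h₂.cont i))
  have key : ∀ m : ℕ, WtBound k (B.rate K) B.μ T (fun i q => w₁ q i - w₂ q i)
      (C * Real.exp B.μ * (1 / 4) ^ m) := by
    intro m
    induction m with
    | zero => exact wtBound_of_abs_le hγ hμ hC0 (by simp) hC
    | succ m ih =>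
      refine ((h₁.solves H hχ').wtBound_sub H B hT.le hχ' hK hKR (h₂.solves H hχ')
        (by positivity) (fun p hp => (hR₁ p hp).trans (le_max_left _ _))
        (fun p hp => (hR₂ p hp).trans (le_max_right _ _)) ih).mono ?_
      rw [pow_succ]
      linarith
  intro q hq
  ext i
  have hlim := ((tendsto_pow_atTop_nhds_zero_of_lt_one (r := (1 / 4 : ℝ)) (by norm_num)
    (by norm_num)).const_mul (C * Real.exp B.μ)).mul_const (wt (B.rate K) B.μ (inflow k i) q)
  rw [mul_zero, zero_mul] at hlim
  have h0 : |w₁ q i - w₂ q i| ≤ 0 := ge_of_tendsto' hlim fun m => key m i q hq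
  exact sub_eq_zero.1 (abs_nonpos_iff.1 h0)

lemma IsClassicalSolution.isLocalSolution (H : Admissible k lam f φ h) {w : ℝ × ℝ → E n}
    (hw : IsClassicalSolution k lam f φ h w) (T : ℝ) : IsLocalSolution k lam f φ h T w := by
  have hinit : ∀ x ∈ Icc (0 : ℝ) 1, w (x, 0) = φ x := by
    have h1 : ContinuousOn (fun x => w (x, 0)) (Icc 0 1) :=
      hw.continuousOn.comp (by fun_prop) fun x hx => ⟨hx, self_mem_Ici⟩
    have h2 : EqOn (fun x => w (x, 0)) φ (Ioo 0 1) := hw.initial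
    exact h2.of_subset_closure h1 H.init.continuousOn Ioo_subset_Icc_self
      (by rw [closure_Ioo zero_ne_one])
  refine ⟨hw.continuousOn.mono (closedRect_subset T), fun q hq i => ?_, hinit, fun t ht i => ?_⟩
  · have hopen : IsOpen strip := isOpen_Ioo.prod isOpen_Ioi
    have hqs : q ∈ strip := ⟨hq.1, hq.2.1⟩
    have hd := (contDiffOn_euclidean.1 hw.contDiffOn i).differentiableOn one_ne_zero
    have hA := (hd.differentiableAt (hopen.mem_nhds hqs)).hasFDerivAt
    refine ⟨_, hA, ?_⟩
    have hx := hA.comp_hasDerivAt_of_eq (f := fun ξ => (ξ, q.2)) q.1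
      ((hasDerivAt_id q.1).prodMk (hasDerivAt_const q.1 q.2)) rfl
    have ht := hA.comp_hasDerivAt_of_eq (f := fun s => (q.1, s)) q.2
      ((hasDerivAt_const q.2 q.1).prodMk (hasDerivAt_id q.2)) rfl
    have heq := hw.equation q.1 hq.1 q.2 hq.2.1 i
    have hx' : deriv (fun ξ => w (ξ, q.2) i) q.1 = _ := hx.deriv
    have ht' : deriv (fun s => w (q.1, s) i) q.2 = _ := ht.deriv
    rw [hx', ht'] at heq
    change _ = f (q.1, q.2) (w (q.1, q.2)) i
    rw [← heq]
    have e : ((lam i q, 1) : ℝ × ℝ) = (0, 1) + lam i q • (1, 0) := by simp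
    rw [e, map_add, map_smul, smul_eq_mul]
  · rcases ht.1.eq_or_lt with h0 | h0
    · subst h0
      have : (outTrace k fun x => w (x, 0)) = outTrace k φ := by
        ext j
        have := congrArg (fun y : E n => y j) (hinit _ (outflow_mem k j))
        exact this
      rw [this, hinit _ (inflow_mem k i), H.compat₀ i]
    · exact hw.boundary t h0 i

/-! ### Solutions for all times -/

lemma Iterate.IsRegular.hasFDerivWithinAt {s : Iterate n} (hs : s.IsRegular k lam f φ T)
    (i : Fin n) {q : ℝ × ℝ} (hq : q ∈ closedRect T) :
    HasFDerivWithinAt (s.u i) ((ContinuousLinearMap.toSpanSingleton ℝ (s.z i q)).coprod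
      (ContinuousLinearMap.toSpanSingleton ℝ (s.p i q))) (closedRect T) q := by
  have hc : ContinuousOn (fun q => ContinuousLinearMap.toSpanSingleton ℝ (s.z i q))
      (closedRect T) :=
    (ContinuousLinearMap.toSpanSingletonCLE (𝕜 := ℝ) (E := ℝ)).continuous.comp_continuousOn
      (hs.cont_z i)
  exact hasFDerivWithinAt_of_partial (f := fun x t => s.u i (x, t))
    (f₁ := fun q => ContinuousLinearMap.toSpanSingleton ℝ (s.z i q)) (convex_Icc 0 1) hq
    (fun x hx t ht => (hs.deriv_fst i (x, t) ⟨hx, ht⟩).hasFDerivWithinAt) (hc q hq)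
    (hs.deriv_snd i q hq).hasFDerivWithinAt

lemma uniqueDiffOn_closedRect (hT : 0 < T) : UniqueDiffOn ℝ (closedRect T) :=
  (uniqueDiffOn_Icc zero_lt_one).prod (uniqueDiffOn_Icc hT)

lemma Iterate.IsRegular.contDiffOn {s : Iterate n} (hs : s.IsRegular k lam f φ T) (hT : 0 < T) :
    ContDiffOn ℝ 1 (vec s.u) (closedRect T) := by
  refine contDiffOn_euclidean.2 fun i => ?_
  have hcle := (ContinuousLinearMap.toSpanSingletonCLE (𝕜 := ℝ) (E := ℝ)).continuous
  have h1 := hcle.comp_continuousOn (hs.cont_z i)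
  have h2 := hcle.comp_continuousOn (hs.cont_p i)
  rw [show (1 : WithTop ℕ∞) = 0 + 1 from rfl,
    contDiffOn_succ_iff_hasFDerivWithinAt_of_uniqueDiffOn (uniqueDiffOn_closedRect hT)]
  refine ⟨by simp, _, contDiffOn_zero.2 ?_, fun q hq => hs.hasFDerivWithinAt i hq⟩
  have h3 : ContinuousOn (fun q =>
      (ContinuousLinearMap.toSpanSingleton ℝ (s.z i q)).comp (ContinuousLinearMap.fst ℝ ℝ ℝ) +
      (ContinuousLinearMap.toSpanSingleton ℝ (s.p i q)).comp (ContinuousLinearMap.snd ℝ ℝ ℝ))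
      (closedRect T) :=
    (h1.clm_comp continuousOn_const).add (h2.clm_comp continuousOn_const)
  refine h3.congr fun q hq => ?_
  ext <;> simp

lemma closedRect_mem_nhds {q : ℝ × ℝ} (hq : q ∈ Ioo (0 : ℝ) 1 ×ˢ Ioo 0 T) :
    closedRect T ∈ 𝓝 q :=
  prod_mem_nhds (Icc_mem_nhds hq.1.1 hq.1.2) (Icc_mem_nhds hq.2.1 hq.2.2)

lemma Iterate.IsRegular.isLocalSolution {s : Iterate n} (hs : s.IsRegular k lam f φ T)
    (heq : ∀ i, ∀ q ∈ closedRect T, s.p i q + lam i q * s.z i q = s.src f i q)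
    (hbd : ∀ i, ∀ t ∈ Icc 0 T, s.u i (inflow k i, t) = h t (outVec k s.u t) i) :
    IsLocalSolution k lam f φ h T (vec s.u) where
  cont := continuousOn_toLp hs.cont_u
  pde q hq i := by
    have hm : q ∈ closedRect T := ⟨Ioo_subset_Icc_self hq.1, Ioo_subset_Icc_self hq.2⟩
    refine ⟨_, (hs.hasFDerivWithinAt i hm).hasFDerivAt (closedRect_mem_nhds hq), ?_⟩
    have := heq i q hm
    simp only [ContinuousLinearMap.coprod_apply, ContinuousLinearMap.toSpanSingleton_apply,
      smul_eq_mul, one_mul]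
    rw [add_comm]
    exact this
  init x hx := by ext i; exact hs.init i x hx
  bdry t ht i := hbd i t ht

/-- The solutions up to finite times fit together, by uniqueness. -/
theorem Admissible.exists_unique_solution (H : Admissible k lam f φ h) :
    ∃ u : ℝ × ℝ → E n, IsClassicalSolution k lam f φ h u ∧ ContDiffOn ℝ 1 u closedStrip ∧
      ∀ w : ℝ × ℝ → E n, IsClassicalSolution k lam f φ h w → EqOn w u closedStrip := by
  have ex : ∀ T : ℝ, ∃ s : Iterate n, 0 < T → s.IsRegular k lam f φ T ∧
      (∀ i, ∀ q ∈ closedRect T, s.p i q + lam i q * s.z i q = s.src f i q) ∧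
      ∀ i, ∀ t ∈ Icc 0 T, s.u i (inflow k i, t) = h t (outVec k s.u t) i := fun T => by
    by_cases hT : 0 < T
    · obtain ⟨s, hs⟩ := H.exists_iterate hT
      exact ⟨s, fun _ => hs⟩
    · exact ⟨Iterate.start k lam f φ, fun h => absurd h hT⟩
  choose s hs using ex
  have hloc : ∀ T, 0 < T → IsLocalSolution k lam f φ h T (vec (s T).u) := fun T hT =>
    (hs T hT).1.isLocalSolution (hs T hT).2.1 (hs T hT).2.2
  -- The solution up to time `t + 1` is used at time `t`, so that `t` is an interior time.
  let u : ℝ × ℝ → E n := fun q => vec (s (q.2 + 1)).u q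
  have hu : ∀ T, 0 < T → EqOn u (vec (s T).u) (closedRect T) := by
    intro T hT q hq
    have h0 : 0 < q.2 + 1 := by linarith [hq.2.1]
    have hm : 0 < min (q.2 + 1) T := lt_min h0 hT
    exact ((hloc _ h0).mono (min_le_left _ _)).eqOn H hm ((hloc _ hT).mono (min_le_right _ _))
      ⟨hq.1, hq.2.1, le_min (by linarith) hq.2.2⟩
  have hC1 : ContDiffOn ℝ 1 u closedStrip := by
    intro q hq
    have hT : 0 < q.2 + 1 := by linarith [show (0 : ℝ) ≤ q.2 from hq.2]
    have hqm : q ∈ closedRect (q.2 + 1) := ⟨hq.1, hq.2, by linarith⟩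
    have h1 := ((hs _ hT).1.contDiffOn hT).congr (hu _ hT) q hqm
    refine h1.mono_of_mem_nhdsWithin ?_
    have h2 : {p : ℝ × ℝ | p.2 < q.2 + 1} ∈ 𝓝 q :=
      (isOpen_lt continuous_snd continuous_const).mem_nhds (by simp)
    filter_upwards [mem_nhdsWithin_of_mem_nhds h2, self_mem_nhdsWithin] with p hp1 hp2
    exact ⟨hp2.1, hp2.2, le_of_lt hp1⟩
  have hstrip : strip ⊆ closedStrip := prod_mono Ioo_subset_Icc_self Ioi_subset_Ici_self
  refine ⟨u, ⟨hC1.continuousOn, hC1.mono hstrip, fun x hx t ht i => ?_, fun x hx => ?_,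
    fun t ht i => ?_⟩, hC1, fun w hw q hq => ?_⟩
  · have ht0 : (0 : ℝ) < t := ht
    have hT : 0 < t + 1 := by linarith
    have hq : (x, t) ∈ Ioo (0 : ℝ) 1 ×ˢ Ioo 0 (t + 1) := ⟨hx, ht0, by simp⟩
    have hm : (x, t) ∈ closedRect (t + 1) :=
      ⟨Ioo_subset_Icc_self hq.1, Ioo_subset_Icc_self hq.2⟩
    have hev : u =ᶠ[𝓝 (x, t)] vec (s (t + 1)).u := by
      filter_upwards [closedRect_mem_nhds hq] with q hq using hu _ hT hq
    have c1 : Tendsto (fun r => (x, r)) (𝓝 t) (𝓝 (x, t)) :=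
      (by fun_prop : Continuous fun r : ℝ => (x, r)).tendsto t
    have c2 : Tendsto (fun ξ => (ξ, t)) (𝓝 x) (𝓝 (x, t)) :=
      (by fun_prop : Continuous fun ξ : ℝ => (ξ, t)).tendsto x
    have d1 : HasDerivAt (fun r => u (x, r) i) ((s (t + 1)).p i (x, t)) t :=
      (((hs _ hT).1.deriv_snd i _ hm).hasDerivAt (Icc_mem_nhds hq.2.1 hq.2.2)
        ).congr_of_eventuallyEq ((c1.eventually hev).mono fun r hr =>
          congrArg (fun y : E n => y i) hr)
    have d2 : HasDerivAt (fun ξ => u (ξ, t) i) ((s (t + 1)).z i (x, t)) x :=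
      (((hs _ hT).1.deriv_fst i _ hm).hasDerivAt (Icc_mem_nhds hq.1.1 hq.1.2)
        ).congr_of_eventuallyEq ((c2.eventually hev).mono fun ξ hξ =>
          congrArg (fun y : E n => y i) hξ)
    rw [d1.deriv, d2.deriv, (hs _ hT).2.1 i _ hm, hu _ hT hm]
    rfl
  · have hm : (x, 0) ∈ closedRect 1 := ⟨Ioo_subset_Icc_self hx, le_rfl, zero_le_one⟩
    rw [hu 1 one_pos hm]
    exact (hloc 1 one_pos).init x (Ioo_subset_Icc_self hx)
  · have ht0 : (0 : ℝ) < t := ht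
    have htm : t ∈ Icc 0 t := ⟨ht0.le, le_rfl⟩
    have : (outTrace k fun x => u (x, t)) = outTrace k fun x => vec (s t).u (x, t) := by
      ext j
      have := congrArg (fun y : E n => y j) (hu t ht0 (mem_side (outflow_mem k j) htm))
      exact this
    rw [this, hu t ht0 (mem_side (inflow_mem k i) htm)]
    exact (hloc t ht0).bdry t htm i
  · have hT : 0 < q.2 + 1 := by linarith [show (0 : ℝ) ≤ q.2 from hq.2]
    exact (hw.isLocalSolution H (q.2 + 1)).eqOn H hT (hloc _ hT) ⟨hq.1, hq.2, by linarith⟩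

end HypIBVP

theorem mainTheorem4 (n k : ℕ) (hk : 1 ≤ k) (hkn : k ≤ n)
    (lam : Fin n → ℝ × ℝ → ℝ) (f : ℝ × ℝ → E n → E n) (φ : ℝ → E n) (h : ℝ → E n → E n)
    (hlam : ∀ i, SpeedRegular (lam i))
    (hneg : ∀ i : Fin n, i.val < k → ∀ p ∈ closedStrip, lam i p < 0)
    (hpos : ∀ i : Fin n, k ≤ i.val → ∀ p ∈ closedStrip, 0 < lam i p)
    (hf : SourceRegular f)
    (hφ : ContDiffOn ℝ 1 φ (Set.Icc 0 1))
    (hh : BoundaryRegular h)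
    (hhb : BoundaryGradBounded h)
    (hfg : SourceGradGrowth f)
    (hc0 : ZeroOrderCompatible k φ h)
    (hc1 : FirstOrderCompatible k lam f φ h) :
    ∃ u : ℝ × ℝ → E n,
      IsClassicalSolution k lam f φ h u ∧ ContDiffOn ℝ 1 u closedStrip ∧
      ∀ w : ℝ × ℝ → E n, IsClassicalSolution k lam f φ h w → Set.EqOn w u closedStrip := by
  exact Admissible.exists_unique_solution
    ⟨hlam, hneg, hpos, hf, hφ, hh, hhb, hfg, hc0, hc1⟩
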